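/- Let $M$ be a closed (compact, without boundary) oriented smooth manifold of even dimension $2n$, with a Riemannian metric. Let $\Lambda^*=\bigoplus_k\Lambda^k(T^*M\otimes\mathbb C)$, let $*$ be the complex linear extension of the Hodge star, so that $\alpha\wedge *\beta=\langle\alpha,\beta\rangle\,\mathrm{vol}$ with $\langle\cdot,\cdot\rangle$ extended complex bilinearly, and let $\tau=i^{\,n+k(k-1)}*:\Lambda^k\to\Lambda^{2n-k}$, an involution of $\Lambda^*$ with $(\pm1)$-eigenbundles $\Lambda^{\pm}$. Let $D=d+\delta$ on smooth complex differential forms, where $\delta=-*d*$ is the formal adjoint of the exterior derivative $d$. Let $$D^0:\Gamma(\Lambda^{\mathrm{even}})\to\Gamma(\Lambda^{\mathrm{odd}}),\qquad D^+:\Gamma(\Lambda^+)\to\Gamma(\Lambda^-),\qquad D^{0,+}:\Gamma(\Lambda^{\mathrm{even}}\cap\Lambda^+)\to\Gamma(\Lambda^{\mathrm{odd}}\cap\Lambda^-)$$ be the restrictions of $D$ (the de Rham operator, the signature operator, and their common part). For compact Hausdorff $X$ let $K(X)$ be the Grothendieck group of complex vector bundles, and let $\widetilde K$ of a pointed space be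 the kernel of restriction to the base point. Let $\pi:T^*M\to M$ be the cotangent bundle, with closed unit disc bundle $D(T^*M)$ and unit sphere bundle $S(T^*M)$, and let $K(T^*M)=\widetilde K\big(D(T^*M)/S(T^*M)\big)$. If $E_1,E_2$ are complex vector bundles over a compact Hausdorff space $X$ and $\sigma:E_1|_A\to E_2|_A$ is an isomorphism over a closed subset $A$, let $Y=X_1\cup_A X_2$ be two copies of $X$ glued along $A$, let $E_{1,2}$ be the bundle on $Y$ glued from $E_1$ on $X_1$ and $E_2$ on $X_2$ by $\sigma$, and $E_{2,2}$ the one glued from two copies of $E_2$ by the identity; $[E_1,E_2;\sigma]$ is the unique element of $\widetilde K(X/A)$ whose image in $K(Y)$ under $Y\to Y/X_2=X/A$ is $E_{1,2}-E_{2,2}$. The leading symbol of a first order operator $P:\Gamma(E_1)\to\Gamma(E_2)$ is the bundle map $\sigma(P):\pi^*E_1\to\pi^*E_2$ over $T^*M$ with $\sigma(P)(df_x)(s(x))=P(fs)(x)$ for smooth sections $s$ and smooth real functions $f$ with $f(x)=0$; $P$ is elliptic if $\sigma(P)$ is an isomorphism off the zero section, and its symbol class is then $[\sigma(P)]=[\pi^*E_1,\pi^*E_2;\sigma(P)|_{S(T^*M)}]\in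 K(T^*M)$. Main Theorem. The operators $D^0$, $D^+$, $D^{0,+}$ are elliptic, so that their symbol classes in $K(T^*M)$ are defined, and $$[\sigma(D^0)]\equiv[\sigma(D^+)]\pmod{2K(T^*M)},\qquad\text{where } 2K(T^*M)=\{\alpha+\alpha:\alpha\in K(T^*M)\}.$$ More precisely, $[\sigma(D^0)]+[\sigma(D^+)]=2\,[\sigma(D^{0,+})]$. -/

import Mathlib

open Topology
open scoped Manifold ContDiff Bundle
open Bundle (RiemannianBundle)

universe u v w

/-- A family of complex vector spaces over `X`: a complex vector space `fiber x` for every `x : X`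
and a topology on the total space. -/
structure VectFamily (X : Type u) where
  fiber : X → Type
  [addCommGroup : ∀ x, AddCommGroup (fiber x)]
  [module : ∀ x, Module ℂ (fiber x)]
  top : TopologicalSpace (Bundle.TotalSpace Unit fiber)

namespace VectFamily

attribute [instance] VectFamily.addCommGroup VectFamily.module

variable {X : Type u} {X' : Type v} {X'' : Type w}

/-- The total space of a family of vector spaces. -/
def Total (E : VectFamily X) : Type u := Bundle.TotalSpace Unit E.fiber

instance (E : VectFamily X) : TopologicalSpace E.Total := E.top

/-- The point of the total space given by a vector in a fiber. -/
def pt (E : VectFamily X) (x : X) (v : E.fiber x) : E.Total := ⟨x, v⟩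

/-- An isomorphism of families: fiberwise linear isomorphisms which form a homeomorphism of total
spaces. -/
structure Iso (E F : VectFamily X) where
  equiv : ∀ x, E.fiber x ≃ₗ[ℂ] F.fiber x
  continuous_hom : Continuous (fun p : E.Total => F.pt p.proj (equiv p.proj p.snd))
  continuous_inv : Continuous (fun p : F.Total => E.pt p.proj ((equiv p.proj).symm p.snd))

/-- The identity isomorphism. -/
def Iso.refl (E : VectFamily X) : Iso E E where
  equiv _ := LinearEquiv.refl ℂ _
  continuous_hom := continuous_id
  continuous_inv := continuous_id

/-- The inverse isomorphism. -/
def Iso.symm {E F : VectFamily X} (φ : Iso E F) : Iso F E where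
  equiv x := (φ.equiv x).symm
  continuous_hom := φ.continuous_inv
  continuous_inv := φ.continuous_hom

/-- The composition of isomorphisms. -/
def Iso.trans {E F G : VectFamily X} (φ : Iso E F) (ψ : Iso F G) : Iso E G where
  equiv x := (φ.equiv x).trans (ψ.equiv x)
  continuous_hom := ψ.continuous_hom.comp φ.continuous_hom
  continuous_inv := φ.continuous_inv.comp ψ.continuous_inv

/-- Local triviality: every point has an open neighbourhood `U` over which the family is isomorphic
to the product family `U × ℂ^ι`, for a finite type `ι`. The rank may vary from one connected
component to another. -/
def IsLocallyTrivial [TopologicalSpace X] (E : VectFamily X) : Prop :=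
  ∀ x₀ : X, ∃ (U : TopologicalSpace.Opens X) (ι : Type) (_ : Finite ι)
    (φ : ∀ x : U, (ι → ℂ) ≃ₗ[ℂ] E.fiber x), x₀ ∈ U ∧
      IsOpenEmbedding (fun p : U × (ι → ℂ) => E.pt p.1 (φ p.1 p.2))

/-- The pullback of a family along a map, as a subspace of `X' × E`. -/
def pullback [TopologicalSpace X'] (f : X' → X) (E : VectFamily X) : VectFamily X' where
  fiber x := E.fiber (f x)
  top := TopologicalSpace.induced
    (fun p => ((p.proj, E.pt (f p.proj) p.snd) : X' × E.Total)) inferInstance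

/-- The restriction of a family to a subspace. -/
def restrict [TopologicalSpace X] (E : VectFamily X) (A : Set X) : VectFamily A :=
  E.pullback (Subtype.val : A → X)

/-- The direct sum of two families, as a subspace of the product of total spaces. -/
def directSum (E F : VectFamily X) : VectFamily X where
  fiber x := E.fiber x × F.fiber x
  top := TopologicalSpace.induced
    (fun p => ((E.pt p.proj p.snd.1, F.pt p.proj p.snd.2) : E.Total × F.Total)) inferInstance

/-- The zero family. -/
def zero (X : Type u) [TopologicalSpace X] : VectFamily X where
  fiber _ := Unit
  top := TopologicalSpace.induced (fun p => p.proj) inferInstance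

section Isomorphisms

theorem continuous_directSum_fst (E F : VectFamily X) :
    Continuous (fun p : (E.directSum F).Total => E.pt p.proj p.snd.1) := by
  have h : Continuous (fun p : (E.directSum F).Total =>
      ((E.pt p.proj p.snd.1, F.pt p.proj p.snd.2) : E.Total × F.Total)) := continuous_induced_dom
  exact continuous_fst.comp h

theorem continuous_directSum_snd (E F : VectFamily X) :
    Continuous (fun p : (E.directSum F).Total => F.pt p.proj p.snd.2) := by
  have h : Continuous (fun p : (E.directSum F).Total =>
      ((E.pt p.proj p.snd.1, F.pt p.proj p.snd.2) : E.Total × F.Total)) := continuous_induced_dom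
  exact continuous_snd.comp h

theorem continuous_directSum_mk {Z : Type*} [TopologicalSpace Z] {E F : VectFamily X}
    {b : Z → X} {s : ∀ z, E.fiber (b z)} {t : ∀ z, F.fiber (b z)}
    (hs : Continuous fun z => E.pt (b z) (s z)) (ht : Continuous fun z => F.pt (b z) (t z)) :
    Continuous (fun z => (E.directSum F).pt (b z) (s z, t z)) :=
  continuous_induced_rng.2 (hs.prodMk ht)

/-- Direct sum of isomorphisms. -/
def Iso.directSum {E E' F F' : VectFamily X} (φ : Iso E E') (ψ : Iso F F') :
    Iso (E.directSum F) (E'.directSum F') where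
  equiv x := (φ.equiv x).prodCongr (ψ.equiv x)
  continuous_hom := continuous_directSum_mk
    (φ.continuous_hom.comp (continuous_directSum_fst E F))
    (ψ.continuous_hom.comp (continuous_directSum_snd E F))
  continuous_inv := continuous_directSum_mk
    (φ.continuous_inv.comp (continuous_directSum_fst E' F'))
    (ψ.continuous_inv.comp (continuous_directSum_snd E' F'))

/-- Commutativity of the direct sum. -/
def Iso.directSumComm (E F : VectFamily X) : Iso (E.directSum F) (F.directSum E) where
  equiv _ := LinearEquiv.prodComm ℂ _ _
  continuous_hom := continuous_directSum_mk
    (continuous_directSum_snd E F) (continuous_directSum_fst E F)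
  continuous_inv := continuous_directSum_mk
    (continuous_directSum_snd F E) (continuous_directSum_fst F E)

/-- Associativity of the direct sum. -/
def Iso.directSumAssoc (E F G : VectFamily X) :
    Iso ((E.directSum F).directSum G) (E.directSum (F.directSum G)) where
  equiv _ := LinearEquiv.prodAssoc ℂ _ _ _
  continuous_hom := continuous_directSum_mk
    ((continuous_directSum_fst E F).comp (continuous_directSum_fst _ G))
    (continuous_directSum_mk
      ((continuous_directSum_snd E F).comp (continuous_directSum_fst _ G))
      (continuous_directSum_snd _ G))
  continuous_inv := continuous_directSum_mk
    (continuous_directSum_mk (continuous_directSum_fst E _)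
      ((continuous_directSum_fst F G).comp (continuous_directSum_snd E _)))
    ((continuous_directSum_snd F G).comp (continuous_directSum_snd E _))

variable [TopologicalSpace X']

theorem continuous_pullback_pt (f : X' → X) (E : VectFamily X) :
    Continuous (fun p : (E.pullback f).Total => E.pt (f p.proj) p.snd) := by
  have h : Continuous (fun p : (E.pullback f).Total =>
      ((p.proj, E.pt (f p.proj) p.snd) : X' × E.Total)) := continuous_induced_dom
  exact continuous_snd.comp h

theorem continuous_pullback_proj (f : X' → X) (E : VectFamily X) :
    Continuous (fun p : (E.pullback f).Total => p.proj) := by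
  have h : Continuous (fun p : (E.pullback f).Total =>
      ((p.proj, E.pt (f p.proj) p.snd) : X' × E.Total)) := continuous_induced_dom
  exact continuous_fst.comp h

theorem continuous_pullback_mk {Z : Type*} [TopologicalSpace Z] {f : X' → X} {E : VectFamily X}
    {b : Z → X'} {s : ∀ z, E.fiber (f (b z))} (hb : Continuous b)
    (hs : Continuous fun z => E.pt (f (b z)) (s z)) :
    Continuous (fun z => (E.pullback f).pt (b z) (s z)) :=
  continuous_induced_rng.2 (hb.prodMk hs)

/-- Pullback of isomorphisms. -/
def Iso.pullback (f : X' → X) {E F : VectFamily X} (φ : Iso E F) :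
    Iso (E.pullback f) (F.pullback f) where
  equiv x := φ.equiv (f x)
  continuous_hom := continuous_pullback_mk (continuous_pullback_proj f E)
    (φ.continuous_hom.comp (continuous_pullback_pt f E))
  continuous_inv := continuous_pullback_mk (continuous_pullback_proj f F)
    (φ.continuous_inv.comp (continuous_pullback_pt f F))

/-- Pullback commutes with direct sums. -/
def Iso.pullbackDirectSum (f : X' → X) (E F : VectFamily X) :
    Iso ((E.directSum F).pullback f) ((E.pullback f).directSum (F.pullback f)) where
  equiv _ := LinearEquiv.refl ℂ _
  continuous_hom := continuous_directSum_mk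
    (continuous_pullback_mk (continuous_pullback_proj f _)
      ((continuous_directSum_fst E F).comp (continuous_pullback_pt f _)))
    (continuous_pullback_mk (continuous_pullback_proj f _)
      ((continuous_directSum_snd E F).comp (continuous_pullback_pt f _)))
  continuous_inv := continuous_pullback_mk
    ((continuous_pullback_proj f E).comp (continuous_directSum_fst _ _))
    (continuous_directSum_mk
      ((continuous_pullback_pt f E).comp (continuous_directSum_fst _ _))
      ((continuous_pullback_pt f F).comp (continuous_directSum_snd _ _)))

end Isomorphisms

section Lemmas

variable [TopologicalSpace X] [TopologicalSpace X']

theorem IsLocallyTrivial.continuous_proj {E : VectFamily X} (hE : E.IsLocallyTrivial) :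
    Continuous (fun p : E.Total => p.proj) := by
  rw [continuous_iff_continuousAt]
  rintro ⟨x, v⟩
  obtain ⟨U, ι, _, φ, hx, hφ⟩ := hE x
  have h1 : (⟨x, v⟩ : E.Total) =
      (fun p : U × (ι → ℂ) => E.pt p.1 (φ p.1 p.2)) (⟨x, hx⟩, (φ ⟨x, hx⟩).symm v) := by
    simp [pt]
  rw [h1, hφ.continuousAt_iff.symm]
  exact (continuous_subtype_val.comp continuous_fst).continuousAt

theorem isLocallyTrivial_pullback {E : VectFamily X} (hE : E.IsLocallyTrivial) {f : X' → X}
    (hf : Continuous f) : (E.pullback f).IsLocallyTrivial := by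
  intro x₀
  obtain ⟨U, ι, hι, φ, hx, hφ⟩ := hE (f x₀)
  refine ⟨⟨f ⁻¹' U, U.isOpen.preimage hf⟩, ι, hι, fun x => φ ⟨f x, x.2⟩, hx, ?_⟩
  let j : (E.pullback f).Total → X' × E.Total := fun p => (p.proj, E.pt (f p.proj) p.snd)
  have hj : Continuous j := continuous_induced_dom
  let h : (f ⁻¹' U : Set X') × (ι → ℂ) → X' × (U × (ι → ℂ)) :=
    fun p => (p.1, (⟨f p.1, p.1.2⟩, p.2))
  have hh : IsEmbedding h := by
    have : IsEmbedding ((Prod.map id Prod.snd : X' × (U × (ι → ℂ)) → X' × (ι → ℂ)) ∘ h) :=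
      IsEmbedding.prodMap IsEmbedding.subtypeVal IsEmbedding.id
    refine IsEmbedding.of_comp ?_ (by fun_prop) this
    fun_prop
  have hcomp : IsEmbedding (j ∘ fun p : (f ⁻¹' U : Set X') × (ι → ℂ) =>
      (E.pullback f).pt p.1 (φ ⟨f p.1, p.1.2⟩ p.2)) :=
    (IsEmbedding.prodMap IsEmbedding.id hφ.isEmbedding).comp hh
  have hcont : Continuous (fun p : (f ⁻¹' U : Set X') × (ι → ℂ) =>
      (E.pullback f).pt p.1 (φ ⟨f p.1, p.1.2⟩ p.2)) :=
    continuous_induced_rng.2 hcomp.continuous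
  refine ⟨IsEmbedding.of_comp hcont hj hcomp, ?_⟩
  have hr : Set.range (fun p : (f ⁻¹' U : Set X') × (ι → ℂ) =>
      (E.pullback f).pt p.1 (φ ⟨f p.1, p.1.2⟩ p.2)) = (fun p => (j p).1) ⁻¹' (f ⁻¹' U) := by
    ext ⟨x, v⟩
    constructor
    · rintro ⟨⟨y, w⟩, h⟩
      have := congrArg (fun q : (E.pullback f).Total => q.proj) h
      have h2 : (y : X') = x := this
      change f x ∈ U
      rw [← h2]
      exact y.2
    · intro hxU
      exact ⟨(⟨x, hxU⟩, (φ ⟨f x, hxU⟩).symm v),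
        congrArg ((E.pullback f).pt x) ((φ ⟨f x, hxU⟩).apply_symm_apply v)⟩
  exact hr ▸ (U.isOpen.preimage hf).preimage (continuous_fst.comp hj)

theorem isLocallyTrivial_directSum {E F : VectFamily X} (hE : E.IsLocallyTrivial)
    (hF : F.IsLocallyTrivial) : (E.directSum F).IsLocallyTrivial := by
  intro x₀
  obtain ⟨U, ι, hι, φ, hx, hφ⟩ := hE x₀
  obtain ⟨V, κ, hκ, ψ, hx', hψ⟩ := hF x₀
  let θ : ∀ x : (U ⊓ V : TopologicalSpace.Opens X),
      (ι ⊕ κ → ℂ) ≃ₗ[ℂ] (E.directSum F).fiber x := fun x =>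
    (LinearEquiv.sumArrowLequivProdArrow ι κ ℂ ℂ).trans
      ((φ ⟨x, x.2.1⟩).prodCongr (ψ ⟨x, x.2.2⟩))
  refine ⟨U ⊓ V, ι ⊕ κ, inferInstance, θ, ⟨hx, hx'⟩, ?_⟩
  let j : (E.directSum F).Total → E.Total × F.Total :=
    fun p => (E.pt p.proj p.snd.1, F.pt p.proj p.snd.2)
  have hj : Continuous j := continuous_induced_dom
  let h : (U ⊓ V : TopologicalSpace.Opens X) × (ι ⊕ κ → ℂ) → (U × (ι → ℂ)) × (V × (κ → ℂ)) :=
    fun p => ((⟨p.1, p.1.2.1⟩, fun i => p.2 (Sum.inl i)), (⟨p.1, p.1.2.2⟩, fun i => p.2 (Sum.inr i)))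
  have hh : IsEmbedding h := by
    let r : (U × (ι → ℂ)) × (V × (κ → ℂ)) → X × (ι ⊕ κ → ℂ) :=
      fun q => (q.1.1, Sum.elim q.1.2 q.2.2)
    have hr : Continuous r := by
      refine Continuous.prodMk (by fun_prop) (continuous_pi ?_)
      rintro (i | i)
      · change Continuous fun q : (U × (ι → ℂ)) × (V × (κ → ℂ)) => q.1.2 i
        fun_prop
      · change Continuous fun q : (U × (ι → ℂ)) × (V × (κ → ℂ)) => q.2.2 i
        fun_prop
    have hrh : r ∘ h = Prod.map Subtype.val id := by
      funext p
      refine Prod.ext rfl (funext ?_)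
      rintro (i | i) <;> rfl
    have : IsEmbedding (r ∘ h) := by
      rw [hrh]
      exact IsEmbedding.prodMap IsEmbedding.subtypeVal IsEmbedding.id
    exact IsEmbedding.of_comp (by fun_prop) hr this
  let P := fun p : (U ⊓ V : TopologicalSpace.Opens X) × (ι ⊕ κ → ℂ) =>
      (E.directSum F).pt p.1 (θ p.1 p.2)
  have hcomp : IsEmbedding (j ∘ P) :=
    (IsEmbedding.prodMap hφ.isEmbedding hψ.isEmbedding).comp hh
  have hcont : Continuous P := continuous_induced_rng.2 hcomp.continuous
  refine ⟨IsEmbedding.of_comp hcont hj hcomp, ?_⟩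
  have hr : Set.range P =
      j ⁻¹' ((fun q => q.1.proj) ⁻¹' (U : Set X) ∩ (fun q => q.2.proj) ⁻¹' (V : Set X)) := by
    ext ⟨x, v⟩
    constructor
    · rintro ⟨⟨y, w⟩, h⟩
      have h2 : (y : X) = x := congrArg (fun q : (E.directSum F).Total => q.proj) h
      change x ∈ U ∧ x ∈ V
      rw [← h2]
      exact y.2
    · intro hxU
      exact ⟨(⟨x, hxU⟩, (θ ⟨x, hxU⟩).symm v),
        congrArg ((E.directSum F).pt x) ((θ ⟨x, hxU⟩).apply_symm_apply v)⟩
  change IsOpen (Set.range P)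
  rw [hr]
  exact ((U.isOpen.preimage (hE.continuous_proj.comp continuous_fst)).inter
    (V.isOpen.preimage (hF.continuous_proj.comp continuous_snd))).preimage hj

theorem isLocallyTrivial_zero : (zero X).IsLocallyTrivial := by
  intro x₀
  refine ⟨⊤, Empty, inferInstance, fun x =>
    { toFun := fun _ => (), invFun := fun _ => 0, map_add' := fun _ _ => rfl,
      map_smul' := fun _ _ => rfl, left_inv := fun _ => Subsingleton.elim _ _,
      right_inv := fun _ => rfl }, trivial, ?_⟩
  let j : (zero X).Total → X := fun p => p.proj
  have hj : IsHomeomorph j := by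
    refine isHomeomorph_iff_exists_inverse.2 ⟨continuous_induced_dom,
      fun x => ⟨x, ()⟩, fun _ => rfl, fun _ => rfl, continuous_induced_rng.2 continuous_id⟩
  refine IsOpenEmbedding.of_comp _ hj.isOpenEmbedding ?_
  change IsOpenEmbedding ((Subtype.val : (⊤ : TopologicalSpace.Opens X) → X) ∘
    (Prod.fst : (⊤ : TopologicalSpace.Opens X) × (Empty → ℂ) → _))
  exact (TopologicalSpace.Opens.isOpenEmbedding' ⊤).comp
    (Homeomorph.prodUnique (⊤ : TopologicalSpace.Opens X) (Empty → ℂ)).isOpenEmbedding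

/-- The zero family is neutral for the direct sum of vector bundles. -/
def Iso.directSumZero (E : VectFamily X) (hE : E.IsLocallyTrivial) :
    Iso (E.directSum (zero X)) E where
  equiv _ := LinearEquiv.prodUnique (R := ℂ) (M₂ := Unit)
  continuous_hom := continuous_directSum_fst E _
  continuous_inv := continuous_directSum_mk continuous_id
    (continuous_induced_rng.2 hE.continuous_proj)

/-- Pullback of the zero family. -/
def Iso.pullbackZero {f : X' → X} (hf : Continuous f) : Iso ((zero X).pullback f) (zero X') where
  equiv _ := LinearEquiv.refl ℂ _
  continuous_hom := continuous_induced_rng.2 (continuous_pullback_proj f _)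
  continuous_inv := continuous_pullback_mk continuous_induced_dom
    (continuous_induced_rng.2 (hf.comp continuous_induced_dom))

end Lemmas

end VectFamily

/-- A complex vector bundle over `X`: a locally trivial family of complex vector spaces. -/
def CVectBundle (X : Type u) [TopologicalSpace X] := {E : VectFamily X // E.IsLocallyTrivial}

section KTheory

variable (X : Type u) [TopologicalSpace X] {X' : Type v} [TopologicalSpace X']

/-- Two vector bundles are equivalent if they are isomorphic. -/
instance CVectBundle.setoid : Setoid (CVectBundle X) where
  r E F := Nonempty (VectFamily.Iso E.1 F.1)
  iseqv :=
    { refl := fun E => ⟨VectFamily.Iso.refl E.1⟩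
      symm := fun ⟨φ⟩ => ⟨φ.symm⟩
      trans := fun ⟨φ⟩ ⟨ψ⟩ => ⟨φ.trans ψ⟩ }

/-- The set of isomorphism classes of complex vector bundles over `X`. -/
def Vect := Quotient (CVectBundle.setoid X)

/-- Addition of isomorphism classes is the direct sum. -/
instance Vect.add : Add (Vect X) where
  add := Quotient.map₂
    (fun E F => ⟨E.1.directSum F.1, VectFamily.isLocallyTrivial_directSum E.2 F.2⟩)
    (fun _ _ ⟨φ⟩ _ _ ⟨ψ⟩ => ⟨φ.directSum ψ⟩)

/-- The class of the zero bundle. -/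
instance Vect.instZero : Zero (Vect X) where
  zero := Quotient.mk _ ⟨VectFamily.zero X, VectFamily.isLocallyTrivial_zero⟩

/-- The isomorphism classes of complex vector bundles form a commutative monoid under direct
sum. -/
instance Vect.addCommMonoid : AddCommMonoid (Vect X) where
  add_assoc := by
    rintro ⟨E⟩ ⟨F⟩ ⟨G⟩
    exact Quotient.sound ⟨VectFamily.Iso.directSumAssoc E.1 F.1 G.1⟩
  add_comm := by
    rintro ⟨E⟩ ⟨F⟩
    exact Quotient.sound ⟨VectFamily.Iso.directSumComm E.1 F.1⟩
  zero_add := by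
    rintro ⟨E⟩
    exact Quotient.sound
      ⟨(VectFamily.Iso.directSumComm _ E.1).trans (VectFamily.Iso.directSumZero E.1 E.2)⟩
  add_zero := by
    rintro ⟨E⟩
    exact Quotient.sound ⟨VectFamily.Iso.directSumZero E.1 E.2⟩
  nsmul := nsmulRec

/-- Pullback of isomorphism classes of vector bundles along a continuous map. -/
def Vect.pullback {X : Type u} [TopologicalSpace X] (f : C(X', X)) : Vect X →+ Vect X' where
  toFun := Quotient.map
    (fun E => ⟨E.1.pullback f, VectFamily.isLocallyTrivial_pullback E.2 f.continuous⟩)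
    (fun _ _ ⟨φ⟩ => ⟨φ.pullback f⟩)
  map_zero' := Quotient.sound ⟨VectFamily.Iso.pullbackZero f.continuous⟩
  map_add' := by
    rintro ⟨E⟩ ⟨F⟩
    exact Quotient.sound ⟨VectFamily.Iso.pullbackDirectSum f E.1 F.1⟩

/-- The group `K(X)`: the Grothendieck group of the monoid of isomorphism classes of complex vector
bundles over `X` (used for compact Hausdorff `X`). -/
abbrev KGroup : Type _ := Algebra.GrothendieckAddGroup (Vect X)

variable {X}

/-- The class of a vector bundle in `K(X)`. -/
noncomputable def KGroup.cls (E : CVectBundle X) : KGroup X :=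
  Algebra.GrothendieckAddGroup.of (Quotient.mk _ E : Vect X)

/-- The homomorphism `f^* : K(X) → K(X')` induced by a continuous map `f : X' → X`. -/
noncomputable def KGroup.map (f : C(X', X)) : KGroup X →+ KGroup X' :=
  Algebra.GrothendieckAddGroup.lift (Algebra.GrothendieckAddGroup.of.comp (Vect.pullback f))

/-- The reduced group of a pointed space `(X, x₀)`: the kernel of the restriction
`K(X) → K({x₀})`. -/
noncomputable def KReduced (x₀ : X) : AddSubgroup (KGroup X) :=
  (KGroup.map (ContinuousMap.const Unit x₀)).ker

/-- The relation which collapses `A` to the base point. For empty `A` the quotient is `X` with a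
disjoint base point. -/
inductive CollapseRel (A : Set X) : X ⊕ Unit → X ⊕ Unit → Prop
  | mk (a : X) (ha : a ∈ A) : CollapseRel A (Sum.inl a) (Sum.inr ())

/-- The pointed quotient space `X / A`. -/
def Collapse (A : Set X) : Type u := Quot (CollapseRel A)

instance (A : Set X) : TopologicalSpace (Collapse A) :=
  inferInstanceAs (TopologicalSpace (Quot _))

/-- The base point of `X / A`. -/
def Collapse.base (A : Set X) : Collapse A := Quot.mk _ (Sum.inr ())

/-- The relative group `K(X, A)`, that is, the reduced group of `X / A`. -/
noncomputable abbrev KRel (A : Set X) := KReduced (Collapse.base A)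

/-- The relation which glues two copies of `X` along `A`. -/
inductive DoubleRel (A : Set X) : X ⊕ X → X ⊕ X → Prop
  | mk (a : X) (ha : a ∈ A) : DoubleRel A (Sum.inl a) (Sum.inr a)

/-- The space `Y = X₁ ∪_A X₂` obtained from two copies of `X` by gluing them along `A`. -/
def Double (A : Set X) : Type u := Quot (DoubleRel A)

instance (A : Set X) : TopologicalSpace (Double A) :=
  inferInstanceAs (TopologicalSpace (Quot _))

/-- The inclusion of the first copy of `X`. -/
def Double.left (A : Set X) (x : X) : Double A := Quot.mk _ (Sum.inl x)

/-- The inclusion of the second copy of `X`. -/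
def Double.right (A : Set X) (x : X) : Double A := Quot.mk _ (Sum.inr x)

/-- The map `Y → Y / X₂ = X / A`. -/
def Double.collapse (A : Set X) : C(Double A, Collapse A) where
  toFun := Quot.lift (Sum.elim (fun x => Quot.mk _ (Sum.inl x)) (fun _ => Collapse.base A))
    (by rintro _ _ ⟨a, ha⟩; exact Quot.sound ⟨a, ha⟩)
  continuous_toFun := by
    refine continuous_coinduced_dom.2 (Continuous.sumElim ?_ continuous_const)
    exact continuous_quot_mk.comp continuous_inl

/-- `G` is obtained by gluing `E₁` over the first copy of `X` with `E₂` over the second copy via the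
isomorphism `σ : E₁|_A ≅ E₂|_A`: there are isomorphisms of `E₁` and `E₂` with the two restrictions
of `G` under which, over `A`, each `v` is identified with `σ v`. -/
def IsGluing {A : Set X} (E₁ E₂ : VectFamily X)
    (σ : VectFamily.Iso (E₁.restrict A) (E₂.restrict A)) (G : VectFamily (Double A)) : Prop :=
  ∃ (α : VectFamily.Iso E₁ (G.pullback (Double.left A)))
    (β : VectFamily.Iso E₂ (G.pullback (Double.right A))),
    ∀ (a : A) (v : E₁.fiber a),
      G.pt (Double.left A a) (α.equiv a v) = G.pt (Double.right A a) (β.equiv a (σ.equiv a v))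

/-- `c ∈ K̃(X / A)` is the class `[E₁, E₂; σ]`: its image in `K(Y)` is `E₁₂ - E₂₂`, where `E₁₂` is
glued from `E₁` and `E₂` by `σ`, and `E₂₂` is glued from `E₂` and `E₂` by the identity. -/
def IsDifferenceClass {A : Set X} (E₁ E₂ : VectFamily X)
    (σ : VectFamily.Iso (E₁.restrict A) (E₂.restrict A)) (c : KRel A) : Prop :=
  ∃ E₁₂ E₂₂ : CVectBundle (Double A), IsGluing E₁ E₂ σ E₁₂.1 ∧
    IsGluing E₂ E₂ (VectFamily.Iso.refl (E₂.restrict A)) E₂₂.1 ∧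
    KGroup.map (Double.collapse A) c = KGroup.cls E₁₂ - KGroup.cls E₂₂

end KTheory

section Hodge

variable {V : Type*} [NormedAddCommGroup V] [InnerProductSpace ℝ V] {m : ℕ}
  [FiniteDimensional ℝ V] [Fact (Module.finrank ℝ V = m)]

theorem append_update_comp_cast {W : Type*} {k l : ℕ} (h : k + l = k + l) (u : Fin k → W)
    (w : Fin l → W) (i : Fin l) (z : W) :
    (Fin.append u (Function.update w i z) ∘ Fin.cast h) =
      Function.update (Fin.append u w) (Fin.natAdd k i) z := by
  funext j
  refine Fin.addCases (fun j => ?_) (fun j => ?_) j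
  · have hne : Fin.castAdd l j ≠ Fin.natAdd k i := by
      intro hh
      have := congrArg Fin.val hh
      simp at this
      omega
    simp [Function.update_of_ne hne]
  · by_cases hj : j = i
    · subst hj
      simp
    · have hne : Fin.natAdd k j ≠ Fin.natAdd k i := by simpa using hj
      simp [Function.update_of_ne hne, Function.update_of_ne hj]

/-- The contraction `η(u₁, …, u_k, ·, …, ·)` of an alternating `m`-form `η` with `k` vectors, an
alternating `l`-form, where `k + l = m`. -/
noncomputable def contract {F : Type*} [NormedAddCommGroup F] [NormedSpace ℝ F]
    (η : V [⋀^Fin m]→L[ℝ] F) {k l : ℕ} (h : k + l = m) (u : Fin k → V) :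
    V [⋀^Fin l]→L[ℝ] F where
  toFun w := η (Fin.append u w ∘ Fin.cast h.symm)
  map_update_add' := by
    intro inst w i x y
    obtain rfl : inst = instDecidableEqFin l := Subsingleton.elim _ _
    subst h
    simpa only [append_update_comp_cast] using
      η.map_update_add (Fin.append u w) (Fin.natAdd k i) x y
  map_update_smul' := by
    intro inst w i c x
    obtain rfl : inst = instDecidableEqFin l := Subsingleton.elim _ _
    subst h
    simpa only [append_update_comp_cast] using
      η.map_update_smul (Fin.append u w) (Fin.natAdd k i) c x
  cont := by
    subst h
    refine η.cont.comp (continuous_pi fun j => ?_)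
    refine Fin.addCases (fun j => ?_) (fun j => ?_) j
    · simpa using continuous_const
    · simpa using continuous_apply j
  map_eq_zero_of_eq' := by
    intro w i j hw hij
    subst h
    refine η.map_eq_zero_of_eq _ (i := Fin.natAdd k i) (j := Fin.natAdd k j) ?_ ?_
    · simpa using hw
    · simpa using hij

/-- The volume form of an oriented Euclidean space, as a complex valued alternating form. -/
noncomputable def volForm (o : Orientation ℝ V (Fin m)) : V [⋀^Fin m]→L[ℝ] ℂ :=
  Complex.ofRealCLM.compContinuousAlternatingMap
    (o.volumeForm.mkContinuous 1 fun v => by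
      simpa using o.abs_volumeForm_apply_le v)

/-- The Hodge star `∗ : Λ^k ⊗ ℂ → Λ^l ⊗ ℂ`, where `k + l = m`, extended complex linearly from real
forms: `∗β = (1 / k!) ∑ β(e_{i₁}, …, e_{i_k}) vol(e_{i₁}, …, e_{i_k}, ·)`, where `(e_i)` is an
orthonormal basis and the sum is over all multi-indices. This is the map with
`α ∧ ∗β = ⟨α, β⟩ vol`. -/
noncomputable def hodgeStar (o : Orientation ℝ V (Fin m)) {k l : ℕ} (h : k + l = m) :
    (V [⋀^Fin k]→L[ℝ] ℂ) →ₗ[ℂ] (V [⋀^Fin l]→L[ℝ] ℂ) :=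
  let e : OrthonormalBasis (Fin m) ℝ V := (stdOrthonormalBasis ℝ V).reindex (finCongr Fact.out)
  { toFun := fun β => ((k.factorial : ℂ)⁻¹) • ∑ i : Fin k → Fin m,
      β (fun a => e (i a)) • contract (volForm o) h (fun a => e (i a))
    map_add' := by
      intro α β
      simp only [ContinuousAlternatingMap.add_apply, add_smul, Finset.sum_add_distrib, smul_add]
    map_smul' := by
      intro c β
      simp only [ContinuousAlternatingMap.smul_apply, smul_assoc, ← Finset.smul_sum,
        RingHom.id_apply]
      rw [smul_comm] }

end Hodge

section Manifold

variable (n : ℕ) {M : Type u} [TopologicalSpace M]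
  [ChartedSpace (EuclideanSpace ℝ (Fin (2 * n))) M]

/-- The fiber at `x` of `Λ^*(T^*M ⊗ ℂ)`: the `k`-th component is an alternating `k`-form on `T_x M`
with values in `ℂ`. The components with `k > 2n` vanish automatically, so that the product over all
`k` is the direct sum of the `Λ^k` with `0 ≤ k ≤ 2n`. -/
abbrev ExtFiber (x : M) : Type :=
  ∀ k : ℕ, TangentSpace (𝓡 (2 * n)) x [⋀^Fin k]→L[ℝ] ℂ

variable (M) in
/-- Not necessarily smooth sections of `Λ^*`. -/
abbrev FormField : Type u := ∀ x : M, ExtFiber n x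

variable {n}

/-- The expression of the degree `k` part of a form in the preferred chart at `x₀`: the pullback by
the inverse of the chart. -/
noncomputable def formInChart (x₀ : M) (η : FormField n M) (k : ℕ)
    (y : EuclideanSpace ℝ (Fin (2 * n))) : EuclideanSpace ℝ (Fin (2 * n)) [⋀^Fin k]→L[ℝ] ℂ :=
  (η ((extChartAt (𝓡 (2 * n)) x₀).symm y) k).compContinuousLinearMap
    (mfderiv 𝓘(ℝ, EuclideanSpace ℝ (Fin (2 * n))) (𝓡 (2 * n))
      (extChartAt (𝓡 (2 * n)) x₀).symm y)

/-- Smoothness of a complex differential form (of mixed degree). -/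
def IsSmoothForm (η : FormField n M) : Prop :=
  ∀ (x₀ : M) (k : ℕ),
    ContDiffOn ℝ ∞ (formInChart x₀ η k) (extChartAt (𝓡 (2 * n)) x₀).target

/-- The exterior derivative, computed at each point in the preferred chart at that point. -/
noncomputable def dForm (η : FormField n M) : FormField n M := fun x k =>
  match k with
  | 0 => 0
  | k + 1 => (extDeriv (formInChart x η k)
      (extChartAt (𝓡 (2 * n)) x x)).compContinuousLinearMap
        (mfderiv (𝓡 (2 * n)) 𝓘(ℝ, EuclideanSpace ℝ (Fin (2 * n))) (extChartAt (𝓡 (2 * n)) x) x)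

variable (n M) in
/-- An orientation of `M`: an orientation of every tangent space which is locally constant in the
local trivializations of the tangent bundle. -/
structure ManifoldOrientation [IsManifold (𝓡 (2 * n)) ∞ M] where
  orient : ∀ x : M, Orientation ℝ (TangentSpace (𝓡 (2 * n)) x) (Fin (2 * n))
  locally_constant : ∀ x₀ : M, ∃ o₀ : Orientation ℝ (EuclideanSpace ℝ (Fin (2 * n))) (Fin (2 * n)),
    ∀ᶠ x in 𝓝 x₀, ∃ hx : x ∈ (trivializationAt (EuclideanSpace ℝ (Fin (2 * n)))
      (TangentSpace (𝓡 (2 * n)) : M → Type _) x₀).baseSet,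
      Orientation.map (Fin (2 * n))
        ((trivializationAt (EuclideanSpace ℝ (Fin (2 * n)))
          (TangentSpace (𝓡 (2 * n)) : M → Type _) x₀).continuousLinearEquivAt ℝ x hx).toLinearEquiv
        (orient x) = o₀

variable [IsManifold (𝓡 (2 * n)) ∞ M]

/-- The family of vector spaces given by a subspace `W x` of `Λ^*_x` for every `x`. The topology is
induced by the topologies of the bundles `Λ^k`. -/
noncomputable def subFamily (W : ∀ x : M, Submodule ℂ (ExtFiber n x)) : VectFamily M where
  fiber x := W x
  top := TopologicalSpace.induced
    (fun p => ((fun k => ⟨p.proj, p.snd.1 k⟩) : ∀ k : ℕ,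
      Bundle.TotalSpace (EuclideanSpace ℝ (Fin (2 * n)) [⋀^Fin k]→L[ℝ] ℂ)
        (fun x : M => TangentSpace (𝓡 (2 * n)) x [⋀^Fin k]→L[ℝ] Bundle.Trivial M ℂ x)))
    inferInstance

/-- `s` is a smooth section of the family of subspaces `W`. -/
def IsSmoothSection (W : ∀ x : M, Submodule ℂ (ExtFiber n x)) (s : FormField n M) : Prop :=
  IsSmoothForm s ∧ ∀ x, s x ∈ W x

variable (n) in
/-- The forms of even degree, `Λ^even`. -/
def extEven (x : M) : Submodule ℂ (ExtFiber n x) where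
  carrier := {η | ∀ k, Odd k → η k = 0}
  add_mem' := by
    intro a b ha hb k hk
    simp [ha k hk, hb k hk]
  zero_mem' := fun _ _ => rfl
  smul_mem' := by
    intro c a ha k hk
    simp [ha k hk]

variable (n) in
/-- The forms of odd degree, `Λ^odd`. -/
def extOdd (x : M) : Submodule ℂ (ExtFiber n x) where
  carrier := {η | ∀ k, Even k → η k = 0}
  add_mem' := by
    intro a b ha hb k hk
    simp [ha k hk, hb k hk]
  zero_mem' := fun _ _ => rfl
  smul_mem' := by
    intro c a ha k hk
    simp [ha k hk]

variable (n M) in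
/-- The total space of the cotangent bundle `T^*M`. -/
abbrev Cotangent : Type u :=
  Bundle.TotalSpace (EuclideanSpace ℝ (Fin (2 * n)) →L[ℝ] ℝ)
    (fun x : M => TangentSpace (𝓡 (2 * n)) x →L[ℝ] Bundle.Trivial M ℝ x)

/-- `σ` is the leading symbol of the first order operator `P` from sections of `W₁` to sections
of `W₂`: `σ(df_x)(s(x)) = P(f s)(x)` for all smooth sections `s` of `W₁` and all smooth real
functions `f` with `f(x) = 0`. -/
def IsPrincipalSymbol (W₁ W₂ : ∀ x : M, Submodule ℂ (ExtFiber n x))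
    (P : FormField n M → FormField n M)
    (σ : ∀ p : Cotangent n M, W₁ p.proj →ₗ[ℂ] W₂ p.proj) : Prop :=
  ∀ (x : M) (f : M → ℝ) (s : FormField n M) (hs : IsSmoothSection W₁ s),
    ContMDiff (𝓡 (2 * n)) 𝓘(ℝ, ℝ) ∞ f → f x = 0 →
      ((σ ⟨x, mfderiv (𝓡 (2 * n)) 𝓘(ℝ, ℝ) f x⟩ ⟨s x, hs.2 x⟩ : W₂ x) : ExtFiber n x) =
        P (fun y => (f y : ℂ) • s y) x

variable [RiemannianBundle (fun x : M => TangentSpace (𝓡 (2 * n)) x)]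

instance finiteDimensional_tangentSpace (x : M) :
    FiniteDimensional ℝ (TangentSpace (𝓡 (2 * n)) x) :=
  inferInstanceAs (FiniteDimensional ℝ (EuclideanSpace ℝ (Fin (2 * n))))

instance fact_finrank_tangentSpace (x : M) :
    Fact (Module.finrank ℝ (TangentSpace (𝓡 (2 * n)) x) = 2 * n) :=
  ⟨finrank_euclideanSpace_fin (𝕜 := ℝ) (n := 2 * n)⟩

/-- The Hodge star on `Λ^*_x`. Its component of degree `l` is the star of the component of degree
`2n - l`. -/
noncomputable def starAt (o : ManifoldOrientation n M) (x : M) : ExtFiber n x →ₗ[ℂ] ExtFiber n x :=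
  LinearMap.pi fun l =>
    if h : l ≤ 2 * n then
      (hodgeStar (V := TangentSpace (𝓡 (2 * n)) x) (o.orient x) (Nat.sub_add_cancel h)).comp
        (LinearMap.proj (2 * n - l))
    else 0

/-- The involution `τ = i^{n + k (k - 1)} ∗ : Λ^k → Λ^{2n - k}`; its component of degree `l` comes
from degree `k = 2n - l`. -/
noncomputable def tauAt (o : ManifoldOrientation n M) (x : M) : ExtFiber n x →ₗ[ℂ] ExtFiber n x :=
  LinearMap.pi fun l =>
    (Complex.I ^ (n + (2 * n - l) * (2 * n - l - 1))) •
      (LinearMap.proj l).comp (starAt o x)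

/-- The eigenbundle `Λ^+` of `τ` for the eigenvalue `1`. -/
noncomputable def extPlus (o : ManifoldOrientation n M) (x : M) : Submodule ℂ (ExtFiber n x) :=
  Module.End.eigenspace (tauAt o x) 1

/-- The eigenbundle `Λ^-` of `τ` for the eigenvalue `-1`. -/
noncomputable def extMinus (o : ManifoldOrientation n M) (x : M) : Submodule ℂ (ExtFiber n x) :=
  Module.End.eigenspace (tauAt o x) (-1)

/-- The codifferential, that is, the formal adjoint of `d`, which in even dimension is
`δ = -∗d∗` in all degrees. -/
noncomputable def codiff (o : ManifoldOrientation n M) (η : FormField n M) : FormField n M :=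
  fun x => -starAt o x (dForm (fun y => starAt o y (η y)) x)

/-- The operator `D = d + δ`. -/
noncomputable def hodgeDirac (o : ManifoldOrientation n M) (η : FormField n M) : FormField n M :=
  dForm η + codiff o η

variable (n M) in
/-- The closed unit disc bundle `D(T^*M)`. -/
def CodiscBundle : Type u := {p : Cotangent n M // ‖p.snd‖ ≤ 1}

noncomputable instance : TopologicalSpace (CodiscBundle n M) := instTopologicalSpaceSubtype

variable (n M) in
/-- The unit sphere bundle `S(T^*M)`, as a subset of `D(T^*M)`. -/
def cosphere : Set (CodiscBundle n M) := {p | ‖p.1.snd‖ = 1}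

variable (n M) in
/-- The group `K(T^*M)`, that is, the reduced `K`-group of `D(T^*M) / S(T^*M)`. -/
noncomputable abbrev KCotangent := KRel (cosphere n M)

/-- The pullback `π^*W` to the disc bundle. -/
noncomputable def liftToDisc (W : ∀ x : M, Submodule ℂ (ExtFiber n x)) : VectFamily (CodiscBundle n M) :=
  (subFamily W).pullback (fun p : CodiscBundle n M => p.1.proj)

/-- `P` is an elliptic first order operator from smooth sections of `W₁` to smooth sections of `W₂`,
and `c ∈ K(T^*M)` is its symbol class `[π^*W₁, π^*W₂; σ(P)]`. -/
def IsSymbolClass (W₁ W₂ : ∀ x : M, Submodule ℂ (ExtFiber n x))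
    (P : FormField n M → FormField n M) (c : KCotangent n M) : Prop :=
  (∀ s, IsSmoothSection W₁ s → IsSmoothSection W₂ (P s)) ∧
  ∃ σ : ∀ p : Cotangent n M, W₁ p.proj →ₗ[ℂ] W₂ p.proj,
    IsPrincipalSymbol W₁ W₂ P σ ∧
    (∀ p : Cotangent n M, p.snd ≠ 0 → Function.Bijective (σ p)) ∧
    ∃ Φ : VectFamily.Iso ((liftToDisc W₁).restrict (cosphere n M))
        ((liftToDisc W₂).restrict (cosphere n M)),
      (∀ (p : cosphere n M) (v : W₁ p.1.1.proj), Φ.equiv p v = σ p.1.1 v) ∧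
      IsDifferenceClass (liftToDisc W₁) (liftToDisc W₂) Φ c

end Manifold

set_option linter.unusedSectionVars false

namespace VectFamily

/-! The bundle `Λ^*` carries two gradings, by the parity of the degree and by the eigenvalue of `τ`.
They are compatible because `2n` is even, and `D` reverses both: it changes the parity, and it
anticommutes with `τ` (`hodgeDirac_tau`). So `D` maps even∩plus to odd∩minus and even∩minus to
odd∩plus, and back again. Let `a`, `b`, `b'` be the classes of its symbol from even∩plus to
odd∩minus, from even∩minus to odd∩plus, and from odd∩plus to even∩minus. The symbols of `D^0` and
`D^+` are block diagonal for these splittings, so their classes are `a + b` and `a + b'`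
(`CliffordPair.isDifferenceClass_of_splits`). Once `b' = -b` is known, the sum is `2a` and the
difference is `2b`.

The symbol of `D` at a covector `ξ` is Clifford multiplication `c(ξ) = ξ∧ - ι_ξ`, with `c(ξ)² =
-|ξ|²` (`clifford_clifford`); this gives ellipticity. It also gives `b + b' = 0`. The operator with
both diagonal blocks `c(ξ)` and both off-diagonal blocks `√(1 - |ξ|²)` is invertible over the whole
disc bundle, and on the sphere bundle it is the direct sum of the two symbols
(`CliffordPair.rotationIso`). An isomorphism that extends over the whole space has class zero
(`IsDifferenceClass.eq_zero`).

For these classes to make sense, the difference class must exist and be unique. Vector bundles over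
a compact Hausdorff space are treated as images of continuous idempotents on a fixed vector space,
so that gluing and descent to quotients become statements about matrix valued functions. Existence
is `exists_isDifferenceClass`, by clutching after stabilization. Uniqueness rests on the injectivity
of the reduced group of `X / A` into `K(Y)` (`KRel.eq_zero_of_map_collapse`).

The geometric input comes from Gram-Schmidt frames: in an oriented orthonormal frame the star, `τ`
and the projections onto all the subbundles are constant endomorphisms. This yields the smoothness
of `D η`, the local triviality of the subbundles and the continuity of the symbol. The symbol is
uniquely determined, since every covector is a differential and every vector of a subbundle is the
value of a smooth section. -/

theorem pt_injective {X : Type u} {E : VectFamily X} {x : X} {v w : E.fiber x}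
    (h : E.pt x v = E.pt x w) : v = w :=
  eq_of_heq (Bundle.TotalSpace.mk.inj h).2

/-! ### Local triviality, and families of images of idempotents. -/

section Basic

variable {X : Type u} [TopologicalSpace X]

/-- A family with continuous projection is locally trivial as soon as it is locally isomorphic to a
product with a finite dimensional topological vector space. -/
theorem isLocallyTrivial_of_exists {E : VectFamily X} (hp : Continuous fun p : E.Total => p.proj)
    (h : ∀ x₀ : X, ∃ (U : TopologicalSpace.Opens X) (W : Type) (_ : AddCommGroup W)
      (_ : Module ℂ W) (_ : TopologicalSpace W) (_ : IsTopologicalAddGroup W)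
      (_ : ContinuousSMul ℂ W) (_ : T2Space W) (_ : FiniteDimensional ℂ W)
      (φ : ∀ x : U, W ≃ₗ[ℂ] E.fiber x), x₀ ∈ U ∧
      Continuous (fun p : U × W => E.pt p.1 (φ p.1 p.2)) ∧
      Continuous (fun p : {p : E.Total // p.proj ∈ U} => (φ ⟨p.1.proj, p.2⟩).symm p.1.snd)) :
    E.IsLocallyTrivial := by
  intro x₀
  obtain ⟨U, W, _, _, _, _, _, _, _, φ, hx, h1, h2⟩ := h x₀
  -- A finite dimensional Hausdorff topological vector space is some `ℂ^d`. Allowing any such `W`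
  -- lets kernels and ranges serve as model fibers without a choice of basis.
  let e : W ≃L[ℂ] (Fin (Module.finrank ℂ W) → ℂ) :=
    (Module.finBasis ℂ W).equivFun.toContinuousLinearEquiv
  refine ⟨U, Fin (Module.finrank ℂ W), inferInstance,
    fun x => e.symm.toLinearEquiv.trans (φ x), hx, ?_⟩
  let H : (U × (Fin (Module.finrank ℂ W) → ℂ)) ≃ₜ {p : E.Total // p.proj ∈ U} :=
    { toFun := fun p => ⟨E.pt p.1 (φ p.1 (e.symm p.2)), p.1.2⟩
      invFun := fun p => (⟨p.1.proj, p.2⟩, e ((φ ⟨p.1.proj, p.2⟩).symm p.1.snd))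
      left_inv := fun p => Prod.ext rfl
        ((congrArg e ((φ p.1).symm_apply_apply _)).trans (e.apply_symm_apply p.2))
      right_inv := fun p => Subtype.ext (congrArg (E.pt p.1.proj)
        ((congrArg (φ ⟨p.1.proj, p.2⟩) (e.symm_apply_apply _)).trans
          ((φ ⟨p.1.proj, p.2⟩).apply_symm_apply p.1.snd)))
      continuous_toFun := by
        refine Continuous.subtype_mk ?_ _
        exact h1.comp (continuous_fst.prodMk (e.symm.continuous.comp continuous_snd))
      continuous_invFun := by
        refine Continuous.prodMk ?_ (e.continuous.comp h2)
        exact Continuous.subtype_mk (hp.comp continuous_subtype_val) _ }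
  exact (U.isOpen.preimage hp).isOpenEmbedding_subtypeVal.comp H.isOpenEmbedding

/-- The inverse of a local trivialization is continuous. -/
theorem continuous_symm_of_isOpenEmbedding {E : VectFamily X} {U : TopologicalSpace.Opens X}
    {ι : Type} (φ : ∀ x : U, (ι → ℂ) ≃ₗ[ℂ] E.fiber x)
    (hφ : IsOpenEmbedding (fun p : U × (ι → ℂ) => E.pt p.1 (φ p.1 p.2)))
    {Z : Type*} [TopologicalSpace Z] {b : Z → U} {s : ∀ z, E.fiber (b z)}
    (hs : Continuous fun z => E.pt (b z) (s z)) : Continuous fun z => (φ (b z)).symm (s z) := by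
  have : Continuous fun z => ((b z, (φ (b z)).symm (s z)) : U × (ι → ℂ)) := by
    rw [hφ.isEmbedding.continuous_iff]
    simpa [Function.comp_def] using hs
  exact continuous_snd.comp this

end Basic

section Idempotent

variable {X : Type u} [TopologicalSpace X] {X' : Type v} [TopologicalSpace X']
variable {V W : Type} [NormedAddCommGroup V] [NormedSpace ℂ V]
  [NormedAddCommGroup W] [NormedSpace ℂ W]

/-- The family of the images of a family of endomorphisms of a fixed vector space. -/
def imFamily (p : X → V →L[ℂ] V) : VectFamily X where
  fiber x := LinearMap.range (p x : V →ₗ[ℂ] V)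
  top := TopologicalSpace.induced (fun q => ((q.proj, (q.snd : V)) : X × V)) inferInstance

/-- The inclusion of the fibers of a family of images. -/
def imIncl (p : X → V →L[ℂ] V) (x : X) : (imFamily p).fiber x →ₗ[ℂ] V :=
  (LinearMap.range (p x : V →ₗ[ℂ] V)).subtype

theorem continuous_imFamily_proj (p : X → V →L[ℂ] V) :
    Continuous fun q : (imFamily p).Total => q.proj := by
  have h : Continuous (fun q : (imFamily p).Total => ((q.proj, imIncl p q.proj q.snd) : X × V)) :=
    continuous_induced_dom
  exact continuous_fst.comp h

theorem continuous_imFamily_val (p : X → V →L[ℂ] V) :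
    Continuous fun q : (imFamily p).Total => imIncl p q.proj q.snd := by
  have h : Continuous (fun q : (imFamily p).Total => ((q.proj, imIncl p q.proj q.snd) : X × V)) :=
    continuous_induced_dom
  exact continuous_snd.comp h

theorem continuous_imFamily_mk {Z : Type*} [TopologicalSpace Z] {p : X → V →L[ℂ] V} {b : Z → X}
    {s : ∀ z, (imFamily p).fiber (b z)} (hb : Continuous b) (hs : Continuous fun z => imIncl p (b z) (s z)) :
    Continuous fun z => (imFamily p).pt (b z) (s z) :=
  continuous_induced_rng.2 (hb.prodMk hs)

theorem imFamily_apply_coe {p : X → V →L[ℂ] V} (hp : ∀ x, p x ∘L p x = p x) (x : X)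
    (v : (imFamily p).fiber x) : p x (imIncl p x v) = imIncl p x v := by
  obtain ⟨_, w, rfl⟩ := v
  exact congrArg (fun f : V →L[ℂ] V => f w) (hp x)

/-- Families of mutually inverse maps between images of idempotents give an isomorphism. -/
noncomputable def imFamilyIso {p : X → V →L[ℂ] V} {q : X → W →L[ℂ] W}
    (hp : ∀ x, p x ∘L p x = p x) (hq : ∀ x, q x ∘L q x = q x)
    {s : X → V →L[ℂ] W} {t : X → W →L[ℂ] V} (hs : Continuous s) (ht : Continuous t)
    (hts : ∀ x, t x ∘L s x = p x) (hst : ∀ x, s x ∘L t x = q x) :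
    Iso (imFamily p) (imFamily q) where
  equiv x := LinearEquiv.ofLinearMap
    ((s x : V →ₗ[ℂ] W).restrict (p := LinearMap.range (p x : V →ₗ[ℂ] V))
      (q := LinearMap.range (q x : W →ₗ[ℂ] W)) (by
        rintro _ ⟨w, rfl⟩
        refine ⟨s x w, ?_⟩
        simp [← hst, ← hts]))
    ((t x : W →ₗ[ℂ] V).restrict (p := LinearMap.range (q x : W →ₗ[ℂ] W))
      (q := LinearMap.range (p x : V →ₗ[ℂ] V)) (by
        rintro _ ⟨w, rfl⟩
        refine ⟨t x w, ?_⟩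
        simp [← hst, ← hts]))
    (by
      refine LinearMap.ext fun v => Subtype.ext ?_
      exact (congrArg (fun f : W →L[ℂ] W => f v.1) (hst x)).trans (imFamily_apply_coe hq x v))
    (by
      refine LinearMap.ext fun v => Subtype.ext ?_
      exact (congrArg (fun f : V →L[ℂ] V => f v.1) (hts x)).trans (imFamily_apply_coe hp x v))
  continuous_hom := continuous_imFamily_mk (continuous_imFamily_proj p)
    ((hs.comp (continuous_imFamily_proj p)).clm_apply (continuous_imFamily_val p))
  continuous_inv := continuous_imFamily_mk (continuous_imFamily_proj q)
    ((ht.comp (continuous_imFamily_proj q)).clm_apply (continuous_imFamily_val q))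

/-- Pullback of a family of images. -/
def imFamilyPullback (p : X → V →L[ℂ] V) {f : X' → X} (hf : Continuous f) :
    Iso ((imFamily p).pullback f) (imFamily fun x => p (f x)) where
  equiv _ := LinearEquiv.refl ℂ _
  continuous_hom := continuous_imFamily_mk (p := fun x => p (f x)) (continuous_pullback_proj f _)
    ((continuous_imFamily_val p).comp (continuous_pullback_pt f _))
  continuous_inv := continuous_pullback_mk (continuous_imFamily_proj fun x => p (f x))
    (continuous_imFamily_mk (hf.comp (continuous_imFamily_proj fun x => p (f x)))
      (continuous_imFamily_val fun x => p (f x)))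

/-- The element `a x = p x p x₀ + (1 - p x)(1 - p x₀)` intertwines `p x₀` with `p x` and equals `1`
at `x₀`. It is therefore invertible near `x₀`, where it carries the image of `p x₀` onto that of `p
x`. Units are open and inversion is continuous, so this is a local trivialization. -/
theorem isLocallyTrivial_imFamily [FiniteDimensional ℂ V] {p : X → V →L[ℂ] V} (hc : Continuous p)
    (hp : ∀ x, p x ∘L p x = p x) : (imFamily p).IsLocallyTrivial := by
  have : CompleteSpace V := FiniteDimensional.complete ℂ V
  refine isLocallyTrivial_of_exists (continuous_imFamily_proj p) fun x₀ => ?_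
  let a : X → V →L[ℂ] V := fun x => p x * p x₀ + (1 - p x) * (1 - p x₀)
  have ha : Continuous a := by fun_prop
  have hpp : ∀ x, p x * p x = p x := hp
  have ha0 : a x₀ = 1 := by
    simp only [a, mul_sub, sub_mul, hpp, mul_one, one_mul]
    abel
  have hcomm : ∀ x, p x * a x = a x * p x₀ := by
    intro x
    simp only [a, mul_add, add_mul, mul_sub, sub_mul, mul_one, one_mul, ← mul_assoc, hpp]
    simp only [mul_assoc, hpp]
    abel
  let U : TopologicalSpace.Opens X := ⟨{x | IsUnit (a x)}, Units.isOpen.preimage ha⟩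
  have hinv : ∀ x ∈ U, Ring.inverse (a x) * p x = p x₀ * Ring.inverse (a x) := by
    intro x hx
    have h1 : a x * Ring.inverse (a x) = 1 := Ring.mul_inverse_cancel _ hx
    have h2 : Ring.inverse (a x) * a x = 1 := Ring.inverse_mul_cancel _ hx
    calc Ring.inverse (a x) * p x = Ring.inverse (a x) * (p x * a x) * Ring.inverse (a x) := by
          rw [mul_assoc, mul_assoc, h1, mul_one]
      _ = p x₀ * Ring.inverse (a x) := by rw [hcomm, ← mul_assoc, h2, one_mul]
  refine ⟨U, LinearMap.range (p x₀ : V →ₗ[ℂ] V), inferInstance, inferInstance, inferInstance,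
    inferInstance, inferInstance, inferInstance, inferInstance, fun x => LinearEquiv.ofLinearMap
    ((a x : V →ₗ[ℂ] V).restrict (p := LinearMap.range (p x₀ : V →ₗ[ℂ] V))
      (q := LinearMap.range (p x : V →ₗ[ℂ] V)) ?_)
    (((Ring.inverse (a x) : V →L[ℂ] V) : V →ₗ[ℂ] V).restrict (p := LinearMap.range (p x : V →ₗ[ℂ] V))
      (q := LinearMap.range (p x₀ : V →ₗ[ℂ] V)) ?_) ?_ ?_, ?_, ?_, ?_⟩
  · rintro _ ⟨w, rfl⟩
    exact ⟨a x w, congrArg (fun f : V →L[ℂ] V => f w) (hcomm x)⟩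
  · rintro _ ⟨w, rfl⟩
    exact ⟨(Ring.inverse (a x) : V →L[ℂ] V) w, (congrArg (fun f : V →L[ℂ] V => f w) (hinv x x.2)).symm⟩
  · refine LinearMap.ext fun v => Subtype.ext ?_
    exact congrArg (fun f : V →L[ℂ] V => f v.1) (Ring.mul_inverse_cancel _ x.2)
  · refine LinearMap.ext fun v => Subtype.ext ?_
    exact congrArg (fun f : V →L[ℂ] V => f v.1) (Ring.inverse_mul_cancel _ x.2)
  · change IsUnit (a x₀)
    exact ha0 ▸ isUnit_one
  · refine continuous_imFamily_mk (continuous_subtype_val.comp continuous_fst) ?_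
    exact ((ha.comp continuous_subtype_val).comp continuous_fst).clm_apply
      (continuous_subtype_val.comp continuous_snd)
  · refine Continuous.subtype_mk ?_ _
    have h : Continuous fun x : U => Ring.inverse (a x) := by
      rw [continuous_iff_continuousAt]
      intro x
      obtain ⟨y, hy⟩ := x.2
      have := NormedRing.inverse_continuousAt y
      rw [hy] at this
      exact this.comp (f := fun x : U => a x) (ha.comp continuous_subtype_val).continuousAt
    have h' : Continuous fun q : {q : (imFamily p).Total // q.proj ∈ U} =>
        (⟨q.1.proj, q.2⟩ : U) :=
      Continuous.subtype_mk ((continuous_imFamily_proj p).comp continuous_subtype_val) _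
    exact (h.comp h').clm_apply ((continuous_imFamily_val p).comp continuous_subtype_val)

end Idempotent

end VectFamily

/-! ### Vector bundles as direct summands of product bundles. -/

namespace VectFamily

section Retract

variable {X : Type u} [TopologicalSpace X] {X' : Type v} [TopologicalSpace X']

/-- A presentation of a family as a direct summand of a product family `X × V`. -/
structure Retract (E : VectFamily X) (V : Type) [NormedAddCommGroup V] [NormedSpace ℂ V] where
  incl : ∀ x, E.fiber x →ₗ[ℂ] V
  retr : ∀ x, V →ₗ[ℂ] E.fiber x
  retr_incl : ∀ x v, retr x (incl x v) = v
  continuous_incl : Continuous fun p : E.Total => incl p.proj p.snd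
  continuous_retr : Continuous fun q : X × V => E.pt q.1 (retr q.1 q.2)

/-- A function which is continuous over an open set and vanishes off a closed subset of it is
continuous. -/
theorem continuous_of_zero_off {Z W : Type*} [TopologicalSpace Z] [TopologicalSpace W] [Zero W]
    {b : Z → X} (hb : Continuous b) {U C : Set X} (hU : IsOpen U) (hC : IsClosed C) (hCU : C ⊆ U)
    {g : Z → W} (h1 : Continuous fun z : {z // b z ∈ U} => g z) (h2 : ∀ z, b z ∉ C → g z = 0) :
    Continuous g := by
  -- Only points of the closed support need checking. It lies over `C`, hence over the open set
  -- where `g` is known to be continuous.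
  refine continuous_of_tsupport fun z hz => ?_
  have hz' : b z ∈ U := by
    refine hCU ?_
    have : tsupport g ⊆ b ⁻¹' C :=
      closure_minimal (fun z hz => by_contra fun h => hz (h2 z h)) (hC.preimage hb)
    exact this hz
  exact ((hU.preimage hb).isOpenEmbedding_subtypeVal.continuousAt_iff (x := ⟨z, hz'⟩)).1
    h1.continuousAt

theorem exists_finite_trivialization [CompactSpace X] {E : VectFamily X}
    (hE : E.IsLocallyTrivial) : ∃ (N : ℕ) (U : Fin N → TopologicalSpace.Opens X)
      (κ : Fin N → Type) (_ : ∀ j, Finite (κ j)) (φ : ∀ j, ∀ x : U j, (κ j → ℂ) ≃ₗ[ℂ] E.fiber x),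
      (∀ x, ∃ j, x ∈ U j) ∧
      ∀ j, IsOpenEmbedding (fun p : U j × (κ j → ℂ) => E.pt p.1 (φ j p.1 p.2)) := by
  choose U κ hκ φ hx hφ using hE
  obtain ⟨t, ht⟩ := isCompact_univ.elim_finite_subcover (fun x => (U x : Set X))
    (fun x => (U x).isOpen) (fun x _ => Set.mem_iUnion.2 ⟨x, hx x⟩)
  refine ⟨t.card, fun j => U (t.equivFin.symm j), fun j => κ (t.equivFin.symm j),
    fun j => hκ _, fun j => φ (t.equivFin.symm j), fun x => ?_, fun j => hφ _⟩
  obtain ⟨y, hy, hxy⟩ := Set.mem_iUnion₂.1 (ht (Set.mem_univ x))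
  exact ⟨t.equivFin ⟨y, hy⟩, by simpa using hxy⟩

/-- A partition of unity subordinate to a finite trivializing cover embeds the bundle into the
product of the model fibers: the inclusion collects the weighted local coordinates, and the
retraction sums up the weighted local inverses. -/
theorem exists_retract [CompactSpace X] [T2Space X] {E : VectFamily X} (hE : E.IsLocallyTrivial) :
    ∃ (V : Type) (_ : NormedAddCommGroup V) (_ : NormedSpace ℂ V) (_ : FiniteDimensional ℂ V),
      Nonempty (Retract E V) := by
  classical
  obtain ⟨N, U, κ, hκ, φ, hx, hφ⟩ := exists_finite_trivialization hE
  have := fun j => Fintype.ofFinite (κ j)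
  obtain ⟨ρ, hρ⟩ := PartitionOfUnity.exists_isSubordinate isClosed_univ (fun j => (U j : Set X))
    (fun j => (U j).isOpen) (fun x _ => Set.mem_iUnion.2 (hx x))
  -- The square roots share each weight equally between inclusion and retraction, so that their
  -- composition has total weight `∑ ρ j = 1`.
  let r : Fin N → X → ℂ := fun j x => (Real.sqrt (ρ j x) : ℂ)
  have hr : ∀ j, Continuous (r j) := fun j =>
    Complex.continuous_ofReal.comp (Real.continuous_sqrt.comp (ρ j).continuous)
  have hr0 : ∀ j x, x ∉ tsupport (ρ j) → r j x = 0 := fun j x h => by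
    simp [r, image_eq_zero_of_notMem_tsupport h]
  let c : ∀ j x, E.fiber x →ₗ[ℂ] (κ j → ℂ) := fun j x =>
    if h : x ∈ U j then r j x • ((φ j ⟨x, h⟩).symm : E.fiber x →ₗ[ℂ] (κ j → ℂ)) else 0
  let d : ∀ j x, (κ j → ℂ) →ₗ[ℂ] E.fiber x := fun j x =>
    if h : x ∈ U j then r j x • (φ j ⟨x, h⟩ : (κ j → ℂ) →ₗ[ℂ] E.fiber x) else 0
  have hdc : ∀ j x v, d j x (c j x v) = (ρ j x : ℂ) • v := by
    intro j x v
    by_cases h : x ∈ U j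
    · simp only [c, d, dif_pos h, LinearMap.smul_apply, map_smul, smul_smul, r,
        LinearEquiv.coe_coe, LinearEquiv.apply_symm_apply]
      rw [← Complex.ofReal_mul, Real.mul_self_sqrt (ρ.nonneg j x)]
    · have h0 : ρ j x = 0 := image_eq_zero_of_notMem_tsupport fun h' => h (hρ j h')
      simp [c, d, h, h0]
  refine ⟨∀ j, κ j → ℂ, inferInstance, inferInstance, inferInstance,
    ⟨{ incl := fun x => LinearMap.pi fun j => c j x
       retr := fun x => ∑ j, (d j x).comp (LinearMap.proj j)
       retr_incl := fun x v => ?_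
       continuous_incl := ?_
       continuous_retr := ?_ }⟩⟩
  · simp only [LinearMap.sum_apply, LinearMap.comp_apply, LinearMap.proj_apply, LinearMap.pi_apply,
      hdc, ← Finset.sum_smul]
    have := ρ.sum_eq_one (Set.mem_univ x)
    rw [finsum_eq_sum_of_fintype] at this
    rw [← Complex.ofReal_sum, this, Complex.ofReal_one, one_smul]
  · refine continuous_pi fun j => ?_
    refine continuous_of_zero_off hE.continuous_proj (U j).isOpen (isClosed_tsupport (ρ j)) (hρ j)
      ?_ ?_
    · have h1 : Continuous fun z : {z : E.Total // z.proj ∈ (U j : Set X)} =>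
          r j z.1.proj • (φ j ⟨z.1.proj, z.2⟩).symm z.1.snd := by
        refine ((hr j).comp (hE.continuous_proj.comp continuous_subtype_val)).smul ?_
        exact continuous_symm_of_isOpenEmbedding (φ j) (hφ j)
          (b := fun z : {z : E.Total // z.proj ∈ (U j : Set X)} => ⟨z.1.proj, z.2⟩)
          (s := fun z => z.1.snd) continuous_subtype_val
      refine h1.congr fun z => ?_
      have hz : z.1.proj ∈ U j := z.2
      simp [c, hz]
    · intro z hz
      simp only [LinearMap.pi_apply, c]
      split_ifs
      · simp [hr0 j _ hz]
      · simp
  -- The target of the retraction varies with the point, so continuity is tested in one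
  -- trivialization `φ k`. There the `j`-th summand is a transition map times `r j`, and it extends
  -- by zero off the support of `ρ j`.
  · rw [continuous_iff_continuousAt]
    rintro ⟨x₀, w₀⟩
    obtain ⟨k, hk⟩ := hx x₀
    refine (((U k).isOpen.preimage continuous_fst).isOpenEmbedding_subtypeVal.continuousAt_iff
      (x := ⟨(x₀, w₀), hk⟩)).1 (Continuous.continuousAt ?_)
    have h1 : Continuous fun z : {z : X × (∀ j, κ j → ℂ) // z.1 ∈ (U k : Set X)} =>
        ∑ j, (φ k ⟨z.1.1, z.2⟩).symm (d j z.1.1 (z.1.2 j)) := by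
      refine continuous_finsetSum _ fun j _ => ?_
      refine continuous_of_zero_off (b := fun z : {z : X × (∀ j, κ j → ℂ) // z.1 ∈ (U k : Set X)} =>
        z.1.1) (by fun_prop) (U j).isOpen (isClosed_tsupport (ρ j)) (hρ j) ?_ ?_
      · have h2 : Continuous fun z : {z : {z : X × (∀ j, κ j → ℂ) // z.1 ∈ (U k : Set X)} //
            z.1.1 ∈ (U j : Set X)} => r j z.1.1.1 •
              (φ k ⟨z.1.1.1, z.1.2⟩).symm (φ j ⟨z.1.1.1, z.2⟩ (z.1.1.2 j)) := by
          refine ((hr j).comp (by fun_prop)).smul ?_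
          refine continuous_symm_of_isOpenEmbedding (φ k) (hφ k)
            (b := fun z : {z : {z : X × (∀ j, κ j → ℂ) // z.1 ∈ (U k : Set X)} //
              z.1.1 ∈ (U j : Set X)} => ⟨z.1.1.1, z.1.2⟩)
            (s := fun z => φ j ⟨z.1.1.1, z.2⟩ (z.1.1.2 j)) ?_
          exact (hφ j).continuous.comp (Continuous.prodMk (Continuous.subtype_mk (by fun_prop) _)
            (by fun_prop))
        refine h2.congr fun z => ?_
        have hz : z.1.1.1 ∈ U j := z.2
        simp [d, hz]
      · intro z hz
        simp only [d]
        split_ifs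
        · simp [hr0 j _ hz]
        · simp
    have h3 := (hφ k).continuous.comp (Continuous.prodMk (Continuous.subtype_mk
      (p := fun x => x ∈ U k) (f := fun z : {z : X × (∀ j, κ j → ℂ) // z.1 ∈ (U k : Set X)} =>
        z.1.1) (by fun_prop) fun z => z.2) h1)
    refine h3.congr fun z => ?_
    refine congrArg (E.pt z.1.1) ?_
    simp only [map_sum, LinearEquiv.apply_symm_apply, LinearMap.sum_apply,
      LinearMap.comp_apply, LinearMap.proj_apply]

variable {E E' : VectFamily X} {V V' : Type} [NormedAddCommGroup V] [NormedSpace ℂ V]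
  [NormedAddCommGroup V'] [NormedSpace ℂ V']

/-- Pullback of a presentation. -/
def Retract.pullback (R : Retract E V) {f : X' → X} (hf : Continuous f) :
    Retract (E.pullback f) V where
  incl x := R.incl (f x)
  retr x := R.retr (f x)
  retr_incl x := R.retr_incl (f x)
  continuous_incl := R.continuous_incl.comp (continuous_pullback_pt f E)
  continuous_retr := continuous_pullback_mk continuous_fst
    (R.continuous_retr.comp ((hf.comp continuous_fst).prodMk continuous_snd))

variable [FiniteDimensional ℂ V] [FiniteDimensional ℂ V']

/-- The expression of an isomorphism in terms of two presentations. -/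
noncomputable def Retract.matrix (R : Retract E V) (R' : Retract E' V') (φ : Iso E E') (x : X) :
    V →L[ℂ] V' :=
  LinearMap.toContinuousLinearMap (R'.incl x ∘ₗ (φ.equiv x : E.fiber x →ₗ[ℂ] E'.fiber x) ∘ₗ R.retr x)

@[simp] theorem Retract.matrix_apply (R : Retract E V) (R' : Retract E' V') (φ : Iso E E') (x : X)
    (v : V) : R.matrix R' φ x v = R'.incl x (φ.equiv x (R.retr x v)) := rfl

theorem Retract.continuous_matrix (R : Retract E V) (R' : Retract E' V') (φ : Iso E E') :
    Continuous (R.matrix R' φ) := by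
  refine continuous_clm_apply.2 fun v => ?_
  exact R'.continuous_incl.comp (φ.continuous_hom.comp
    (R.continuous_retr.comp (continuous_id.prodMk continuous_const)))

/-- The idempotent given by a presentation. -/
noncomputable def Retract.idem (R : Retract E V) (x : X) : V →L[ℂ] V := R.matrix R (Iso.refl E) x

theorem Retract.idem_apply (R : Retract E V) (x : X) (v : V) :
    R.idem x v = R.incl x (R.retr x v) := rfl

theorem Retract.idem_comp_idem (R : Retract E V) (x : X) : R.idem x ∘L R.idem x = R.idem x := by
  ext v
  simp [Retract.idem_apply, R.retr_incl]

/-- The inner retraction cancels the inner inclusion, so matrices compose like the isomorphisms,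
with the idempotent in the role of the identity. -/
theorem Retract.matrix_comp_matrix (R : Retract E V) (R' : Retract E' V') (φ : Iso E E') (x : X) :
    R'.matrix R φ.symm x ∘L R.matrix R' φ x = R.idem x := by
  ext v
  simp [Retract.idem_apply, R'.retr_incl, Iso.symm]

/-- A locally trivial family is isomorphic to the image of the idempotent of a presentation. -/
noncomputable def Retract.iso (R : Retract E V) (hE : E.IsLocallyTrivial) : Iso E (imFamily R.idem) where
  equiv x := LinearEquiv.ofLinearMap
    ((R.incl x).codRestrict (LinearMap.range (R.idem x : V →ₗ[ℂ] V))
      fun v => ⟨R.incl x v, by simp [Retract.idem_apply, R.retr_incl]⟩)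
    ((R.retr x) ∘ₗ imIncl R.idem x)
    (by
      refine LinearMap.ext fun v => Subtype.ext ?_
      exact imFamily_apply_coe R.idem_comp_idem x v)
    (LinearMap.ext fun v => R.retr_incl x v)
  continuous_hom := continuous_imFamily_mk hE.continuous_proj R.continuous_incl
  continuous_inv := R.continuous_retr.comp
    ((continuous_imFamily_proj _).prodMk (continuous_imFamily_val _))

/-- The presentation of the image of a family of idempotents. -/
noncomputable def imRetract {p : X → V →L[ℂ] V} (hc : Continuous p) (hp : ∀ x, p x ∘L p x = p x) :
    Retract (imFamily p) V where
  incl x := imIncl p x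
  retr x := (p x : V →ₗ[ℂ] V).rangeRestrict
  retr_incl x v := Subtype.ext (imFamily_apply_coe hp x v)
  continuous_incl := continuous_imFamily_val p
  continuous_retr := continuous_imFamily_mk continuous_fst
    ((hc.comp continuous_fst).clm_apply continuous_snd)

end Retract

end VectFamily

/-! ### Topology of the double `Y` and of the quotient `X / A`. -/

section DoubleCollapse

variable {X : Type u} [TopologicalSpace X] {A : Set X}

theorem Double.continuous_left : Continuous (Double.left A) := continuous_quot_mk.comp continuous_inl

theorem Double.continuous_right : Continuous (Double.right A) :=
  continuous_quot_mk.comp continuous_inr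

theorem Double.left_eq_right {a : X} (ha : a ∈ A) : Double.left A a = Double.right A a :=
  Quot.sound ⟨a, ha⟩

/-- A function on the double is given by two functions which agree on `A`. -/
def Double.desc {Z : Type*} (f g : X → Z) (h : ∀ a ∈ A, f a = g a) : Double A → Z :=
  Quot.lift (Sum.elim f g) (by rintro _ _ ⟨a, ha⟩; exact h a ha)

theorem Double.continuous_desc {Z : Type*} [TopologicalSpace Z] {f g : X → Z}
    {h : ∀ a ∈ A, f a = g a} (hf : Continuous f) (hg : Continuous g) :
    Continuous (Double.desc f g h) :=
  continuous_coinduced_dom.2 (hf.sumElim hg)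

theorem Double.ind {P : Double A → Prop} (h1 : ∀ x, P (Double.left A x))
    (h2 : ∀ x, P (Double.right A x)) (y : Double A) : P y :=
  Quot.ind (by rintro (x | x); exacts [h1 x, h2 x]) y

/-- The folding map `Y → X`. -/
def Double.fold (A : Set X) : Double A → X := Double.desc id id fun _ _ => rfl

theorem Double.continuous_fold : Continuous (Double.fold A) :=
  Double.continuous_desc continuous_id continuous_id

instance [CompactSpace X] (A : Set X) : CompactSpace (Double A) :=
  inferInstanceAs (CompactSpace (Quot _))

instance [CompactSpace X] (A : Set X) : CompactSpace (Collapse A) :=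
  inferInstanceAs (CompactSpace (Quot _))

/-- Points with different images under the folding map are separated already in `X`. The only other
pairs are the two copies of a point outside `A`, and the two copies of the open complement of `A`
are disjoint open sets. -/
theorem Double.t2Space [T2Space X] (hA : IsClosed A) : T2Space (Double A) := by
  have key : ∀ x ∉ A, ∃ U V : Set (Double A), IsOpen U ∧ IsOpen V ∧ Double.left A x ∈ U ∧
      Double.right A x ∈ V ∧ Disjoint U V := by
    intro x hx
    -- Subsets are written as `Prop` valued functions so that they can be defined on the quotient by
    -- `Double.desc`.
    let s : Double A → Prop := Double.desc (fun x => x ∉ A) (fun _ => False)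
      fun a ha => by simp [ha]
    let t : Double A → Prop := Double.desc (fun _ => False) (fun x => x ∉ A)
      fun a ha => by simp [ha]
    refine ⟨{y | s y}, {y | t y}, ?_, ?_, hx, hx, ?_⟩
    · refine isOpen_coinduced.2 (isOpen_sum_iff.2 ⟨hA.isOpen_compl, ?_⟩)
      exact isOpen_empty
    · refine isOpen_coinduced.2 (isOpen_sum_iff.2 ⟨?_, hA.isOpen_compl⟩)
      exact isOpen_empty
    · refine Set.disjoint_left.2 fun y => ?_
      induction y using Double.ind with
      | h1 x => exact fun _ h => h
      | h2 x => exact fun h => h.elim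
  have key' : ∀ x, Double.left A x ≠ Double.right A x → x ∉ A :=
    fun x h hx => h (Double.left_eq_right hx)
  refine ⟨fun y y' h => ?_⟩
  by_cases hf : Double.fold A y = Double.fold A y'
  · induction y using Double.ind with
    | h1 x =>
      induction y' using Double.ind with
      | h1 x' => exact (h (congrArg _ hf)).elim
      | h2 x' =>
        obtain rfl : x = x' := hf
        exact key x (key' x h)
    | h2 x =>
      induction y' using Double.ind with
      | h1 x' =>
        obtain rfl : x = x' := hf
        obtain ⟨U, V, hU, hV, h1, h2, h3⟩ := key x (key' x h.symm)
        exact ⟨V, U, hV, hU, h2, h1, h3.symm⟩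
      | h2 x' => exact (h (congrArg _ hf)).elim
  · exact separated_by_continuous Double.continuous_fold hf

/-- The quotient map `X → X / A`. -/
def Collapse.proj (A : Set X) (x : X) : Collapse A := Quot.mk _ (Sum.inl x)

theorem Collapse.proj_eq_base {a : X} (ha : a ∈ A) : Collapse.proj A a = Collapse.base A :=
  Quot.sound ⟨a, ha⟩

/-- A function on `X / A` is given by a function on `X` which is constant on `A`. -/
def Collapse.desc {Z : Type*} (f : X → Z) (z : Z) (h : ∀ a ∈ A, f a = z) : Collapse A → Z :=
  Quot.lift (Sum.elim f fun _ => z) (by rintro _ _ ⟨a, ha⟩; exact h a ha)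

theorem Collapse.continuous_desc {Z : Type*} [TopologicalSpace Z] {f : X → Z} {z : Z}
    {h : ∀ a ∈ A, f a = z} (hf : Continuous f) : Continuous (Collapse.desc f z h) :=
  continuous_coinduced_dom.2 (hf.sumElim continuous_const)

theorem Collapse.ind {P : Collapse A → Prop} (h1 : ∀ x, P (Collapse.proj A x))
    (h2 : P (Collapse.base A)) (y : Collapse A) : P y :=
  Quot.ind (by rintro (x | x); exacts [h1 x, h2]) y

/-- A Urysohn function that vanishes on `A` descends to the quotient, and it can be chosen to
separate a given point outside `A` from any other point. -/
theorem Collapse.t2Space [NormalSpace X] [T1Space X] (hA : IsClosed A) : T2Space (Collapse A) := by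
  have key : ∀ x y, x ∉ A → Collapse.proj A x ≠ y →
      ∃ f : Collapse A → ℝ, Continuous f ∧ f (Collapse.proj A x) ≠ f y := by
    intro x y hx hy
    -- `C` consists of `A` together with a representative of `y`, if `y` is not given as the base
    -- point. A function vanishing on `C` is constant on `A` and zero at `y`.
    obtain ⟨C, hC, hxC, hAC, hyC⟩ : ∃ C : Set X, IsClosed C ∧ x ∉ C ∧ A ⊆ C ∧
        (y = Collapse.base A ∨ ∃ x' ∈ C, y = Collapse.proj A x') := by
      induction y using Collapse.ind with
      | h1 x' =>
        refine ⟨A ∪ {x'}, hA.union isClosed_singleton, ?_, Set.subset_union_left, Or.inr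
          ⟨x', by simp, rfl⟩⟩
        rintro (h | rfl)
        exacts [hx h, hy rfl]
      | h2 => exact ⟨A, hA, hx, le_rfl, Or.inl rfl⟩
    obtain ⟨f, hf0, hf1, -⟩ := exists_continuous_zero_one_of_isClosed hC
      (isClosed_singleton (x := x)) (Set.disjoint_singleton_right.2 hxC)
    refine ⟨Collapse.desc f 0 fun a ha => hf0 (hAC ha), Collapse.continuous_desc f.continuous, ?_⟩
    have h1 : f x = 1 := hf1 rfl
    rcases hyC with rfl | ⟨x', hx', rfl⟩
    · change f x ≠ 0
      simp [h1]
    · change f x ≠ f x'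
      rw [h1, hf0 hx']
      simp
  have key' : ∀ x, Collapse.proj A x ≠ Collapse.base A → x ∉ A :=
    fun x h hx => h (Collapse.proj_eq_base hx)
  refine ⟨fun y y' h => ?_⟩
  suffices ∃ f : Collapse A → ℝ, Continuous f ∧ f y ≠ f y' by
    obtain ⟨f, hf, hff⟩ := this
    exact separated_by_continuous hf hff
  have key2 : ∀ y y' : Collapse A, y ≠ y' → y ≠ Collapse.base A →
      ∃ f : Collapse A → ℝ, Continuous f ∧ f y ≠ f y' := by
    intro y y' h hb
    induction y using Collapse.ind with
    | h1 x => exact key x y' (key' x hb) h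
    | h2 => exact (hb rfl).elim
  by_cases hb : y = Collapse.base A
  · obtain ⟨f, hf, hff⟩ := key2 y' y h.symm (hb ▸ h.symm)
    exact ⟨f, hf, hff.symm⟩
  · exact key2 y y' h hb

end DoubleCollapse

/-! ### Identifications of fibers, iterated pullbacks and complements. -/

namespace VectFamily

variable {X : Type u} {X' : Type v} {X'' : Type w}

/-- Equality of points in the total space replaces transport of vectors along equalities of base
points. The gluing condition is phrased in this way, and the next lemmas propagate such equalities.
-/
theorem exists_pt_eq (E : VectFamily X) {x y : X} (h : x = y) (v : E.fiber x) :
    ∃ w : E.fiber y, E.pt x v = E.pt y w := by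
  subst h
  exact ⟨v, rfl⟩

theorem directSum_pt_eq {E F : VectFamily X} {x y : X} {v : E.fiber x} {v' : E.fiber y}
    {w : F.fiber x} {w' : F.fiber y} (h : E.pt x v = E.pt y v') (h' : F.pt x w = F.pt y w') :
    (E.directSum F).pt x (v, w) = (E.directSum F).pt y (v', w') := by
  obtain rfl : x = y := congrArg (fun p : E.Total => p.proj) h
  rw [pt_injective h, pt_injective h']

theorem pullback_pt_eq [TopologicalSpace X'] {E : VectFamily X} {f : X' → X} {x y : X'} (h : x = y)
    {v : E.fiber (f x)} {w : E.fiber (f y)} (h' : E.pt (f x) v = E.pt (f y) w) :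
    (E.pullback f).pt x v = (E.pullback f).pt y w := by
  subst h
  rw [pt_injective h']

theorem imFamily_pt_eq [TopologicalSpace X] {V : Type} [NormedAddCommGroup V] [NormedSpace ℂ V]
    {p : X → V →L[ℂ] V} {x y : X} (h : x = y) {v : (imFamily p).fiber x} {w : (imFamily p).fiber y}
    (h' : imIncl p x v = imIncl p y w) : (imFamily p).pt x v = (imFamily p).pt y w := by
  subst h
  exact congrArg _ (Subtype.ext h')

/-- Iterated pullback. -/
def Iso.pullbackComp [TopologicalSpace X'] [TopologicalSpace X''] (E : VectFamily X) (f : X' → X)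
    {g : X'' → X'} (hg : Continuous g) :
    Iso ((E.pullback f).pullback g) (E.pullback fun x => f (g x)) where
  equiv _ := LinearEquiv.refl ℂ _
  continuous_hom := continuous_pullback_mk (continuous_pullback_proj g _)
    ((continuous_pullback_pt f E).comp (continuous_pullback_pt g _))
  continuous_inv := continuous_pullback_mk (continuous_pullback_proj (fun x => f (g x)) E)
    (continuous_pullback_mk (hg.comp (continuous_pullback_proj (fun x => f (g x)) E))
      (continuous_pullback_pt (fun x => f (g x)) E))

variable [TopologicalSpace X]

/-- A locally trivial family is isomorphic to its pullback along the identity. -/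
def Iso.pullbackId {E : VectFamily X} (hE : E.IsLocallyTrivial) {f : X → X}
    (e : ∀ x, E.fiber x ≃ₗ[ℂ] E.fiber (f x)) (he : ∀ x v, E.pt x v = E.pt (f x) (e x v)) :
    Iso E (E.pullback f) where
  equiv := e
  continuous_hom := continuous_pullback_mk hE.continuous_proj
    (continuous_id.congr fun p => he p.proj p.snd)
  continuous_inv := by
    refine (continuous_pullback_pt f E).congr fun p => ?_
    exact (congrArg (E.pt (f p.proj)) ((e p.proj).apply_symm_apply p.snd)).symm.trans
      (he p.proj _).symm

variable {A : Set X}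

/-- The direct sum of two isomorphisms over a subspace. -/
def Iso.restrictSum {E F E' F' : VectFamily X} (φ : Iso (E.restrict A) (F.restrict A))
    (ψ : Iso (E'.restrict A) (F'.restrict A)) :
    Iso ((E.directSum E').restrict A) ((F.directSum F').restrict A) :=
  ((Iso.pullbackDirectSum _ E E').trans (φ.directSum ψ)).trans (Iso.pullbackDirectSum _ F F').symm

section Complement

variable {E : VectFamily X} {V : Type} [NormedAddCommGroup V] [NormedSpace ℂ V]
  [FiniteDimensional ℂ V]

/-- The complement of a direct summand of a product family. -/
noncomputable def Retract.compl (R : Retract E V) : VectFamily X := imFamily fun x => 1 - R.idem x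

theorem Retract.continuous_idem (R : Retract E V) : Continuous R.idem := R.continuous_matrix R _

theorem Retract.compl_comp_compl (R : Retract E V) (x : X) :
    (1 - R.idem x) ∘L (1 - R.idem x) = 1 - R.idem x := by
  have h : R.idem x * R.idem x = R.idem x := R.idem_comp_idem x
  change (1 - R.idem x) * (1 - R.idem x) = _
  rw [sub_mul, mul_sub (R.idem x), h]
  simp

theorem Retract.isLocallyTrivial_compl (R : Retract E V) : R.compl.IsLocallyTrivial :=
  isLocallyTrivial_imFamily (continuous_const.sub R.continuous_idem) R.compl_comp_compl

theorem Retract.retr_compl (R : Retract E V) (x : X) (w : R.compl.fiber x) :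
    R.retr x (imIncl (fun x => 1 - R.idem x) x w) = 0 := by
  obtain ⟨_, w, rfl⟩ := w
  change R.retr x (w - R.idem x w) = 0
  simp [Retract.idem_apply, R.retr_incl]

/-- A direct summand and its complement add up to the product family. -/
noncomputable def Retract.complIso (R : Retract E V) :
    Iso (E.directSum R.compl) (imFamily fun _ => (1 : V →L[ℂ] V)) where
  equiv x := LinearEquiv.ofLinearMap
    (((R.incl x).coprod (imIncl (fun x => 1 - R.idem x) x)).codRestrict
      (LinearMap.range ((1 : V →L[ℂ] V) : V →ₗ[ℂ] V)) fun v => ⟨_, rfl⟩)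
    (((R.retr x).prod ((1 - R.idem x : V →L[ℂ] V) : V →ₗ[ℂ] V).rangeRestrict) ∘ₗ
      imIncl (fun _ => (1 : V →L[ℂ] V)) x)
    (by
      refine LinearMap.ext fun v => Subtype.ext ?_
      change R.incl x (R.retr x v.1) + (v.1 - R.idem x v.1) = v.1
      simp [Retract.idem_apply])
    (by
      refine LinearMap.ext fun v => ?_
      obtain ⟨v, w⟩ := v
      have h := R.retr_compl x w
      refine Prod.ext ?_ (Subtype.ext ?_)
      · change R.retr x (R.incl x v + imIncl (fun x => 1 - R.idem x) x w) = v
        rw [map_add, R.retr_incl, h, add_zero]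
      · change (R.incl x v + imIncl (fun x => 1 - R.idem x) x w) -
          R.idem x (R.incl x v + imIncl (fun x => 1 - R.idem x) x w) =
          imIncl (fun x => 1 - R.idem x) x w
        rw [Retract.idem_apply, map_add, R.retr_incl, h, add_zero, add_sub_cancel_left])
  continuous_hom := by
    refine continuous_imFamily_mk ?_ ?_
    · exact (continuous_imFamily_proj _).comp (continuous_directSum_snd E R.compl)
    · exact (R.continuous_incl.comp (continuous_directSum_fst E R.compl)).add
        ((continuous_imFamily_val _).comp (continuous_directSum_snd E R.compl))
  continuous_inv := by
    have h1 := continuous_imFamily_proj fun _ : X => (1 : V →L[ℂ] V)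
    have h2 := continuous_imFamily_val fun _ : X => (1 : V →L[ℂ] V)
    refine continuous_directSum_mk (R.continuous_retr.comp (h1.prodMk h2)) ?_
    exact continuous_imFamily_mk h1
      (((continuous_const.sub R.continuous_idem).comp h1).clm_apply h2)

end Complement

end VectFamily

/-! ### Gluing of bundles over the double, and clutching. -/

section Gluing

open VectFamily

variable {X : Type u} [TopologicalSpace X] {A : Set X}

/-- Isomorphisms over the two copies of `X` which agree on `A` form an isomorphism over the
double. -/
theorem VectFamily.nonempty_iso_of_double [CompactSpace X] [T2Space X] (hA : IsClosed A)
    {E E' : VectFamily (Double A)} (hE : E.IsLocallyTrivial) (hE' : E'.IsLocallyTrivial)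
    (φ : Iso (E.pullback (Double.left A)) (E'.pullback (Double.left A)))
    (ψ : Iso (E.pullback (Double.right A)) (E'.pullback (Double.right A)))
    (h : ∀ a ∈ A, ∀ (v : E.fiber (Double.left A a)) (w : E.fiber (Double.right A a)),
      E.pt _ v = E.pt _ w → E'.pt (Double.left A a) (φ.equiv a v) =
        E'.pt (Double.right A a) (ψ.equiv a w)) :
    Nonempty (Iso E E') := by
  have := Double.t2Space hA
  obtain ⟨V, _, _, _, ⟨R⟩⟩ := exists_retract hE
  obtain ⟨V', _, _, _, ⟨R'⟩⟩ := exists_retract hE'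
  -- The inverse isomorphisms satisfy the same compatibility over `A`, as is needed for the matrix
  -- of the inverse to descend.
  have h' : ∀ a ∈ A, ∀ (v : E'.fiber (Double.left A a)) (w : E'.fiber (Double.right A a)),
      E'.pt _ v = E'.pt _ w → E.pt (Double.left A a) ((φ.equiv a).symm v) =
        E.pt (Double.right A a) ((ψ.equiv a).symm w) := by
    intro a ha v w hvw
    obtain ⟨w', hw'⟩ := E.exists_pt_eq (Double.left_eq_right ha) ((φ.equiv a).symm v)
    have h1 := h a ha _ _ hw'
    have h0 : φ.equiv a ((φ.equiv a).symm v) = v := (φ.equiv a).apply_symm_apply v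
    have h2 : w = ψ.equiv a w' :=
      pt_injective (hvw.symm.trans ((congrArg (E'.pt _) h0).symm.trans h1))
    rw [hw', h2]
    exact congrArg _ ((ψ.equiv a).symm_apply_apply w').symm
  have hl := Double.continuous_left (A := A)
  have hr := Double.continuous_right (A := A)
  -- In presentations of `E` and `E'` the two isomorphisms become matrices between fixed spaces.
  -- These agree on `A`, so they define a function on the double whose continuity is immediate.
  let s : Double A → V →L[ℂ] V' := Double.desc ((R.pullback hl).matrix (R'.pullback hl) φ)
    ((R.pullback hr).matrix (R'.pullback hr) ψ) fun a ha => by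
      ext v
      exact congrArg (fun p : E'.Total => R'.incl p.proj p.snd) (h a ha _ _
        (congrArg (fun y => E.pt y (R.retr y v)) (Double.left_eq_right ha)))
  let t : Double A → V' →L[ℂ] V := Double.desc ((R'.pullback hl).matrix (R.pullback hl) φ.symm)
    ((R'.pullback hr).matrix (R.pullback hr) ψ.symm) fun a ha => by
      ext v
      exact congrArg (fun p : E.Total => R.incl p.proj p.snd) (h' a ha _ _
        (congrArg (fun y => E'.pt y (R'.retr y v)) (Double.left_eq_right ha)))
  have hs : Continuous s := Double.continuous_desc (Retract.continuous_matrix _ _ _)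
    (Retract.continuous_matrix _ _ _)
  have ht : Continuous t := Double.continuous_desc (Retract.continuous_matrix _ _ _)
    (Retract.continuous_matrix _ _ _)
  refine ⟨((R.iso hE).trans (imFamilyIso R.idem_comp_idem R'.idem_comp_idem hs ht
    (fun y => ?_) (fun y => ?_))).trans (R'.iso hE').symm⟩
  · induction y using Double.ind with
    | h1 x => exact Retract.matrix_comp_matrix (R.pullback hl) (R'.pullback hl) φ x
    | h2 x => exact Retract.matrix_comp_matrix (R.pullback hr) (R'.pullback hr) ψ x
  · induction y using Double.ind with
    | h1 x => exact Retract.matrix_comp_matrix (R'.pullback hl) (R.pullback hl) φ.symm x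
    | h2 x => exact Retract.matrix_comp_matrix (R'.pullback hr) (R.pullback hr) ψ.symm x

variable {E F E' F' : VectFamily X} {σ : Iso (E.restrict A) (F.restrict A)}
  {σ' : Iso (E'.restrict A) (F'.restrict A)} {G G' : VectFamily (Double A)}

theorem IsGluing.trans (h : IsGluing E' F' σ' G) (φ : Iso E E') (ψ : Iso F F')
    (hσ : ∀ (a : A) (v : E.fiber a), ψ.equiv a (σ.equiv a v) = σ'.equiv a (φ.equiv a v)) :
    IsGluing E F σ G := by
  obtain ⟨α, β, h⟩ := h
  refine ⟨φ.trans α, ψ.trans β, fun a v => ?_⟩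
  exact (h a (φ.equiv a v)).trans (congrArg (fun w => G.pt (Double.right A a) (β.equiv a w))
    (hσ a v).symm)

theorem IsGluing.directSum (h : IsGluing E F σ G) (h' : IsGluing E' F' σ' G') :
    IsGluing (E.directSum E') (F.directSum F') (σ.restrictSum σ') (G.directSum G') := by
  obtain ⟨α, β, h⟩ := h
  obtain ⟨α', β', h'⟩ := h'
  exact ⟨(α.directSum α').trans (Iso.pullbackDirectSum _ G G').symm,
    (β.directSum β').trans (Iso.pullbackDirectSum _ G G').symm,
    fun a v => directSum_pt_eq (h a v.1) (h' a v.2)⟩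

/-- Both glued bundles restrict to `E` and `F` on the two copies, and both identify the restrictions
over `A` by the same `σ`; hence the evident isomorphisms on the copies fit together. -/
theorem IsGluing.nonempty_iso [CompactSpace X] [T2Space X] (hA : IsClosed A)
    (hG : G.IsLocallyTrivial) (hG' : G'.IsLocallyTrivial) (h : IsGluing E F σ G)
    (h' : IsGluing E F σ G') : Nonempty (Iso G G') := by
  obtain ⟨α, β, h⟩ := h
  obtain ⟨α', β', h'⟩ := h'
  refine nonempty_iso_of_double hA hG hG' (α.symm.trans α') (β.symm.trans β') fun a ha v w hvw => ?_
  let v' := (α.equiv a).symm v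
  have h1 : α.equiv a v' = v := (α.equiv a).apply_symm_apply v
  have h2 := h ⟨a, ha⟩ v'
  rw [h1] at h2
  have h3 := pt_injective (hvw.symm.trans h2)
  refine (h' ⟨a, ha⟩ v').trans (congrArg (fun w => G'.pt (Double.right A a) (β'.equiv a w)) ?_)
  exact (((β.equiv a).symm_apply_eq).2 h3).symm

/-- The folding map composed with either inclusion is the identity, so no twist occurs along `A`. -/
theorem isGluing_pullback_fold (hE : E.IsLocallyTrivial) :
    IsGluing E E (Iso.refl (E.restrict A)) (E.pullback (Double.fold A)) :=
  ⟨(Iso.pullbackId (f := fun x => x) hE (fun _ => LinearEquiv.refl ℂ _) fun _ _ => rfl).trans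
      (Iso.pullbackComp E (Double.fold A) Double.continuous_left).symm,
    (Iso.pullbackId (f := fun x => x) hE (fun _ => LinearEquiv.refl ℂ _) fun _ _ => rfl).trans
      (Iso.pullbackComp E (Double.fold A) Double.continuous_right).symm,
    fun a v => pullback_pt_eq (E := E) (f := Double.fold A) (v := v) (w := v)
      (Double.left_eq_right a.2) rfl⟩

section Clutching

variable {V W : Type} [NormedAddCommGroup V] [NormedSpace ℂ V] [FiniteDimensional ℂ V]
  [NormedAddCommGroup W] [NormedSpace ℂ W] [FiniteDimensional ℂ W]

/-- An isomorphism over `A` between the images of two families of idempotents makes the first family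
isomorphic to one which agrees with the second one over `A`. -/
theorem exists_clutching [NormalSpace X] (hA : IsClosed A) {p : X → V →L[ℂ] V} (hc : Continuous p)
    (hp : ∀ x, p x ∘L p x = p x) {f₀ : A → V →L[ℂ] W} {g₀ : A → W →L[ℂ] V}
    (hf₀ : Continuous f₀) (hg₀ : Continuous g₀) (hgf : ∀ a, g₀ a ∘L f₀ a = p a)
    (hf : ∀ a : A, f₀ a ∘L p a = f₀ a) (hg : ∀ a : A, p a ∘L g₀ a = g₀ a) :
    ∃ (J : X → V →L[ℂ] W × V) (R : X → W × V →L[ℂ] V), Continuous J ∧ Continuous R ∧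
      (∀ x, R x ∘L J x = p x) ∧ (∀ x, J x ∘L p x = J x) ∧
      (∀ a : A, J a = (f₀ a).prod 0) ∧ (∀ a : A, R a = (g₀ a).coprod 0) := by
  -- Tietze extension, with values in finite dimensional spaces of operators. The extensions need
  -- not be inverse to each other off `A`.
  obtain ⟨f₁, hf₁⟩ := ContinuousMap.exists_restrict_eq hA ⟨f₀, hf₀⟩
  obtain ⟨g₁, hg₁⟩ := ContinuousMap.exists_restrict_eq hA ⟨g₀, hg₀⟩
  have hf₁' : ∀ a : A, f₁ a = f₀ a := fun a => congrArg (fun k => k a) hf₁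
  have hg₁' : ∀ a : A, g₁ a = g₀ a := fun a => congrArg (fun k => k a) hg₁
  let f : X → V →L[ℂ] W := fun x => f₁ x ∘L p x
  let g : X → W →L[ℂ] V := fun x => p x ∘L g₁ x
  -- `h` measures how far `g` is from inverting `f` on the image of `p`. It vanishes on `A`, so the
  -- extra component `V` can absorb it without changing the data there.
  let h : X → V →L[ℂ] V := fun x => p x - g x ∘L f x
  have hfc : Continuous f := f₁.continuous.clm_comp hc
  have hgc : Continuous g := hc.clm_comp g₁.continuous
  have hhc : Continuous h := hc.sub (hgc.clm_comp hfc)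
  have hpp : ∀ x v, p x (p x v) = p x v := fun x v => congrArg (fun k : V →L[ℂ] V => k v) (hp x)
  have hfa : ∀ a : A, f a = f₀ a := fun a => by simp only [f, hf₁', hf]
  have hga : ∀ a : A, g a = g₀ a := fun a => by simp only [g, hg₁', hg]
  have hha : ∀ a : A, h a = 0 := fun a => by simp only [h, hfa, hga, hgf, sub_self]
  -- With `J = (f, h)` and `R = ((p + h) g, h)` one has `R J = (p + h)(p - h) + h² = p`, because `g
  -- f = p - h` and `p` acts as the identity on `h` from both sides.
  refine ⟨fun x => (f x).prod (h x), fun x => ((p x + h x) ∘L g x).coprod (h x), ?_, ?_, ?_, ?_,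
    ?_, ?_⟩
  · exact (ContinuousLinearMap.prodₗᵢ ℂ).continuous.comp (hfc.prodMk hhc)
  · have : (fun x => ((p x + h x) ∘L g x).coprod (h x)) = fun x =>
        ((p x + h x) ∘L g x) ∘L ContinuousLinearMap.fst ℂ W V +
          h x ∘L ContinuousLinearMap.snd ℂ W V := by
      funext x
      ext <;> simp
    rw [this]
    exact (((hc.add hhc).clm_comp hgc).clm_comp continuous_const).add
      (hhc.clm_comp continuous_const)
  · intro x
    ext v
    simp only [ContinuousLinearMap.comp_apply, ContinuousLinearMap.coprod_apply,
      ContinuousLinearMap.prod_apply, h, f, g, sub_apply,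
      add_apply, hpp, map_sub]
    abel
  · intro x
    ext v <;> simp [h, f, hpp]
  · intro a
    simp only [hfa, hha]
  · intro a
    have : p a ∘L g a = g₀ a := by rw [hga, hg]
    simp only [hha, add_zero, this]

end Clutching

end Gluing

/-! ### The groups `K(X)`, and injectivity of the reduced group of `X / A` into `K(Y)`. -/

section DifferenceClass

open VectFamily

section KGroup

variable {X : Type u} [TopologicalSpace X] {X' : Type v} [TopologicalSpace X']

theorem KGroup.cls_eq_of_iso {E F : CVectBundle X} (φ : Iso E.1 F.1) :
    KGroup.cls E = KGroup.cls F :=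
  congrArg Algebra.GrothendieckAddGroup.of (Quotient.sound ⟨φ⟩)

/-- The direct sum of vector bundles. -/
def CVectBundle.directSum (E F : CVectBundle X) : CVectBundle X :=
  ⟨E.1.directSum F.1, isLocallyTrivial_directSum E.2 F.2⟩

/-- The pullback of a vector bundle. -/
def CVectBundle.pullback (f : C(X', X)) (E : CVectBundle X) : CVectBundle X' :=
  ⟨E.1.pullback f, isLocallyTrivial_pullback E.2 f.continuous⟩

/-- The isomorphism class of a vector bundle. -/
def CVectBundle.toVect (E : CVectBundle X) : Vect X := Quotient.mk _ E

theorem KGroup.cls_directSum (E F : CVectBundle X) :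
    KGroup.cls (E.directSum F) = KGroup.cls E + KGroup.cls F :=
  map_add (Algebra.GrothendieckAddGroup.of (M := Vect X)) E.toVect F.toVect

theorem KGroup.map_cls (f : C(X', X)) (E : CVectBundle X) :
    KGroup.map f (KGroup.cls E) = KGroup.cls (E.pullback f) :=
  (AddSubmonoid.LocalizationMap.lift_eq _ _ _).trans rfl

theorem KGroup.exists_cls_sub_cls (c : KGroup X) :
    ∃ E F : CVectBundle X, c = KGroup.cls E - KGroup.cls F := by
  induction c using AddLocalization.induction_on with
  | _ y =>
    obtain ⟨⟨E⟩, ⟨F⟩, hF⟩ := y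
    refine ⟨E, F, ?_⟩
    rw [eq_sub_iff_add_eq]
    have := (AddLocalization.addMonoidOf (⊤ : AddSubmonoid (Vect X))).mk'_spec
      (Quotient.mk _ E : Vect X) ⟨(Quotient.mk _ F : Vect X), hF⟩
    rw [← AddLocalization.mk_eq_addMonoidOf_mk'] at this
    exact this

theorem KGroup.exists_iso_of_cls_eq {E F : CVectBundle X} (h : KGroup.cls E = KGroup.cls F) :
    ∃ H : CVectBundle X, Nonempty (Iso (H.directSum E).1 (H.directSum F).1) := by
  obtain ⟨⟨⟨H⟩, _⟩, hH⟩ :=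
    (AddLocalization.addMonoidOf (⊤ : AddSubmonoid (Vect X))).eq_iff_exists.1 h
  exact ⟨H, Quotient.exact hH⟩

/-- The product bundle with fiber `V`. -/
noncomputable def CVectBundle.triv (X : Type u) [TopologicalSpace X] (V : Type) [NormedAddCommGroup V]
    [NormedSpace ℂ V] [FiniteDimensional ℂ V] : CVectBundle X :=
  ⟨imFamily fun _ => (1 : V →L[ℂ] V), isLocallyTrivial_imFamily continuous_const fun _ => rfl⟩

/-- Adding a complement of the subtracted bundle to both terms makes that bundle trivial. -/
theorem KGroup.exists_cls_sub_triv [CompactSpace X] [T2Space X] (c : KGroup X) :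
    ∃ (E : CVectBundle X) (V : Type) (_ : NormedAddCommGroup V) (_ : NormedSpace ℂ V)
      (_ : FiniteDimensional ℂ V), c = KGroup.cls E - KGroup.cls (CVectBundle.triv X V) := by
  obtain ⟨E, F, rfl⟩ := KGroup.exists_cls_sub_cls c
  obtain ⟨V, _, _, _, ⟨R⟩⟩ := exists_retract F.2
  let F' : CVectBundle X := ⟨R.compl, R.isLocallyTrivial_compl⟩
  refine ⟨E.directSum F', V, inferInstance, inferInstance, inferInstance, ?_⟩
  have h : KGroup.cls (F.directSum F') = KGroup.cls (CVectBundle.triv X V) :=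
    KGroup.cls_eq_of_iso R.complIso
  rw [← h, KGroup.cls_directSum, KGroup.cls_directSum]
  abel

/-- The stabilizing bundle from the Grothendieck construction may be enlarged by a complement, so a
trivial one suffices. -/
theorem KGroup.exists_iso_of_cls_eq_triv [CompactSpace X] [T2Space X] {E F : CVectBundle X}
    (h : KGroup.cls E = KGroup.cls F) :
    ∃ (V : Type) (_ : NormedAddCommGroup V) (_ : NormedSpace ℂ V) (_ : FiniteDimensional ℂ V),
      Nonempty (Iso ((CVectBundle.triv X V).directSum E).1 ((CVectBundle.triv X V).directSum F).1) := by
  obtain ⟨H, ⟨φ⟩⟩ := KGroup.exists_iso_of_cls_eq h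
  obtain ⟨V, _, _, _, ⟨R⟩⟩ := exists_retract H.2
  refine ⟨V, inferInstance, inferInstance, inferInstance, ⟨?_⟩⟩
  have key : ∀ E : CVectBundle X, Iso ((CVectBundle.triv X V).directSum E).1
      (R.compl.directSum (H.directSum E).1) := fun E =>
    ((R.complIso.symm.trans (Iso.directSumComm _ _)).directSum (Iso.refl E.1)).trans
      (Iso.directSumAssoc _ _ _)
  exact ((key E).trans ((Iso.refl _).directSum φ)).trans (key F).symm

theorem KGroup.map_comp_cls {X'' : Type w} [TopologicalSpace X''] (f : C(X', X)) (g : C(X'', X'))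
    (E : CVectBundle X) :
    KGroup.map g (KGroup.map f (KGroup.cls E)) = KGroup.cls (E.pullback (f.comp g)) := by
  rw [KGroup.map_cls, KGroup.map_cls]
  exact KGroup.cls_eq_of_iso (Iso.pullbackComp E.1 f g.continuous)

end KGroup

variable {X : Type u} [TopologicalSpace X] {A : Set X}

/-- A bundle on `X / A` whose pullback to the double is trivial is isomorphic to a constant one. -/
theorem VectFamily.nonempty_iso_const_of_collapse [CompactSpace X] [T2Space X] (hA : IsClosed A)
    {E : VectFamily (Collapse A)} (hE : E.IsLocallyTrivial)
    {V : Type} [NormedAddCommGroup V] [NormedSpace ℂ V] [FiniteDimensional ℂ V]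
    (φ : Iso (E.pullback (Double.collapse A)) (imFamily fun _ => (1 : V →L[ℂ] V))) :
    Nonempty (Iso E (E.pullback fun _ => Collapse.base A)) := by
  have := Collapse.t2Space hA
  obtain ⟨W, _, _, _, ⟨R⟩⟩ := exists_retract hE
  let R₁ := R.pullback (Double.collapse A).continuous
  let R₂ : Retract (imFamily fun _ : Double A => (1 : V →L[ℂ] V)) V :=
    imRetract continuous_const fun _ => rfl
  let s := R₁.matrix R₂ φ
  let t := R₂.matrix R₁ φ.symm
  have hts : ∀ y, t y ∘L s y = R.idem (Double.collapse A y) := R₁.matrix_comp_matrix R₂ φ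
  have hst : ∀ y, s y ∘L t y = 1 := R₂.matrix_comp_matrix R₁ φ.symm
  have hs : Continuous s := R₁.continuous_matrix R₂ φ
  have ht : Continuous t := R₂.continuous_matrix R₁ φ.symm
  have hl := Double.continuous_left (A := A)
  have hr := Double.continuous_right (A := A)
  -- The trivialization over the double is used to pass from a point in the first copy, where the
  -- fiber is that of `E` at its class, through the constant fiber `V`, to the same point in the
  -- second copy, where the fiber is that over the base point. Over `A` the two copies coincide, so
  -- nothing moves and the map descends; `T` is the way back.
  let S : Collapse A → W →L[ℂ] W := Collapse.desc
    (fun x => t (Double.right A x) ∘L s (Double.left A x)) (R.idem (Collapse.base A)) fun a ha => by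
      rw [Double.left_eq_right ha, hts]
      rfl
  let T : Collapse A → W →L[ℂ] W := Collapse.desc
    (fun x => t (Double.left A x) ∘L s (Double.right A x)) (R.idem (Collapse.base A)) fun a ha => by
      rw [Double.left_eq_right ha, hts]
      rfl
  have hS : Continuous S := Collapse.continuous_desc ((ht.comp hr).clm_comp (hs.comp hl))
  have hT : Continuous T := Collapse.continuous_desc ((ht.comp hl).clm_comp (hs.comp hr))
  have key : ∀ y y', (t y ∘L s y') ∘L (t y' ∘L s y) = R.idem (Double.collapse A y) := by
    intro y y'
    rw [ContinuousLinearMap.comp_assoc, ← ContinuousLinearMap.comp_assoc (s y'), hst, ← hts]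
    rfl
  let ψ := imFamilyIso (q := fun _ : Collapse A => R.idem (Collapse.base A)) R.idem_comp_idem
    (fun _ => R.idem_comp_idem _) hS hT
    (fun z => by
      induction z using Collapse.ind with
      | h1 x => exact key (Double.left A x) (Double.right A x)
      | h2 => exact R.idem_comp_idem _)
    (fun z => by
      induction z using Collapse.ind with
      | h1 x => exact key (Double.right A x) (Double.left A x)
      | h2 => exact R.idem_comp_idem _)
  exact ⟨((R.iso hE).trans ψ).trans ((imFamilyPullback R.idem continuous_const).symm.trans
    ((R.iso hE).pullback fun _ => Collapse.base A).symm)⟩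

/-- After stabilization `c` is a difference of two bundles on `X / A` that both become trivial on
the double. Each is then pulled back from the base point, so `c` is determined by its restriction
there, which is zero for a reduced class. -/
theorem KRel.eq_zero_of_map_collapse [CompactSpace X] [T2Space X] (hA : IsClosed A)
    (c : KGroup (Collapse A)) (hc : c ∈ KRel A) (h : KGroup.map (Double.collapse A) c = 0) :
    c = 0 := by
  have := Collapse.t2Space hA
  have := Double.t2Space hA
  obtain ⟨E, V, _, _, _, rfl⟩ := KGroup.exists_cls_sub_triv c
  rw [map_sub, KGroup.map_cls, KGroup.map_cls, sub_eq_zero] at h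
  obtain ⟨W, _, _, _, ⟨φ⟩⟩ := KGroup.exists_iso_of_cls_eq_triv h
  let T := CVectBundle.triv (Collapse A) W
  let B := T.directSum E
  let B' := T.directSum (CVectBundle.triv (Collapse A) V)
  have hB : KGroup.cls E - KGroup.cls (CVectBundle.triv (Collapse A) V) =
      KGroup.cls B - KGroup.cls B' := by
    rw [KGroup.cls_directSum, KGroup.cls_directSum]
    abel
  rw [hB] at hc ⊢
  have e1 : Iso (T.1.pullback (Double.collapse A)) (CVectBundle.triv (Double A) W).1 :=
    imFamilyPullback _ (Double.collapse A).continuous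
  have e2 : Iso ((CVectBundle.triv (Collapse A) V).1.pullback (Double.collapse A))
    (CVectBundle.triv (Double A) V).1 := imFamilyPullback _ (Double.collapse A).continuous
  let R : Retract (CVectBundle.triv (Double A) W).1 W := imRetract continuous_const fun _ => rfl
  have e3 : Iso ((CVectBundle.triv (Double A) W).1.directSum (CVectBundle.triv (Double A) V).1)
      (imFamily fun _ : Double A => (1 : W × V →L[ℂ] W × V)) :=
    { equiv := fun x => LinearEquiv.ofLinearMap
        (((imIncl _ x).prodMap (imIncl _ x)).codRestrict
          (LinearMap.range ((1 : W × V →L[ℂ] W × V) : W × V →ₗ[ℂ] W × V)) fun v => ⟨_, rfl⟩)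
        ((LinearMap.prodMap (((1 : W →L[ℂ] W) : W →ₗ[ℂ] W).rangeRestrict)
          (((1 : V →L[ℂ] V) : V →ₗ[ℂ] V).rangeRestrict)) ∘ₗ
            imIncl (fun _ : Double A => (1 : W × V →L[ℂ] W × V)) x)
        (LinearMap.ext fun v => rfl) (LinearMap.ext fun v => rfl)
      continuous_hom := continuous_imFamily_mk
        ((continuous_imFamily_proj _).comp (continuous_directSum_fst _ _))
        (((continuous_imFamily_val _).comp (continuous_directSum_fst _ _)).prodMk
          ((continuous_imFamily_val _).comp (continuous_directSum_snd _ _)))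
      continuous_inv := continuous_directSum_mk
        (continuous_imFamily_mk (continuous_imFamily_proj _)
          (continuous_fst.comp (continuous_imFamily_val _)))
        (continuous_imFamily_mk (continuous_imFamily_proj _)
          (continuous_snd.comp (continuous_imFamily_val _))) }
  have e4 : Iso (B'.1.pullback (Double.collapse A))
      (imFamily fun _ : Double A => (1 : W × V →L[ℂ] W × V)) :=
    ((Iso.pullbackDirectSum _ _ _).trans (e1.directSum e2)).trans e3
  have e5 : Iso (B.1.pullback (Double.collapse A)) (B'.1.pullback (Double.collapse A)) :=
    (((Iso.pullbackDirectSum _ _ _).trans (e1.directSum (Iso.refl _))).trans φ).trans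
      ((e1.directSum (Iso.refl _)).symm.trans (Iso.pullbackDirectSum _ _ _).symm)
  obtain ⟨ψ⟩ := nonempty_iso_const_of_collapse hA B.2 (e5.trans e4)
  obtain ⟨ψ'⟩ := nonempty_iso_const_of_collapse hA B'.2 e4
  let f : C(Unit, Collapse A) := ContinuousMap.const Unit (Collapse.base A)
  let g : C(Collapse A, Unit) := ContinuousMap.const _ ()
  -- A constant bundle is unchanged by restriction to the base point followed by pullback along the
  -- map to a point.
  have h1 : KGroup.cls B = KGroup.map g (KGroup.map f (KGroup.cls B)) := by
    rw [KGroup.map_comp_cls]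
    exact KGroup.cls_eq_of_iso ψ
  have h2 : KGroup.cls B' = KGroup.map g (KGroup.map f (KGroup.cls B')) := by
    rw [KGroup.map_comp_cls]
    exact KGroup.cls_eq_of_iso ψ'
  have h3 : KGroup.map f (KGroup.cls B - KGroup.cls B') = 0 := hc
  rw [h1, h2, ← map_sub, ← map_sub, h3, map_zero]

end DifferenceClass

/-! ### Existence, additivity and uniqueness of the difference class. -/

section DifferenceClass

open VectFamily

variable {X : Type u} [TopologicalSpace X] {A : Set X}
variable {E F E' F' : VectFamily X}

theorem comp_prod_zero_coprod_zero {V W : Type} [NormedAddCommGroup V] [NormedSpace ℂ V]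
    [NormedAddCommGroup W] [NormedSpace ℂ W] (f : V →L[ℂ] W) (g : W →L[ℂ] V) :
    (f.prod (0 : V →L[ℂ] V)) ∘L (g.coprod (0 : V →L[ℂ] V)) = (f ∘L g).prodMap 0 := by
  ext <;> simp

theorem isIdempotent_of_comp {V W : Type} [NormedAddCommGroup V] [NormedSpace ℂ V]
    [NormedAddCommGroup W] [NormedSpace ℂ W] {p : V →L[ℂ] V} {J : V →L[ℂ] W} {R : W →L[ℂ] V}
    (h : R ∘L J = p) (h' : J ∘L p = J) : (J ∘L R) ∘L (J ∘L R) = J ∘L R := by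
  rw [ContinuousLinearMap.comp_assoc, ← ContinuousLinearMap.comp_assoc R, h,
    ← ContinuousLinearMap.comp_assoc, h']

theorem VectFamily.Retract.matrix_comp_idem {V W : Type} [NormedAddCommGroup V] [NormedSpace ℂ V]
    [NormedAddCommGroup W] [NormedSpace ℂ W] [FiniteDimensional ℂ V] [FiniteDimensional ℂ W]
    (R : Retract E V) (S : Retract F W) (φ : Iso E F) (x : X) :
    R.matrix S φ x ∘L R.idem x = R.matrix S φ x := by
  ext v
  simp [Retract.idem_apply, R.retr_incl]

theorem VectFamily.Retract.idem_comp_matrix {V W : Type} [NormedAddCommGroup V] [NormedSpace ℂ V]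
    [NormedAddCommGroup W] [NormedSpace ℂ W] [FiniteDimensional ℂ V] [FiniteDimensional ℂ W]
    (R : Retract E V) (S : Retract F W) (φ : Iso E F) (x : X) :
    S.idem x ∘L R.matrix S φ x = R.matrix S φ x := by
  ext v
  simp [Retract.idem_apply, S.retr_incl]

theorem prodMap_zero_comp_self {V W : Type} [NormedAddCommGroup V] [NormedSpace ℂ V]
    [NormedAddCommGroup W] [NormedSpace ℂ W] {p : V →L[ℂ] V} (hp : p ∘L p = p) :
    p.prodMap (0 : W →L[ℂ] W) ∘L p.prodMap (0 : W →L[ℂ] W) = p.prodMap 0 :=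
  ContinuousLinearMap.ext fun v => Prod.ext (congrArg (fun f : V →L[ℂ] V => f v.1) hp) rfl

theorem continuous_prodMap_zero {V W : Type} [NormedAddCommGroup V] [NormedSpace ℂ V]
    [NormedAddCommGroup W] [NormedSpace ℂ W] {p : X → V →L[ℂ] V} (hp : Continuous p) :
    Continuous fun x => (p x).prodMap (0 : W →L[ℂ] W) := by
  have : (fun x => (p x).prodMap (0 : W →L[ℂ] W)) = fun x =>
      ContinuousLinearMap.inl ℂ V W ∘L p x ∘L ContinuousLinearMap.fst ℂ V W := by
    funext x
    ext <;> simp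
  rw [this]
  exact continuous_const.clm_comp (hp.clm_comp continuous_const)

/-- The first summand of a product as the image of an idempotent. -/
noncomputable def imFamilyProdZero {V W : Type} [NormedAddCommGroup V] [NormedSpace ℂ V]
    [NormedAddCommGroup W] [NormedSpace ℂ W] {p : X → V →L[ℂ] V} (hc : Continuous p)
    (hp : ∀ x, p x ∘L p x = p x) :
    Iso (imFamily p) (imFamily fun x => (p x).prodMap (0 : W →L[ℂ] W)) :=
  imFamilyIso hp (fun x => prodMap_zero_comp_self (hp x))
    (s := fun x => ContinuousLinearMap.inl ℂ V W ∘L p x)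
    (t := fun x => p x ∘L ContinuousLinearMap.fst ℂ V W)
    (continuous_const.clm_comp hc) (hc.clm_comp continuous_const)
    (fun x => by
      ext v
      exact congrArg (fun f : V →L[ℂ] V => f v) (hp x))
    (fun x => by
      ext v
      · exact congrArg (fun f : V →L[ℂ] V => f v) (hp x)
      · rfl
      · simp
      · simp)

/-- Bundles can be glued. -/
theorem exists_isGluing [CompactSpace X] [T2Space X] (hA : IsClosed A) (hE : E.IsLocallyTrivial)
    (hF : F.IsLocallyTrivial) (σ : Iso (E.restrict A) (F.restrict A)) :
    ∃ G : CVectBundle (Double A), IsGluing E F σ G.1 := by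
  obtain ⟨V, _, _, _, ⟨R⟩⟩ := exists_retract hE
  obtain ⟨W, _, _, _, ⟨S⟩⟩ := exists_retract hF
  let R₀ := R.pullback (continuous_subtype_val (p := (· ∈ A)))
  let S₀ := S.pullback (continuous_subtype_val (p := (· ∈ A)))
  obtain ⟨J, K, hJ, hK, hKJ, hJp, hJA, hKA⟩ := exists_clutching hA R.continuous_idem
    R.idem_comp_idem (R₀.continuous_matrix S₀ σ) (S₀.continuous_matrix R₀ σ.symm)
    (R₀.matrix_comp_matrix S₀ σ) (R₀.matrix_comp_idem S₀ σ) (S₀.idem_comp_matrix R₀ σ.symm)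
  let q : X → W × V →L[ℂ] W × V := fun x => (S.idem x).prodMap 0
  have hq : Continuous q := continuous_prodMap_zero S.continuous_idem
  have hqq : ∀ x, q x ∘L q x = q x := fun x => prodMap_zero_comp_self (S.idem_comp_idem x)
  -- Over the first copy the image of `J K` is a clutched copy of `E`; over the second the image is
  -- that of the idempotent of `F`. Over `A` both are the idempotent of `F` plus zero, because the
  -- two matrices of `σ` compose to it.
  let P : Double A → W × V →L[ℂ] W × V := Double.desc (fun x => J x ∘L K x) q fun a ha => by
    rw [hJA ⟨a, ha⟩, hKA ⟨a, ha⟩, comp_prod_zero_coprod_zero]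
    exact congrArg (fun f => ContinuousLinearMap.prodMap f 0) (S₀.matrix_comp_matrix R₀ σ.symm _)
  have hP : Continuous P := Double.continuous_desc (hJ.clm_comp hK) hq
  have hPP : ∀ y, P y ∘L P y = P y := fun y => by
    induction y using Double.ind with
    | h1 x => exact isIdempotent_of_comp (hKJ x) (hJp x)
    | h2 x => exact hqq x
  refine ⟨⟨imFamily P, isLocallyTrivial_imFamily hP hPP⟩, ?_⟩
  let α₀ := imFamilyIso (q := fun x => J x ∘L K x) R.idem_comp_idem
    (fun x => isIdempotent_of_comp (hKJ x) (hJp x)) hJ hK hKJ fun x => rfl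
  refine ⟨((R.iso hE).trans α₀).trans (imFamilyPullback P Double.continuous_left).symm,
    ((S.iso hF).trans (imFamilyProdZero S.continuous_idem S.idem_comp_idem)).trans
      (imFamilyPullback P Double.continuous_right).symm, fun a v => ?_⟩
  refine imFamily_pt_eq (Double.left_eq_right a.2) ?_
  change J a (R.incl a v) = (S.idem a (S.incl a (σ.equiv a v)), 0)
  rw [hJA a, ContinuousLinearMap.prod_apply]
  refine Prod.ext ?_ rfl
  exact (congrArg (fun w => S.incl a (σ.equiv a w)) (R.retr_incl a v)).trans
    (congrArg (S.incl a) (S.retr_incl a (σ.equiv a v)).symm)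

/-- Adding a complement of `F` to both bundles turns `F` into a product bundle, and `σ` plus the
identity into a trivialization over `A` of the first bundle. That bundle therefore descends to `X /
A`, and its class minus a trivial one is the required element: pulled back to the double, both terms
exceed the prescribed gluings by the same bundle `H`, which cancels. -/
theorem exists_isDifferenceClass [CompactSpace X] [T2Space X] (hA : IsClosed A)
    (hE : E.IsLocallyTrivial) (hF : F.IsLocallyTrivial) (σ : Iso (E.restrict A) (F.restrict A)) :
    ∃ c : KRel A, IsDifferenceClass E F σ c := by
  obtain ⟨V, _, _, _, ⟨R⟩⟩ := exists_retract hE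
  obtain ⟨W, _, _, _, ⟨S⟩⟩ := exists_retract hF
  obtain ⟨G, hG⟩ := exists_isGluing hA hE hF σ
  obtain ⟨G', hG'⟩ := exists_isGluing hA hF hF (Iso.refl _)
  let Q : VectFamily X := imFamily fun _ => (1 : W →L[ℂ] W)
  have hQ : Q.IsLocallyTrivial := isLocallyTrivial_imFamily continuous_const fun _ => rfl
  have hEC := isLocallyTrivial_directSum hE S.isLocallyTrivial_compl
  obtain ⟨U, _, _, _, ⟨R'⟩⟩ := exists_retract hEC
  let S' : Retract Q W := imRetract continuous_const fun _ => rfl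
  let τ : Iso ((E.directSum S.compl).restrict A) (Q.restrict A) :=
    (σ.restrictSum (Iso.refl _)).trans (S.complIso.pullback Subtype.val)
  let R₀ := R'.pullback (continuous_subtype_val (p := (· ∈ A)))
  let S₀ := S'.pullback (continuous_subtype_val (p := (· ∈ A)))
  obtain ⟨J, K, hJ, hK, hKJ, hJp, hJA, hKA⟩ := exists_clutching hA R'.continuous_idem
    R'.idem_comp_idem (R₀.continuous_matrix S₀ τ) (S₀.continuous_matrix R₀ τ.symm)
    (R₀.matrix_comp_matrix S₀ τ) (R₀.matrix_comp_idem S₀ τ) (S₀.idem_comp_matrix R₀ τ.symm)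
  let q : W × U →L[ℂ] W × U := (1 : W →L[ℂ] W).prodMap 0
  have hqq : q ∘L q = q := prodMap_zero_comp_self rfl
  -- The clutched idempotent equals the constant `q` along `A`, since its target there is the
  -- product bundle; hence it is defined on `X / A` with value `q` at the base point.
  let P : Collapse A → W × U →L[ℂ] W × U := Collapse.desc (fun x => J x ∘L K x) q fun a ha => by
    rw [hJA ⟨a, ha⟩, hKA ⟨a, ha⟩, comp_prod_zero_coprod_zero]
    exact congrArg (fun f => ContinuousLinearMap.prodMap f 0) (S₀.matrix_comp_matrix R₀ τ.symm _)
  have hP : Continuous P := Collapse.continuous_desc (hJ.clm_comp hK)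
  have hPP : ∀ y, P y ∘L P y = P y := fun y => by
    induction y using Collapse.ind with
    | h1 x => exact isIdempotent_of_comp (hKJ x) (hJp x)
    | h2 => exact hqq
  let D : CVectBundle (Collapse A) := ⟨imFamily P, isLocallyTrivial_imFamily hP hPP⟩
  let T : CVectBundle (Collapse A) := CVectBundle.triv _ W
  have hl := Double.continuous_left (A := A)
  have hr := Double.continuous_right (A := A)
  have hq := (Double.collapse A).continuous
  have hD : IsGluing (E.directSum S.compl) Q τ (D.pullback (Double.collapse A)).1 := by
    let α₀ := imFamilyIso (q := fun x => J x ∘L K x) R'.idem_comp_idem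
      (fun x => isIdempotent_of_comp (hKJ x) (hJp x)) hJ hK hKJ fun x => rfl
    refine ⟨((R'.iso hEC).trans α₀).trans ((imFamilyPullback P (hq.comp hl)).symm.trans
      (Iso.pullbackComp (imFamily P) _ hl).symm),
      (imFamilyProdZero (p := fun _ : X => (1 : W →L[ℂ] W)) continuous_const fun _ => rfl).trans
      ((imFamilyPullback P (hq.comp hr)).symm.trans (Iso.pullbackComp (imFamily P) _ hr).symm),
      fun a v => ?_⟩
    refine pullback_pt_eq (E := imFamily P) (Double.left_eq_right a.2)
      (imFamily_pt_eq (congrArg _ (Double.left_eq_right a.2)) ?_)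
    change J a (R'.incl a v) = (imIncl (fun _ => (1 : W →L[ℂ] W)) a (τ.equiv a v), 0)
    rw [hJA a, ContinuousLinearMap.prod_apply]
    refine Prod.ext ?_ rfl
    exact congrArg (fun w => imIncl (fun _ : X => (1 : W →L[ℂ] W)) a (τ.equiv a w))
      (R'.retr_incl a v)
  have hT : IsGluing Q Q (Iso.refl _) (T.pullback (Double.collapse A)).1 :=
    ⟨(imFamilyPullback (fun _ => (1 : W →L[ℂ] W)) (hq.comp hl)).symm.trans
      (Iso.pullbackComp T.1 _ hl).symm,
      (imFamilyPullback (fun _ => (1 : W →L[ℂ] W)) (hq.comp hr)).symm.trans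
      (Iso.pullbackComp T.1 _ hr).symm, fun a v =>
      pullback_pt_eq (E := T.1) (Double.left_eq_right a.2)
      (imFamily_pt_eq (congrArg _ (Double.left_eq_right a.2)) rfl)⟩
  let H : CVectBundle (Double A) := ⟨S.compl.pullback (Double.fold A),
    isLocallyTrivial_pullback S.isLocallyTrivial_compl Double.continuous_fold⟩
  have hH : IsGluing S.compl S.compl (Iso.refl _) H.1 :=
    isGluing_pullback_fold S.isLocallyTrivial_compl
  obtain ⟨φ⟩ := IsGluing.nonempty_iso hA (D.pullback _).2 (G.directSum H).2
    (hD.trans (Iso.refl _) S.complIso fun _ _ => rfl) (hG.directSum hH)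
  obtain ⟨ψ⟩ := IsGluing.nonempty_iso hA (T.pullback _).2 (G'.directSum H).2
    (hT.trans S.complIso S.complIso fun _ _ => rfl) (hG'.directSum hH)
  refine ⟨⟨KGroup.cls D - KGroup.cls T, ?_⟩, G, G', hG, hG', ?_⟩
  -- At the base point the fiber of `D` is the image of `q`, a copy of `W`, just as for `T`; so the
  -- class is reduced.
  · change KGroup.map _ _ = 0
    rw [map_sub, KGroup.map_cls, KGroup.map_cls, sub_eq_zero]
    refine KGroup.cls_eq_of_iso ?_
    exact (imFamilyPullback P continuous_const).trans
      ((imFamilyProdZero (X := Unit) (p := fun _ => (1 : W →L[ℂ] W)) continuous_const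
        fun _ => rfl).symm.trans (imFamilyPullback (fun _ => (1 : W →L[ℂ] W)) continuous_const).symm)
  · rw [map_sub, KGroup.map_cls, KGroup.map_cls, KGroup.cls_eq_of_iso φ, KGroup.cls_eq_of_iso ψ,
      KGroup.cls_directSum, KGroup.cls_directSum]
    abel

variable {σ : Iso (E.restrict A) (F.restrict A)} {σ' : Iso (E'.restrict A) (F'.restrict A)}

theorem IsDifferenceClass.trans {c : KRel A} (h : IsDifferenceClass E' F' σ' c) (φ : Iso E E')
    (ψ : Iso F F')
    (hσ : ∀ (a : A) (v : E.fiber a), ψ.equiv a (σ.equiv a v) = σ'.equiv a (φ.equiv a v)) :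
    IsDifferenceClass E F σ c := by
  obtain ⟨G, G', h1, h2, h3⟩ := h
  exact ⟨G, G', h1.trans φ ψ hσ, h2.trans ψ ψ fun _ _ => rfl, h3⟩

theorem IsDifferenceClass.directSum {c c' : KRel A} (h : IsDifferenceClass E F σ c)
    (h' : IsDifferenceClass E' F' σ' c') :
    IsDifferenceClass (E.directSum E') (F.directSum F') (σ.restrictSum σ') (c + c') := by
  obtain ⟨G, G₂, h1, h2, h3⟩ := h
  obtain ⟨G', G₂', h1', h2', h3'⟩ := h'
  refine ⟨G.directSum G', G₂.directSum G₂', h1.directSum h1', ?_, ?_⟩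
  · exact (h2.directSum h2').trans (Iso.refl _) (Iso.refl _) fun _ _ => rfl
  · rw [AddSubgroup.coe_add, map_add, h3, h3', KGroup.cls_directSum, KGroup.cls_directSum]
    abel

/-- The two glued bundles are determined up to isomorphism, so the images in `K(Y)` agree, and the
map to `K(Y)` is injective on reduced classes. -/
theorem IsDifferenceClass.unique [CompactSpace X] [T2Space X] (hA : IsClosed A) {c c' : KRel A}
    (h : IsDifferenceClass E F σ c) (h' : IsDifferenceClass E F σ c') : c = c' := by
  obtain ⟨G, G₂, h1, h2, h3⟩ := h
  obtain ⟨G', G₂', h1', h2', h3'⟩ := h'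
  obtain ⟨φ⟩ := h1.nonempty_iso hA G.2 G'.2 h1'
  obtain ⟨ψ⟩ := h2.nonempty_iso hA G₂.2 G₂'.2 h2'
  rw [← sub_eq_zero]
  refine Subtype.ext (KRel.eq_zero_of_map_collapse hA _ (c - c').2 ?_)
  rw [AddSubgroup.coe_sub, map_sub, h3, h3', KGroup.cls_eq_of_iso φ, KGroup.cls_eq_of_iso ψ,
    sub_self]

/-- The class of an isomorphism which extends to the whole space vanishes. -/
theorem IsDifferenceClass.eq_zero [CompactSpace X] [T2Space X] (hA : IsClosed A) {c : KRel A}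
    (h : IsDifferenceClass E F σ c) (φ : Iso E F)
    (hφ : ∀ (a : A) (v : E.fiber a), φ.equiv a v = σ.equiv a v) : c = 0 := by
  obtain ⟨G, G₂, h1, h2, h3⟩ := h
  -- Using `φ` to identify the first copy of `E` with `F` turns the gluing by `σ` into the gluing by
  -- the identity.
  obtain ⟨ψ⟩ := h1.nonempty_iso hA G.2 G₂.2 (h2.trans φ (Iso.refl _) fun a v => (hφ a v).symm)
  refine Subtype.ext (KRel.eq_zero_of_map_collapse hA _ c.2 ?_)
  rw [h3, KGroup.cls_eq_of_iso ψ, sub_self]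

end DifferenceClass

/-! ### Alternating forms on concatenated tuples, and change of orthonormal basis. -/

section AppendAlternating

variable {V F : Type*} [NormedAddCommGroup V] [InnerProductSpace ℝ V] [NormedAddCommGroup F]
  [NormedSpace ℝ F] {m : ℕ} [FiniteDimensional ℝ V] [Fact (Module.finrank ℝ V = m)]

/-- The vector `x` has to cross the `k` entries of `u`, which costs one sign each. -/
theorem ContinuousAlternatingMap.map_append_cons (η : V [⋀^Fin m]→L[ℝ] F) {k l : ℕ}
    (h : k + (l + 1) = m) (h' : k + 1 + l = m) (u : Fin k → V) (x : V) (w : Fin l → V) :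
    η (Fin.append u (Fin.cons x w) ∘ Fin.cast h.symm) =
      (-1 : ℤ) ^ k • η (Fin.append (Fin.cons x u) w ∘ Fin.cast h'.symm) := by
  have hlm : l + (k + 1) = m := by omega
  -- Moving the block `w` to the front turns the form into an alternating function of the remaining
  -- block. The sign of `ρ` occurs on both sides and is never computed.
  let ρ : Equiv.Perm (Fin m) := (finCongr h'.symm).trans (finAddFlip.trans (finCongr hlm))
  have hρ : ∀ z : Fin (k + 1) → V, Fin.append z w ∘ Fin.cast h'.symm =
      (Fin.append w z ∘ Fin.cast hlm.symm) ∘ ρ := by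
    intro z
    subst h'
    funext j
    refine Fin.addCases (fun j => ?_) (fun j => ?_) j
    · simp [ρ]
    · simp [ρ]
  have key : ∀ z : Fin (k + 1) → V, η (Fin.append z w ∘ Fin.cast h'.symm) =
      Equiv.Perm.sign ρ • (contract η hlm w).toAlternatingMap z := by
    intro z
    rw [hρ]
    exact η.toAlternatingMap.map_perm _ ρ
  have h1 : Fin.append u (Fin.cons x w) ∘ Fin.cast h.symm =
      Fin.append (Fin.snoc u x : Fin (k + 1) → V) w ∘ Fin.cast h'.symm := by
    subst h'
    rw [Fin.append_right_cons]
    rfl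
  rw [h1, key, key, ← Fin.insertNth_last', AlternatingMap.map_insertNth]
  rw [smul_comm]
  rfl

/-- Induction on the length of the second block: its vectors cross the first block one at a time. -/
theorem ContinuousAlternatingMap.map_append_comm (η : V [⋀^Fin m]→L[ℝ] F) {k l : ℕ}
    (h : k + l = m) (h' : l + k = m) (u : Fin k → V) (w : Fin l → V) :
    η (Fin.append u w ∘ Fin.cast h.symm) =
      (-1 : ℤ) ^ (k * l) • η (Fin.append w u ∘ Fin.cast h'.symm) := by
  induction l generalizing k with
  | zero =>
    subst h
    simp only [Nat.mul_zero, pow_zero, one_smul]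
    congr 1
    funext j
    refine Fin.addCases (fun j => ?_) (fun j => j.elim0) j
    have : Fin.cast h'.symm (Fin.castAdd 0 j) = Fin.natAdd 0 j := by ext; simp
    rw [Function.comp_apply, Function.comp_apply, this, Fin.append_right]
    exact Fin.append_left u w j
  | succ l ih =>
    rw [← Fin.cons_self_tail w, η.map_append_cons h (by omega), ih (by omega) (by omega),
      η.map_append_cons (by omega) h', smul_smul, smul_smul]
    congr 1
    -- Only the parity of the exponents matters: the vector that has been moved is crossed back by
    -- the other `l` vectors, so the total is `k (l + 1)` only modulo two.
    rw [← pow_add, ← pow_add, neg_one_pow_eq_pow_mod_two, neg_one_pow_eq_pow_mod_two (n := k * (l + 1))]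
    congr 1
    ring_nf
    omega

/-- Expanding `e` in `e'`, the coefficients form an orthogonal matrix in every slot, so only the
diagonal terms survive. This makes the Hodge star independent of the basis. -/
theorem sum_orthonormalBasis_mul {E : Type*} [NormedAddCommGroup E] [InnerProductSpace ℝ E]
    {ι : Type*} [Fintype ι] [DecidableEq ι] {A : Type*} [NormedRing A] [NormedAlgebra ℝ A] {k : ℕ}
    (f g : MultilinearMap ℝ (fun _ : Fin k => E) A) (e e' : OrthonormalBasis ι ℝ E) :
    ∑ i : Fin k → ι, f (fun a => e (i a)) * g (fun a => e (i a)) =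
      ∑ i : Fin k → ι, f (fun a => e' (i a)) * g (fun a => e' (i a)) := by
  have hexp : ∀ (f : MultilinearMap ℝ (fun _ : Fin k => E) A) (i : Fin k → ι),
      f (fun a => e (i a)) =
        ∑ j : Fin k → ι, (∏ a, inner ℝ (e' (j a)) (e (i a))) • f (fun a => e' (j a)) := by
    intro f i
    have : (fun a => e (i a)) = fun a => ∑ b, inner ℝ (e' b) (e (i a)) • e' b := by
      funext a
      exact (e'.sum_repr' _).symm
    rw [this, f.map_sum]
    exact Finset.sum_congr rfl fun j _ => f.map_smul_univ _ _
  simp_rw [hexp f, hexp g, Finset.sum_mul_sum]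
  rw [Finset.sum_comm]
  refine Finset.sum_congr rfl fun j _ => ?_
  rw [Finset.sum_comm, Finset.sum_eq_single j]
  · simp_rw [smul_mul_smul_comm, ← Finset.prod_mul_distrib]
    rw [← Finset.sum_smul]
    -- The sum over multi-indices of products factors into a product over the slots of Parseval
    -- sums.
    have h := Finset.prod_univ_sum (fun _ : Fin k => (Finset.univ : Finset ι))
      (fun a b => inner ℝ (e' (j a)) (e b) * inner ℝ (e' (j a)) (e b))
    rw [Fintype.piFinset_univ] at h
    rw [← h, Finset.prod_eq_one, one_smul]
    intro a _
    have := e.sum_inner_mul_inner (e' (j a)) (e' (j a))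
    simp_rw [real_inner_comm (e' (j a))] at this ⊢
    rw [this]
    simp
  · intro j' _ hj
    simp_rw [smul_mul_smul_comm, ← Finset.prod_mul_distrib]
    rw [← Finset.sum_smul]
    have h := Finset.prod_univ_sum (fun _ : Fin k => (Finset.univ : Finset ι))
      (fun a b => inner ℝ (e' (j a)) (e b) * inner ℝ (e' (j' a)) (e b))
    rw [Fintype.piFinset_univ] at h
    obtain ⟨a, ha⟩ := Function.ne_iff.1 hj
    rw [← h, Finset.prod_eq_zero (Finset.mem_univ a), zero_smul]
    refine Eq.trans ?_ ((e.sum_inner_mul_inner (e' (j a)) (e' (j' a))).trans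
      (e'.orthonormal.2 (Ne.symm ha)))
    exact Finset.sum_congr rfl fun b _ => by rw [real_inner_comm (e b) (e' (j' a))]
  · simp

end AppendAlternating

/-! ### The Hodge star on a Euclidean space. -/

section HodgeStar

variable {V : Type*} [NormedAddCommGroup V] [InnerProductSpace ℝ V] {m : ℕ}
  [FiniteDimensional ℝ V] [Fact (Module.finrank ℝ V = m)]

theorem contract_apply {F : Type*} [NormedAddCommGroup F] [NormedSpace ℝ F]
    (η : V [⋀^Fin m]→L[ℝ] F) {k l : ℕ} (h : k + l = m) (u : Fin k → V) (w : Fin l → V) :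
    contract η h u w = η (Fin.append u w ∘ Fin.cast h.symm) :=
  rfl

theorem volForm_apply (o : Orientation ℝ V (Fin m)) (v : Fin m → V) :
    volForm o v = (o.volumeForm v : ℂ) :=
  rfl

/-- The contraction of an alternating form with the last `l` vectors, as a function of the first
ones. -/
theorem exists_contract_right {F : Type*} [NormedAddCommGroup F] [NormedSpace ℝ F]
    (η : V [⋀^Fin m]→L[ℝ] F) {k l : ℕ} (h : k + l = m) (w : Fin l → V) :
    ∃ g : V [⋀^Fin k]→L[ℝ] F, ∀ u, g u = η (Fin.append u w ∘ Fin.cast h.symm) := by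
  refine ⟨(-1 : ℤ) ^ (k * l) • contract η (by omega : l + k = m) w, fun u => ?_⟩
  rw [η.map_append_comm h (by omega)]
  rfl

/-- The Hodge star can be computed in any orthonormal basis. -/
theorem hodgeStar_apply (o : Orientation ℝ V (Fin m)) {k l : ℕ} (h : k + l = m)
    (e : OrthonormalBasis (Fin m) ℝ V) (β : V [⋀^Fin k]→L[ℝ] ℂ) (w : Fin l → V) :
    hodgeStar o h β w = ((k.factorial : ℂ)⁻¹) * ∑ i : Fin k → Fin m,
      β (fun a => e (i a)) * volForm o (Fin.append (fun a => e (i a)) w ∘ Fin.cast h.symm) := by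
  obtain ⟨g, hg⟩ := exists_contract_right (volForm o) h w
  have := sum_orthonormalBasis_mul β.toMultilinearMap g.toMultilinearMap
    ((stdOrthonormalBasis ℝ V).reindex (finCongr Fact.out)) e
  simp only [hg, ContinuousMultilinearMap.coe_coe,
    ContinuousAlternatingMap.coe_toContinuousMultilinearMap] at this
  rw [← this]
  simp only [hodgeStar, LinearMap.coe_mk, AddHom.coe_mk, ContinuousAlternatingMap.smul_apply,
    ContinuousAlternatingMap.sum_apply, smul_eq_mul, contract_apply]

/-- The Hodge star commutes with orientation preserving isometries. -/
theorem hodgeStar_compContinuousLinearMap {E : Type*} [NormedAddCommGroup E]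
    [InnerProductSpace ℝ E] [FiniteDimensional ℝ E] [Fact (Module.finrank ℝ E = m)]
    (o₀ : Orientation ℝ E (Fin m)) (o : Orientation ℝ V (Fin m)) (L : E ≃ₗᵢ[ℝ] V)
    (hL : Orientation.map (Fin m) L.toLinearEquiv o₀ = o) {k l : ℕ} (h : k + l = m)
    (β : V [⋀^Fin k]→L[ℝ] ℂ) :
    (hodgeStar o h β).compContinuousLinearMap (L.toContinuousLinearEquiv : E →L[ℝ] V) =
      hodgeStar o₀ h (β.compContinuousLinearMap (L.toContinuousLinearEquiv : E →L[ℝ] V)) := by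
  ext w
  let e := stdOrthonormalBasis ℝ E |>.reindex (finCongr (Fact.out : Module.finrank ℝ E = m))
  rw [ContinuousAlternatingMap.compContinuousLinearMap_apply, hodgeStar_apply o h (e.map L),
    hodgeStar_apply o₀ h e]
  congr 1
  refine Finset.sum_congr rfl fun i _ => ?_
  congr 1
  rw [volForm_apply, volForm_apply, ← hL, Orientation.volumeForm_map]
  congr 2
  funext j
  subst h
  refine Fin.addCases (fun j => ?_) (fun j => ?_) j <;> simp

variable (o : Orientation ℝ V (Fin m))

/-- In the defining sum only the rearrangements of `I` contribute. The signs of a rearrangement in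
the two factors cancel, so all `k!` terms are equal and absorb the factor `1 / k!`. -/
theorem hodgeStar_apply_basis {k l : ℕ} (h : k + l = m) (e : OrthonormalBasis (Fin m) ℝ V)
    (β : V [⋀^Fin k]→L[ℝ] ℂ) (I : Fin k → Fin m) (J : Fin l → Fin m)
    (hIJ : Function.Injective (Fin.append I J)) :
    hodgeStar o h β (fun a => e (J a)) =
      volForm o (fun a => e (Fin.append I J (Fin.cast h.symm a))) * β (fun a => e (I a)) := by
  obtain ⟨g, hg⟩ := exists_contract_right (volForm o) h (fun a => e (J a))
  have hg' : ∀ u : Fin k → Fin m, volForm o (Fin.append (fun a => e (u a)) (fun a => e (J a)) ∘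
      Fin.cast h.symm) = g (fun a => e (u a)) := fun u => (hg _).symm
  have hgI : volForm o (fun a => e (Fin.append I J (Fin.cast h.symm a))) =
      g (fun a => e (I a)) := by
    rw [hg]
    congr 1
    funext j
    subst h
    refine Fin.addCases (fun j => ?_) (fun j => ?_) j <;> simp
  obtain ⟨hI, hJ, hd⟩ := Fin.append_injective_iff.1 hIJ
  rw [hodgeStar_apply o h e, hgI]
  simp_rw [hg']
  have hsum : ∑ σ : Equiv.Perm (Fin k), β (fun a => e (I (σ a))) * g (fun a => e (I (σ a))) =
      ∑ i : Fin k → Fin m, β (fun a => e (i a)) * g (fun a => e (i a)) := by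
    refine Finset.sum_of_injOn (fun σ a => I (σ a)) ?_ (fun _ _ => Finset.mem_coe.2 (Finset.mem_univ _)) ?_ ?_
    · intro σ _ τ _ hστ
      exact Equiv.ext fun a => hI (congrFun hστ a)
    · intro i _ hi
      by_cases hinj : Function.Injective i
      swap
      · have : β (fun a => e (i a)) = 0 := by
          obtain ⟨a, b, hab, hne⟩ := Function.not_injective_iff.1 hinj
          exact β.map_eq_zero_of_eq _ (congrArg e hab) hne
        rw [this, zero_mul]
      -- `I` and `J` exhaust the indices, so an injective multi-index avoiding `J` would be a
      -- rearrangement of `I`. Any other one repeats an index of `J`, which kills the volume form.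
      have : ∃ a b, i a = J b := by
        by_contra! hcon
        refine hi ?_
        have hr : ∀ a, ∃ b, I b = i a := by
          intro a
          have hbij : Function.Bijective (Fin.append I J) := by
            rw [Fintype.bijective_iff_injective_and_card]
            exact ⟨hIJ, by simp [h]⟩
          obtain ⟨b, hb⟩ := hbij.2 (i a)
          revert hb
          refine Fin.addCases (fun b hb => ⟨b, by simpa using hb⟩) (fun b hb => ?_) b
          exact absurd (by simpa using hb.symm) (hcon a b)
        choose σ hσ using hr
        have hσinj : Function.Injective σ := fun a b hab =>
          hinj (by rw [← hσ, ← hσ, hab])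
        refine ⟨Equiv.ofBijective σ (Finite.injective_iff_bijective.1 hσinj),
          Finset.mem_coe.2 (Finset.mem_univ _), ?_⟩
        funext a
        exact hσ a
      obtain ⟨a, b, hab⟩ := this
      rw [hg]
      have : volForm o (Fin.append (fun a => e (i a)) (fun a => e (J a)) ∘ Fin.cast h.symm) = 0 := by
        subst h
        refine (volForm o).map_eq_zero_of_eq _ (i := Fin.castAdd l a) (j := Fin.natAdd k b) ?_ ?_
        · simp [hab]
        · intro hh
          have := congrArg Fin.val hh
          simp at this
          omega
      rw [this, mul_zero]
    · intro σ _
      rfl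
  rw [← hsum]
  have hterm : ∀ σ : Equiv.Perm (Fin k), β (fun a => e (I (σ a))) * g (fun a => e (I (σ a))) =
      g (fun a => e (I a)) * β (fun a => e (I a)) := by
    intro σ
    have h1 : β (fun a => e (I (σ a))) = Equiv.Perm.sign σ • β (fun a => e (I a)) :=
      β.toAlternatingMap.map_perm (fun a => e (I a)) σ
    have h2 : g (fun a => e (I (σ a))) = Equiv.Perm.sign σ • g (fun a => e (I a)) :=
      g.toAlternatingMap.map_perm (fun a => e (I a)) σ
    rw [h1, h2]
    rcases Int.units_eq_one_or (Equiv.Perm.sign σ) with hs | hs <;> rw [hs] <;> simp [mul_comm]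
  rw [Finset.sum_congr rfl fun σ _ => hterm σ, Finset.sum_const, Finset.card_univ,
    Fintype.card_perm, Fintype.card_fin, nsmul_eq_mul, ← mul_assoc,
    inv_mul_cancel₀ (by exact_mod_cast k.factorial_ne_zero), one_mul]

/-- On basis tuples the two applications contribute `vol(e_J, e_I)` and `vol(e_I, e_J)`. The first
is `(-1)^(kl)` times the second, and the second squares to one. -/
theorem hodgeStar_hodgeStar {k l : ℕ} (h : k + l = m) (h' : l + k = m)
    (β : V [⋀^Fin k]→L[ℝ] ℂ) :
    hodgeStar o h' (hodgeStar o h β) = (-1 : ℤ) ^ (k * l) • β := by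
  let e := (stdOrthonormalBasis ℝ V).reindex (finCongr (Fact.out : Module.finrank ℝ V = m))
  apply ContinuousAlternatingMap.toAlternatingMap_injective
  refine Module.Basis.ext_alternating e.toBasis fun I hI => ?_
  simp only [OrthonormalBasis.coe_toBasis]
  have hc : (Finset.univ.image I)ᶜ.card = l := by
    rw [Finset.card_compl, Finset.card_image_of_injective _ hI]
    simp
    omega
  -- Any enumeration of the indices not in `I` would do.
  let J : Fin l → Fin m := (Finset.univ.image I)ᶜ.orderEmbOfFin hc
  have hJ : Function.Injective J := ((Finset.univ.image I)ᶜ.orderEmbOfFin hc).injective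
  have hd : ∀ a b, I a ≠ J b := by
    intro a b hab
    have := (Finset.univ.image I)ᶜ.orderEmbOfFin_mem hc b
    rw [Finset.mem_compl] at this
    exact this (Finset.mem_image.2 ⟨a, Finset.mem_univ _, hab⟩)
  have h1 : Function.Injective (Fin.append I J) := Fin.append_injective_iff.2 ⟨hI, hJ, hd⟩
  have h2 : Function.Injective (Fin.append J I) :=
    Fin.append_injective_iff.2 ⟨hJ, hI, fun a b => (hd b a).symm⟩
  have e1 := hodgeStar_apply_basis o h' e (hodgeStar o h β) J I h2
  rw [hodgeStar_apply_basis o h e β I J h1] at e1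
  refine e1.trans ?_
  have hcomp : ∀ (k l : ℕ) (h : k + l = m) (I : Fin k → Fin m) (J : Fin l → Fin m),
      (fun a => e (Fin.append I J (Fin.cast h.symm a))) =
        Fin.append (fun a => e (I a)) (fun a => e (J a)) ∘ Fin.cast h.symm := by
    intro k l h I J
    funext j
    subst h
    refine Fin.addCases (fun j => ?_) (fun j => ?_) j <;> simp
  have hsq : volForm o (fun a => e (Fin.append I J (Fin.cast h.symm a))) *
      volForm o (fun a => e (Fin.append I J (Fin.cast h.symm a))) = 1 := by
    rw [volForm_apply, ← Complex.ofReal_mul, ← abs_mul_abs_self]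
    have hb : Function.Bijective (fun a => Fin.append I J (Fin.cast h.symm a)) := by
      rw [← Finite.injective_iff_bijective]
      exact h1.comp (Fin.cast_injective _)
    have := o.abs_volumeForm_apply_of_orthonormal (e.reindex (Equiv.ofBijective _ hb).symm)
    have h3 : (e.reindex (Equiv.ofBijective _ hb).symm : Fin m → V) =
        fun a => e (Fin.append I J (Fin.cast h.symm a)) := by
      funext a
      simp
    rw [h3] at this
    rw [this]
    simp
  rw [hcomp l k h', (volForm o).map_append_comm h' h, ← hcomp k l h, smul_mul_assoc, ← mul_assoc, hsq,
    one_mul, mul_comm l k]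
  rfl

end HodgeStar

/-! ### Exterior multiplication by a covector and contraction with a vector. -/

section Wedge

variable {V : Type*} [NormedAddCommGroup V] [NormedSpace ℝ V]

/-- The exterior product of a covector with an alternating form. -/
noncomputable def wedge (ξ : V →L[ℝ] ℝ) {k : ℕ} (β : V [⋀^Fin k]→L[ℝ] ℂ) :
    V [⋀^Fin (k + 1)]→L[ℝ] ℂ :=
  ContinuousAlternatingMap.alternatizeUncurryFin (ξ.smulRight β)

theorem wedge_apply (ξ : V →L[ℝ] ℝ) {k : ℕ} (β : V [⋀^Fin k]→L[ℝ] ℂ) (w : Fin (k + 1) → V) :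
    wedge ξ β w = ∑ p : Fin (k + 1), (-1 : ℤ) ^ (p : ℕ) • (ξ (w p) • β (p.removeNth w)) :=
  ContinuousAlternatingMap.alternatizeUncurryFin_apply _ _

theorem wedge_add (ξ : V →L[ℝ] ℝ) {k : ℕ} (β γ : V [⋀^Fin k]→L[ℝ] ℂ) :
    wedge ξ (β + γ) = wedge ξ β + wedge ξ γ := by
  ext w
  simp only [wedge_apply, ContinuousAlternatingMap.add_apply, smul_add, Finset.sum_add_distrib]

theorem wedge_smul (ξ : V →L[ℝ] ℝ) {k : ℕ} (c : ℂ) (β : V [⋀^Fin k]→L[ℝ] ℂ) :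
    wedge ξ (c • β) = c • wedge ξ β := by
  ext w
  simp only [wedge_apply, ContinuousAlternatingMap.smul_apply, Finset.smul_sum]
  refine Finset.sum_congr rfl fun p _ => ?_
  rw [smul_comm (ξ (w p)) c, smul_comm _ c]

theorem wedge_neg (ξ : V →L[ℝ] ℝ) {k : ℕ} (β : V [⋀^Fin k]→L[ℝ] ℂ) :
    wedge ξ (-β) = -wedge ξ β := by
  ext w
  simp [wedge_apply]

theorem wedge_zero (ξ : V →L[ℝ] ℝ) {k : ℕ} : wedge ξ (0 : V [⋀^Fin k]→L[ℝ] ℂ) = 0 := by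
  ext w
  simp [wedge_apply]

/-- The bilinear map `(x, y) ↦ ξ x • ξ y • β` is symmetric in the two vectors, and alternating it
twice gives zero. -/
theorem wedge_wedge (ξ : V →L[ℝ] ℝ) {k : ℕ} (β : V [⋀^Fin k]→L[ℝ] ℂ) :
    wedge ξ (wedge ξ β) = 0 := by
  have h := ContinuousAlternatingMap.alternatizeUncurryFin_alternatizeUncurryFinCLM_comp_of_symmetric
    (f := ξ.smulRight (ξ.smulRight β)) (fun x y => by
      simp only [ContinuousLinearMap.smulRight_apply, smul_apply]
      rw [smul_comm])
  rw [← h]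
  unfold wedge
  congr 1
  ext x : 1
  simp only [ContinuousLinearMap.smulRight_apply, ContinuousLinearMap.comp_apply,
    ContinuousAlternatingMap.alternatizeUncurryFinCLM_apply]
  rw [ContinuousAlternatingMap.alternatizeUncurryFin_smul]

/-- Degree zero stands apart because a function has no contraction. -/
theorem curryLeft_wedge_zero (ξ : V →L[ℝ] ℝ) (v : V) (β : V [⋀^Fin 0]→L[ℝ] ℂ) :
    (wedge ξ β).curryLeft v = (ξ v : ℂ) • β := by
  ext w
  rw [ContinuousAlternatingMap.curryLeft_apply_apply, wedge_apply]
  simp [Matrix.vecCons]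

/-- Contraction is an antiderivation: the term in which `ξ` meets `v` is the first summand, and in
all the others the index is shifted by one, which produces the minus sign. -/
theorem curryLeft_wedge_succ (ξ : V →L[ℝ] ℝ) (v : V) {k : ℕ} (β : V [⋀^Fin (k + 1)]→L[ℝ] ℂ) :
    (wedge ξ β).curryLeft v = (ξ v : ℂ) • β - wedge ξ (β.curryLeft v) := by
  ext w
  rw [ContinuousAlternatingMap.curryLeft_apply_apply, wedge_apply, Fin.sum_univ_succ,
    ContinuousAlternatingMap.sub_apply, wedge_apply, sub_eq_add_neg, ← Finset.sum_neg_distrib]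
  congr 1
  · simp [Matrix.vecCons]
  · refine Finset.sum_congr rfl fun p _ => ?_
    rw [ContinuousAlternatingMap.curryLeft_apply_apply]
    have : (p.succ).removeNth (Matrix.vecCons v w) = Matrix.vecCons v (p.removeNth w) := by
      funext j
      refine Fin.cases ?_ (fun j => ?_) j
      · simp [Fin.removeNth, Matrix.vecCons]
      · simp [Fin.removeNth, Matrix.vecCons]
    rw [this, Matrix.cons_val_succ, Fin.val_succ, pow_succ]
    simp

theorem ContinuousAlternatingMap.curryLeft_curryLeft_self {k : ℕ} (v : V)
    (β : V [⋀^Fin (k + 2)]→L[ℝ] ℂ) : (β.curryLeft v).curryLeft v = 0 := by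
  ext w
  rw [ContinuousAlternatingMap.curryLeft_apply_apply, ContinuousAlternatingMap.curryLeft_apply_apply]
  exact β.map_eq_zero_of_eq _ (i := 0) (j := 1) (by simp) (by simp)

end Wedge

/-! ### The Hodge star exchanges exterior multiplication and contraction. -/

section StarWedge

variable {V : Type*} [NormedAddCommGroup V] [InnerProductSpace ℝ V] {m : ℕ}
  [FiniteDimensional ℝ V] [Fact (Module.finrank ℝ V = m)] (o : Orientation ℝ V (Fin m))

theorem ContinuousAlternatingMap.eq_zero_of_finrank_lt {k : ℕ} (hk : m < k)
    (β : V [⋀^Fin k]→L[ℝ] ℂ) : β = 0 := by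
  ext w
  refine β.toAlternatingMap.map_linearDependent w fun hw => ?_
  have := hw.fintype_card_le_finrank
  rw [Fintype.card_fin, (Fact.out : Module.finrank ℝ V = m)] at this
  omega

/-- In the basis formula each of the `k + 1` positions of `ξ` contributes the same amount, since `∑
ξ(e_a) e_a` reassembles `v`. The factor `k + 1` turns `1 / (k + 1)!` into `1 / k!`, and moving `v`
past the `k` summation vectors gives the sign. -/
theorem hodgeStar_wedge (ξ : V →L[ℝ] ℝ) (v : V) (hv : ∀ w, ξ w = inner ℝ v w) {k l : ℕ}
    (h : k + 1 + l = m) (h' : k + (l + 1) = m) (β : V [⋀^Fin k]→L[ℝ] ℂ) :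
    hodgeStar o h (wedge ξ β) = (-1 : ℤ) ^ k • (hodgeStar o h' β).curryLeft v := by
  ext w
  let e := (stdOrthonormalBasis ℝ V).reindex (finCongr (Fact.out : Module.finrank ℝ V = m))
  obtain ⟨g, hg⟩ := exists_contract_right (volForm o) h w
  have h1 : ∑ i : Fin (k + 1) → Fin m, wedge ξ β (fun a => e (i a)) * g (fun a => e (i a)) =
      (k + 1 : ℂ) * ∑ j : Fin k → Fin m, β (fun a => e (j a)) *
        g (Matrix.vecCons v (fun a => e (j a))) := by
    simp_rw [wedge_apply, Finset.sum_mul]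
    rw [Finset.sum_comm]
    have hp : ∀ p : Fin (k + 1), ∑ i : Fin (k + 1) → Fin m,
        ((-1 : ℤ) ^ (p : ℕ) • (ξ (e (i p)) • β (p.removeNth fun a => e (i a)))) *
          g (fun a => e (i a)) = ∑ j : Fin k → Fin m, β (fun a => e (j a)) *
        g (Matrix.vecCons v (fun a => e (j a))) := by
      intro p
      -- A multi-index is split into its entry at `p` and the remaining ones; the sum over the
      -- former rebuilds `v`.
      rw [← (Fin.insertNthEquiv (fun _ => Fin m) p).sum_comp, Fintype.sum_prod_type_right]
      refine Finset.sum_congr rfl fun j _ => ?_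
      have hvs : Matrix.vecCons v (fun a => e (j a)) =
          Matrix.vecCons (∑ a, inner ℝ (e a) v • e a) (fun a => e (j a)) := by
        rw [e.sum_repr' v]
      have hlin : g (Matrix.vecCons (∑ a, inner ℝ (e a) v • e a) (fun a => e (j a))) =
          ∑ a, inner ℝ (e a) v • g (Matrix.vecCons (e a) (fun a => e (j a))) := by
        have := congrArg (fun c : V [⋀^Fin k]→L[ℝ] ℂ => c (fun a => e (j a)))
          (map_sum g.curryLeft (fun a => inner ℝ (e a) v • e a) Finset.univ)
        simp only [ContinuousAlternatingMap.sum_apply, map_smul,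
          ContinuousAlternatingMap.smul_apply,
          ContinuousAlternatingMap.curryLeft_apply_apply] at this
        exact this
      rw [hvs, hlin, Finset.mul_sum]
      refine Finset.sum_congr rfl fun a _ => ?_
      have e1 : (fun b => e ((Fin.insertNthEquiv (fun _ => Fin m) p) (a, j) b)) =
          p.insertNth (e a) (fun b => e (j b)) := by
        funext b
        refine Fin.succAboveCases p ?_ (fun b => ?_) b <;> simp
      have e2 : (p.removeNth fun b => e ((Fin.insertNthEquiv (fun _ => Fin m) p) (a, j) b)) =
          fun b => e (j b) := by
        rw [e1, Fin.removeNth_insertNth]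
      rw [e2, e1, g.map_insertNth, hv, real_inner_comm]
      simp only [Fin.insertNthEquiv_apply, Fin.insertNth_apply_same]
      -- The sign of the summand in the exterior product and the sign for bringing the `p`-th
      -- argument of `g` to the front are both `(-1)^p`.
      rw [smul_mul_smul_comm, ← mul_pow]
      simp
      ring
    rw [Finset.sum_congr rfl fun p _ => hp p, Finset.sum_const, Finset.card_univ,
      Fintype.card_fin, nsmul_eq_mul]
    push_cast
    ring
  rw [hodgeStar_apply o h e]
  have h2 : (((-1 : ℤ) ^ k • (hodgeStar o h' β).curryLeft v) : V [⋀^Fin l]→L[ℝ] ℂ) w =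
      (-1 : ℤ) ^ k • hodgeStar o h' β (Matrix.vecCons v w) := rfl
  rw [h2, hodgeStar_apply o h' e, ← Finset.sum_congr rfl fun i _ => congrArg _ (hg _), h1,
    Nat.factorial_succ]
  have h3 : ∀ j : Fin k → Fin m, volForm o (Fin.append (fun a => e (j a)) (Matrix.vecCons v w) ∘
      Fin.cast h'.symm) = (-1 : ℤ) ^ k • g (Matrix.vecCons v (fun a => e (j a))) := by
    intro j
    rw [hg]
    exact (volForm o).map_append_cons h' h _ v w
  simp_rw [h3, mul_smul_comm, ← Finset.smul_sum]
  rw [mul_smul_comm, smul_smul, ← mul_pow]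
  simp only [mul_neg, mul_one, neg_neg, one_pow, one_smul]
  push_cast
  have : (k + 1 : ℂ) ≠ 0 := by exact_mod_cast k.succ_ne_zero
  have h4 : (k.factorial : ℂ) ≠ 0 := by exact_mod_cast k.factorial_ne_zero
  field_simp

end StarWedge

/-- The space of complex valued alternating forms of all degrees. -/
abbrev ExtAlg (V : Type*) [AddCommGroup V] [Module ℝ V] [TopologicalSpace V] :=
  ∀ k : ℕ, V [⋀^Fin k]→L[ℝ] ℂ

/-! ### Forms of all degrees: the Clifford relation and the involution `τ`. -/

section Graded

/-- The pullback of alternating forms of all degrees along a linear map. -/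
noncomputable def gradedComp {V E : Type*} [AddCommGroup V] [Module ℝ V] [TopologicalSpace V]
    [AddCommGroup E] [Module ℝ E] [TopologicalSpace E] (L : E →L[ℝ] V) :
    ExtAlg V →ₗ[ℂ] ExtAlg E where
  toFun η k := (η k).compContinuousLinearMap L
  map_add' _ _ := rfl
  map_smul' _ _ := rfl

/-- The exterior product of a covector with forms of all degrees. -/
noncomputable def gradedWedge {V : Type*} [NormedAddCommGroup V] [NormedSpace ℝ V]
    (ξ : V →L[ℝ] ℝ) : ExtAlg V →ₗ[ℂ] ExtAlg V where
  toFun η k := match k with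
    | 0 => 0
    | k + 1 => wedge ξ (η k)
  map_add' η θ := by
    funext k
    cases k with
    | zero => exact (add_zero _).symm
    | succ k => exact wedge_add ξ _ _
  map_smul' c η := by
    funext k
    cases k with
    | zero =>
      ext w
      exact (mul_zero c).symm
    | succ k => exact wedge_smul ξ c _

variable {V : Type*} [NormedAddCommGroup V] [InnerProductSpace ℝ V] {n : ℕ}
  [FiniteDimensional ℝ V] [Fact (Module.finrank ℝ V = 2 * n)]

/-- The Hodge star on forms of all degrees. -/
noncomputable def gradedStar (o : Orientation ℝ V (Fin (2 * n))) : ExtAlg V →ₗ[ℂ] ExtAlg V :=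
  LinearMap.pi fun l =>
    if h : l ≤ 2 * n then
      (hodgeStar o (Nat.sub_add_cancel h)).comp (LinearMap.proj (2 * n - l))
    else 0

/-- The involution `τ` on forms of all degrees. -/
noncomputable def gradedTau (o : Orientation ℝ V (Fin (2 * n))) : ExtAlg V →ₗ[ℂ] ExtAlg V :=
  LinearMap.pi fun l =>
    (Complex.I ^ (n + (2 * n - l) * (2 * n - l - 1))) •
      (LinearMap.proj l).comp (gradedStar o)

/-- The action of a covector on forms of all degrees, the symbol of `d + δ`. -/
noncomputable def clifford (o : Orientation ℝ V (Fin (2 * n))) (ξ : V →L[ℝ] ℝ) :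
    ExtAlg V →ₗ[ℂ] ExtAlg V :=
  gradedWedge ξ - gradedStar o ∘ₗ gradedWedge ξ ∘ₗ gradedStar o

variable (o : Orientation ℝ V (Fin (2 * n)))

theorem gradedStar_apply {k l : ℕ} (h : k + l = 2 * n) (η : ExtAlg V) :
    gradedStar o η l = hodgeStar o h (η k) := by
  obtain rfl : k = 2 * n - l := by omega
  have hl : l ≤ 2 * n := by omega
  simp [gradedStar, hl]

theorem gradedTau_apply {k l : ℕ} (h : k + l = 2 * n) (η : ExtAlg V) :
    gradedTau o η l = (Complex.I ^ (n + k * (k - 1))) • gradedStar o η l := by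
  obtain rfl : k = 2 * n - l := by omega
  rfl

/-- In even dimension complementary degrees have the same parity, which reduces the exponent `l (2n
- l)` to `l`. Above degree `2n` everything vanishes. -/
theorem gradedStar_gradedStar (η : ExtAlg V) (l : ℕ) :
    gradedStar o (gradedStar o η) l = (-1 : ℂ) ^ l • η l := by
  rcases le_or_gt l (2 * n) with hl | hl
  · obtain ⟨k, hk⟩ := Nat.exists_eq_add_of_le hl
    rw [gradedStar_apply o (by omega : k + l = 2 * n),
      gradedStar_apply o (by omega : l + k = 2 * n), hodgeStar_hodgeStar]
    have : (-1 : ℤ) ^ (l * k) = (-1) ^ l := by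
      rcases Nat.even_or_odd l with he | ho
      · rw [he.neg_one_pow, (he.mul_right k).neg_one_pow]
      · have : Odd k := by
          rw [Nat.odd_iff] at ho ⊢
          omega
        rw [ho.neg_one_pow, (ho.mul this).neg_one_pow]
    rw [this]
    ext w
    simp
  · exact (ContinuousAlternatingMap.eq_zero_of_finrank_lt hl _).trans (ContinuousAlternatingMap.eq_zero_of_finrank_lt hl _).symm

/-- The star turns exterior multiplication into contraction, and in even dimension the signs of the
two stars cancel against it. This identifies the symbol of `δ` with minus the contraction. -/
theorem gradedStar_gradedWedge_gradedStar (ξ : V →L[ℝ] ℝ) (v : V) (hv : ∀ w, ξ w = inner ℝ v w)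
    (η : ExtAlg V) (l : ℕ) :
    gradedStar o (gradedWedge ξ (gradedStar o η)) l = (η (l + 1)).curryLeft v := by
  rcases le_or_gt l (2 * n) with hl | hl
  · obtain ⟨k, hk⟩ := Nat.exists_eq_add_of_le hl
    rw [gradedStar_apply o (by omega : k + l = 2 * n)]
    cases k with
    | zero =>
      rw [ContinuousAlternatingMap.eq_zero_of_finrank_lt (by omega : 2 * n < l + 1) (η (l + 1))]
      exact (hodgeStar o _).map_zero
    | succ k =>
      change hodgeStar o _ (wedge ξ (gradedStar o η k)) = _
      rw [hodgeStar_wedge o ξ v hv (by omega) (by omega : k + (l + 1) = 2 * n),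
        gradedStar_apply o (by omega : l + 1 + k = 2 * n), hodgeStar_hodgeStar]
      -- Since `k + (l + 1) = 2n`, the numbers `k` and `l + 1` have the same parity.
      have : (-1 : ℤ) ^ k * (-1 : ℤ) ^ ((l + 1) * k) = 1 := by
        rw [← pow_add]
        refine Even.neg_one_pow ?_
        rcases Nat.even_or_odd k with he | ho
        · exact he.add (he.mul_left _)
        · have : Odd (l + 1) := by
            rw [Nat.odd_iff] at ho ⊢
            omega
          exact ho.add_odd (this.mul ho)
      ext w
      change (-1 : ℤ) ^ k • ((-1 : ℤ) ^ ((l + 1) * k) • η (l + 1) (Matrix.vecCons v w)) = _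
      rw [smul_smul, this, one_smul]
      rfl
  · rw [ContinuousAlternatingMap.eq_zero_of_finrank_lt (by omega : 2 * n < l + 1) (η (l + 1))]
    exact ContinuousAlternatingMap.eq_zero_of_finrank_lt hl _

theorem clifford_apply (ξ : V →L[ℝ] ℝ) (v : V) (hv : ∀ w, ξ w = inner ℝ v w) (η : ExtAlg V)
    (l : ℕ) : clifford o ξ η l = gradedWedge ξ η l - (η (l + 1)).curryLeft v := by
  rw [← gradedStar_gradedWedge_gradedStar o ξ v hv]
  rfl

/-- Exterior multiplication and contraction both square to zero, and their anticommutator is `ξ v =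
|ξ|²` for the metric dual `v` of `ξ`. Ellipticity and the rotation over the disc bundle both come
from this relation. -/
theorem clifford_clifford (ξ : V →L[ℝ] ℝ) (η : ExtAlg V) :
    clifford o ξ (clifford o ξ η) = -((‖ξ‖ ^ 2 : ℝ) : ℂ) • η := by
  let v := (InnerProductSpace.toDual ℝ V).symm ξ
  have hv : ∀ w, ξ w = inner ℝ v w := fun w => by simp [v]
  have hξ : ξ v = ‖ξ‖ ^ 2 := by
    rw [hv, real_inner_self_eq_norm_sq, LinearIsometryEquiv.norm_map]
  funext l
  have hneg : ∀ (c : ℂ) (k : ℕ) (β : V [⋀^Fin k]→L[ℝ] ℂ), (-c) • β = -(c • β) := by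
    intro c k β
    ext w
    simp
  have hc : (clifford o ξ η (l + 1)).curryLeft v =
      (wedge ξ (η l)).curryLeft v - ((η (l + 2)).curryLeft v).curryLeft v := by
    rw [clifford_apply o ξ v hv]
    rfl
  rw [clifford_apply o ξ v hv, hc, ContinuousAlternatingMap.curryLeft_curryLeft_self, sub_zero,
    ← hξ]
  change _ = -(ξ v : ℂ) • η l
  cases l with
  | zero =>
    rw [curryLeft_wedge_zero, hneg]
    exact zero_sub _
  | succ l =>
    rw [curryLeft_wedge_succ, hneg]
    have hw : gradedWedge ξ (clifford o ξ η) (l + 1) = - wedge ξ ((η (l + 1)).curryLeft v) := by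
      change wedge ξ (clifford o ξ η l) = _
      rw [clifford_apply o ξ v hv, sub_eq_add_neg, wedge_add, wedge_neg]
      have h1 : wedge ξ (gradedWedge ξ η l) = 0 := by
        cases l with
        | zero => exact wedge_zero ξ
        | succ l => exact wedge_wedge ξ _
      rw [h1, zero_add]
    rw [hw]
    abel

/-- The powers of `i` in the definition of `τ` are chosen so that, together with the sign of the
double star, the total exponent is `(k + l)² = 4n²`. -/
theorem gradedTau_gradedTau (η : ExtAlg V) : gradedTau o (gradedTau o η) = η := by
  funext l
  rcases le_or_gt l (2 * n) with hl | hl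
  · obtain ⟨k, hk⟩ := Nat.exists_eq_add_of_le hl
    have hk' : k + l = 2 * n := by omega
    have hl' : l + k = 2 * n := by omega
    rw [gradedTau_apply o hk', gradedStar_apply o hk', gradedTau_apply o hl', map_smul,
      ← gradedStar_apply o hk', gradedStar_gradedStar, smul_smul, smul_smul]
    have : Complex.I ^ (n + k * (k - 1)) * Complex.I ^ (n + l * (l - 1)) * (-1) ^ l = 1 := by
      -- As `k` and `l` have the same parity, `l` may be replaced by `k l`, which supplies the cross
      -- term of the square.
      have h2 : (-1 : ℂ) ^ l = Complex.I ^ (2 * (k * l)) := by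
        rw [pow_mul, Complex.I_sq]
        rcases Nat.even_or_odd l with he | ho
        · rw [he.neg_one_pow, (he.mul_left k).neg_one_pow]
        · have : Odd k := by
            rw [Nat.odd_iff] at ho ⊢
            omega
          rw [ho.neg_one_pow, (this.mul ho).neg_one_pow]
      rw [h2, ← pow_add, ← pow_add]
      have h3 : ∀ j : ℕ, j * (j - 1) + j = j * j := by
        intro j
        cases j with
        | zero => rfl
        | succ j => simp; ring
      have h4 : n + k * (k - 1) + (n + l * (l - 1)) + 2 * (k * l) = 4 * (n * n) := by
        have a := h3 k
        have b := h3 l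
        have c : (k + l) * (k + l) = (2 * n) * (2 * n) := by rw [hk']
        nlinarith
      rw [h4, pow_mul, Complex.I_pow_four, one_pow]
    rw [this, one_smul]
  · exact (ContinuousAlternatingMap.eq_zero_of_finrank_lt hl _).trans (ContinuousAlternatingMap.eq_zero_of_finrank_lt hl _).symm

end Graded

/-! ### Naturality under orientation preserving isometries. -/

section GradedComp

variable {V E : Type*} [NormedAddCommGroup V] [NormedAddCommGroup E]

theorem gradedComp_gradedWedge [NormedSpace ℝ V] [NormedSpace ℝ E] (L : E →L[ℝ] V) (ξ : V →L[ℝ] ℝ)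
    (η : ExtAlg V) :
    gradedComp L (gradedWedge ξ η) = gradedWedge (ξ.comp L) (gradedComp L η) := by
  funext k
  cases k with
  | zero => rfl
  | succ k =>
    ext w
    change wedge ξ (η k) (L ∘ w) = wedge (ξ.comp L) ((η k).compContinuousLinearMap L) w
    rw [wedge_apply, wedge_apply]
    rfl

variable [InnerProductSpace ℝ V] {n : ℕ} [FiniteDimensional ℝ V]
  [Fact (Module.finrank ℝ V = 2 * n)] [InnerProductSpace ℝ E] [FiniteDimensional ℝ E]
  [Fact (Module.finrank ℝ E = 2 * n)] (o₀ : Orientation ℝ E (Fin (2 * n)))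
  (o : Orientation ℝ V (Fin (2 * n))) (L : E ≃ₗᵢ[ℝ] V)
  (hL : Orientation.map (Fin (2 * n)) L.toLinearEquiv o₀ = o)

include hL

theorem gradedComp_gradedStar (η : ExtAlg V) :
    gradedComp (L.toContinuousLinearEquiv : E →L[ℝ] V) (gradedStar o η) =
      gradedStar o₀ (gradedComp (L.toContinuousLinearEquiv : E →L[ℝ] V) η) := by
  funext l
  rcases le_or_gt l (2 * n) with hl | hl
  · rw [gradedStar_apply o₀ (Nat.sub_add_cancel hl)]
    change (gradedStar o η l).compContinuousLinearMap _ = _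
    rw [gradedStar_apply o (Nat.sub_add_cancel hl), hodgeStar_compContinuousLinearMap o₀ o L hL]
    rfl
  · exact (ContinuousAlternatingMap.eq_zero_of_finrank_lt hl _).trans (ContinuousAlternatingMap.eq_zero_of_finrank_lt hl _).symm

theorem gradedComp_gradedTau (η : ExtAlg V) :
    gradedComp (L.toContinuousLinearEquiv : E →L[ℝ] V) (gradedTau o η) =
      gradedTau o₀ (gradedComp (L.toContinuousLinearEquiv : E →L[ℝ] V) η) := by
  funext l
  exact congrArg ((Complex.I ^ (n + (2 * n - l) * (2 * n - l - 1)) : ℂ) • ·) (congrFun (gradedComp_gradedStar o₀ o L hL η) l)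

theorem gradedComp_clifford (ξ : V →L[ℝ] ℝ) (η : ExtAlg V) :
    gradedComp (L.toContinuousLinearEquiv : E →L[ℝ] V) (clifford o ξ η) =
      clifford o₀ (ξ.comp (L.toContinuousLinearEquiv : E →L[ℝ] V))
        (gradedComp (L.toContinuousLinearEquiv : E →L[ℝ] V) η) := by
  simp only [clifford, LinearMap.sub_apply, map_sub, LinearMap.comp_apply,
    gradedComp_gradedWedge, gradedComp_gradedStar o₀ o L hL]

end GradedComp

/-! ### Smooth orthonormal frames. -/

section Frame

variable {n : ℕ} {M : Type u} [TopologicalSpace M]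
  [ChartedSpace (EuclideanSpace ℝ (Fin (2 * n))) M] [IsManifold (𝓡 (2 * n)) ∞ M]

local notation "𝔼" => EuclideanSpace ℝ (Fin (2 * n))

variable (n) in
/-- The vector fields over a coordinate neighbourhood of `x₀` given by the coordinates. -/
noncomputable def coordFrame (x₀ : M) (i : Fin (2 * n)) (x : M) : TangentSpace (𝓡 (2 * n)) x :=
  (trivializationAt 𝔼 (TangentSpace (𝓡 (2 * n)) : M → Type _) x₀).localFrame
    (EuclideanSpace.basisFun (Fin (2 * n)) ℝ).toBasis i x

/-- The tangent bundle costs one derivative, which is harmless at `∞` since `∞ + 1 = ∞`. -/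
instance contMDiffVectorBundle_tangentSpace :
    ContMDiffVectorBundle ∞ 𝔼 (TangentSpace (𝓡 (2 * n)) : M → Type _) (𝓡 (2 * n)) :=
  haveI : IsManifold (𝓡 (2 * n)) (∞ + 1) M := ‹IsManifold (𝓡 (2 * n)) ∞ M›
  inferInstance

theorem linearIndependent_coordFrame {x₀ x : M} (hx : x ∈ (chartAt 𝔼 x₀).source) :
    LinearIndependent ℝ (fun i => coordFrame n x₀ i x) :=
  ((trivializationAt 𝔼 (TangentSpace (𝓡 (2 * n)) : M → Type _)
    x₀).isLocalFrameOn_localFrame_baseSet (𝓡 (2 * n)) ∞ _).linearIndependent hx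

theorem contMDiffAt_coordFrame {x₀ x : M} (hx : x ∈ (chartAt 𝔼 x₀).source) (i : Fin (2 * n)) :
    ContMDiffAt (𝓡 (2 * n)) ((𝓡 (2 * n)).prod 𝓘(ℝ, 𝔼)) ∞
      (fun y => Bundle.TotalSpace.mk' 𝔼 y (coordFrame n x₀ i y)) x :=
  contMDiffAt_localFrame_of_mem ∞ _ _ i hx

variable [RiemannianBundle (fun x : M => TangentSpace (𝓡 (2 * n)) x)]

variable (n) in
/-- An orthonormal frame over a coordinate neighbourhood of `x₀`, obtained by the Gram-Schmidt
process. -/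
noncomputable def frame (x₀ x : M) : 𝔼 ≃ₗᵢ[ℝ] TangentSpace (𝓡 (2 * n)) x :=
  (InnerProductSpace.gramSchmidtOrthonormalBasis (𝕜 := ℝ) (E := TangentSpace (𝓡 (2 * n)) x)
    (by rw [Fintype.card_fin]; exact (fact_finrank_tangentSpace x).out)
    (fun i => coordFrame n x₀ i x)).repr.symm

/-- The frame is an isometry at every point of `M`, but it is the normalized Gram-Schmidt family
only where the coordinate fields are independent, that is, on the chart domain. -/
theorem frame_apply_basis {x₀ x : M} (hx : x ∈ (chartAt 𝔼 x₀).source) (i : Fin (2 * n)) :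
    frame n x₀ x (EuclideanSpace.basisFun (Fin (2 * n)) ℝ i) =
      InnerProductSpace.gramSchmidtNormed ℝ (fun i => coordFrame n x₀ i x) i := by
  have h := InnerProductSpace.gramSchmidtNormed_linearIndependent
    (linearIndependent_coordFrame (n := n) (x₀ := x₀) (x := x) hx)
  rw [← InnerProductSpace.gramSchmidtOrthonormalBasis_apply (𝕜 := ℝ)
    (by rw [Fintype.card_fin]; exact (fact_finrank_tangentSpace x).out) (h.ne_zero i)]
  simp [frame]

variable [IsContMDiffRiemannianBundle (𝓡 (2 * n)) ∞ (EuclideanSpace ℝ (Fin (2 * n)))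
      (fun x : M => TangentSpace (𝓡 (2 * n)) x)]

/-- Induction along the Gram-Schmidt recursion. Its coefficients are quotients of inner products,
which are smooth because the metric is, and the denominators do not vanish by linear independence.
-/
theorem contMDiffAt_gramSchmidt {x₀ x : M} (hx : x ∈ (chartAt 𝔼 x₀).source) (i : Fin (2 * n)) :
    ContMDiffAt (𝓡 (2 * n)) ((𝓡 (2 * n)).prod 𝓘(ℝ, 𝔼)) ∞
      (fun y => Bundle.TotalSpace.mk' 𝔼 y
        (InnerProductSpace.gramSchmidt ℝ (fun i => coordFrame n x₀ i y) i)) x := by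
  induction i using WellFoundedLT.induction with
  | ind i ih =>
  have hdef : ∀ y, InnerProductSpace.gramSchmidt ℝ (fun i => coordFrame n x₀ i y) i =
      coordFrame n x₀ i y - ∑ j ∈ Finset.Iio i,
        ((inner ℝ (InnerProductSpace.gramSchmidt ℝ (fun i => coordFrame n x₀ i y) j)
          (coordFrame n x₀ i y)) /
        (inner ℝ (InnerProductSpace.gramSchmidt ℝ (fun i => coordFrame n x₀ i y) j)
          (InnerProductSpace.gramSchmidt ℝ (fun i => coordFrame n x₀ i y) j))) •
        InnerProductSpace.gramSchmidt ℝ (fun i => coordFrame n x₀ i y) j := by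
    intro y
    have := InnerProductSpace.gramSchmidt_def'' ℝ (fun i => coordFrame n x₀ i y) i
    simp only [real_inner_self_eq_norm_sq]
    exact eq_sub_of_add_eq this.symm
  simp_rw [hdef]
  refine ContMDiffAt.sub_section (contMDiffAt_coordFrame hx i)
    (ContMDiffAt.sum_section fun j hj => ?_)
  have hj' := ih j (Finset.mem_Iio.1 hj)
  refine ContMDiffAt.smul_section ?_ hj'
  refine ContMDiffAt.div₀ (ContMDiffAt.inner_bundle hj' (contMDiffAt_coordFrame hx i))
    (ContMDiffAt.inner_bundle hj' hj') ?_
  rw [real_inner_self_eq_norm_sq]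
  exact pow_ne_zero 2 (norm_ne_zero_iff.2
    (InnerProductSpace.gramSchmidt_ne_zero j (linearIndependent_coordFrame hx)))

/-- The norm is the square root of a smooth function that does not vanish on the chart domain, so
normalization keeps the Gram-Schmidt fields smooth. -/
theorem contMDiffAt_frame_basis {x₀ x : M} (hx : x ∈ (chartAt 𝔼 x₀).source) (i : Fin (2 * n)) :
    ContMDiffAt (𝓡 (2 * n)) ((𝓡 (2 * n)).prod 𝓘(ℝ, 𝔼)) ∞
      (fun y => Bundle.TotalSpace.mk' 𝔼 y
        (frame n x₀ y (EuclideanSpace.basisFun (Fin (2 * n)) ℝ i))) x := by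
  have hs := (contMDiffAt_gramSchmidt hx i).inner_bundle (contMDiffAt_gramSchmidt hx i)
  have h0 : InnerProductSpace.gramSchmidt ℝ (fun i => coordFrame n x₀ i x) i ≠ 0 :=
    InnerProductSpace.gramSchmidt_ne_zero i (linearIndependent_coordFrame hx)
  have hsq : ContMDiffAt (𝓡 (2 * n)) 𝓘(ℝ, ℝ) ∞
      (fun y => ‖InnerProductSpace.gramSchmidt ℝ (fun i => coordFrame n x₀ i y) i‖⁻¹) x := by
    have : (fun y => ‖InnerProductSpace.gramSchmidt ℝ (fun i => coordFrame n x₀ i y) i‖⁻¹) =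
        (fun t : ℝ => (Real.sqrt t)⁻¹) ∘ fun y =>
          inner ℝ (InnerProductSpace.gramSchmidt ℝ (fun i => coordFrame n x₀ i y) i)
            (InnerProductSpace.gramSchmidt ℝ (fun i => coordFrame n x₀ i y) i) := by
      funext y
      simp
    rw [this]
    refine ContMDiffAt.comp x (ContDiffAt.contMDiffAt ?_) hs
    have hne : inner ℝ (InnerProductSpace.gramSchmidt ℝ (fun i => coordFrame n x₀ i x) i)
            (InnerProductSpace.gramSchmidt ℝ (fun i => coordFrame n x₀ i x) i) ≠ 0 := by
      rw [real_inner_self_eq_norm_sq]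
      exact pow_ne_zero 2 (norm_ne_zero_iff.2 h0)
    refine (Real.contDiffAt_sqrt hne).inv ?_
    rw [real_inner_self_eq_norm_sq, Real.sqrt_sq (norm_nonneg _)]
    exact norm_ne_zero_iff.2 h0
  refine (hsq.smul_section (contMDiffAt_gramSchmidt hx i)).congr_of_eventuallyEq ?_
  filter_upwards [(chartAt 𝔼 x₀).open_source.mem_nhds hx] with y hy
  rw [frame_apply_basis hy]
  rfl

end Frame

/-! ### Regularity of functions with values in alternating forms. -/

section FormAnalysis

variable {V : Type*} [NormedAddCommGroup V] [NormedSpace ℝ V] [FiniteDimensional ℝ V]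

/-- The values of an alternating form on the tuples of basis vectors. -/
noncomputable def formCoord (V : Type*) [NormedAddCommGroup V] [NormedSpace ℝ V]
    [FiniteDimensional ℝ V] (k : ℕ) :
    (V [⋀^Fin k]→L[ℝ] ℂ) →ₗ[ℂ] ((Fin k → Fin (Module.finrank ℝ V)) → ℂ) where
  toFun β i := β fun a => Module.finBasis ℝ V (i a)
  map_add' _ _ := rfl
  map_smul' _ _ := rfl

theorem formCoord_injective (k : ℕ) : Function.Injective (formCoord V k) := by
  intro β γ h
  apply ContinuousAlternatingMap.toAlternatingMap_injective
  exact Module.Basis.ext_alternating (Module.finBasis ℝ V) fun i _ => congrFun h i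

instance finiteDimensional_form (k : ℕ) : FiniteDimensional ℂ (V [⋀^Fin k]→L[ℝ] ℂ) :=
  Module.Finite.of_injective (formCoord V k) (formCoord_injective k)

instance finiteDimensional_real_form (k : ℕ) : FiniteDimensional ℝ (V [⋀^Fin k]→L[ℝ] ℂ) :=
  Module.Finite.of_injective ((formCoord V k).restrictScalars ℝ) (formCoord_injective k)

theorem exists_formCoord_leftInverse (V : Type*) [NormedAddCommGroup V] [NormedSpace ℝ V]
    [FiniteDimensional ℝ V] (k : ℕ) :
    ∃ G : ((Fin k → Fin (Module.finrank ℝ V)) → ℂ) →L[ℝ] (V [⋀^Fin k]→L[ℝ] ℂ),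
      ∀ β, G (formCoord V k β) = β := by
  obtain ⟨g, hg⟩ := ((formCoord V k).restrictScalars ℝ).exists_leftInverse_of_injective
    (LinearMap.ker_eq_bot.2 (formCoord_injective k))
  exact ⟨LinearMap.toContinuousLinearMap g, fun β => LinearMap.congr_fun hg β⟩

variable {F : Type*} [NormedAddCommGroup F] [NormedSpace ℝ F] {k : ℕ} {r : ℕ∞ω}

/-- In finite dimension a form is a linear function of its finitely many values on basis tuples. -/
theorem contDiffAt_form_iff {f : F → V [⋀^Fin k]→L[ℝ] ℂ} {x : F} :
    ContDiffAt ℝ r f x ↔ ∀ v, ContDiffAt ℝ r (fun y => f y v) x := by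
  constructor
  · intro h v
    exact (ContinuousAlternatingMap.apply ℝ V ℂ v).contDiff.contDiffAt.comp x h
  · intro h
    obtain ⟨G, hG⟩ := exists_formCoord_leftInverse V k
    have : f = fun y => G (formCoord V k (f y)) := funext fun y => (hG _).symm
    rw [this]
    exact G.contDiff.contDiffAt.comp x (contDiffAt_pi.2 fun i => h _)

/-- Expanding in a basis, each value of the pulled back form is a polynomial in the entries of the
map, with values of the form as coefficients. -/
theorem ContDiffAt.form_compContinuousLinearMap {E : Type*} [NormedAddCommGroup E]
    [NormedSpace ℝ E] [FiniteDimensional ℝ E] {f : F → V [⋀^Fin k]→L[ℝ] ℂ} {A : F → E →L[ℝ] V}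
    {x : F} (hf : ContDiffAt ℝ r f x) (hA : ContDiffAt ℝ r A x) :
    ContDiffAt ℝ r (fun y => (f y).compContinuousLinearMap (A y)) x := by
  rw [contDiffAt_form_iff] at hf ⊢
  intro v
  let b := Module.finBasis ℝ V
  have hexp : ∀ y, (f y).compContinuousLinearMap (A y) v =
      ∑ i : Fin k → Fin (Module.finrank ℝ V), (∏ a, b.coord (i a) (A y (v a))) •
        f y (fun a => b (i a)) := by
    intro y
    have h1 : (⇑(A y) ∘ v) = fun a => ∑ j, b.coord j (A y (v a)) • b j := by
      funext a
      exact (b.sum_repr _).symm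
    rw [ContinuousAlternatingMap.compContinuousLinearMap_apply, h1]
    refine ((f y).toMultilinearMap.map_sum _).trans ?_
    exact Finset.sum_congr rfl fun i _ => (f y).toMultilinearMap.map_smul_univ _ _
  simp_rw [hexp]
  refine ContDiffAt.sum fun i _ => ?_
  have hp : ContDiffAt ℝ r (fun y => ∏ a, b.coord (i a) (A y (v a))) x := by
    refine contDiffAt_prod fun a _ => ?_
    exact (LinearMap.toContinuousLinearMap (b.coord (i a))).contDiff.contDiffAt.comp x
      (hA.clm_apply contDiffAt_const)
  exact hp.smul (hf fun a => b (i a))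

theorem Filter.Tendsto.form_compContinuousLinearMap {E : Type*} [NormedAddCommGroup E]
    [NormedSpace ℝ E] {Z : Type*} {l : Filter Z} {f : Z → V [⋀^Fin k]→L[ℝ] ℂ} {A : Z → E →L[ℝ] V}
    {f₀ : V [⋀^Fin k]→L[ℝ] ℂ} {A₀ : E →L[ℝ] V} (hf : Tendsto f l (𝓝 f₀))
    (hA : Tendsto A l (𝓝 A₀)) :
    Tendsto (fun y => (f y).compContinuousLinearMap (A y)) l
      (𝓝 (f₀.compContinuousLinearMap A₀)) := by
  have h := (ContinuousAlternatingMap.continuous_compContinuousLinearMapCLM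
    (𝕜 := ℝ) (ι := Fin k) (E := E) (F := V) (G := ℂ)).continuousAt.tendsto.comp hA
  exact (isBoundedBilinearMap_apply.continuous.tendsto _).comp (h.prodMk_nhds hf)

/-- The product runs over all degrees, but forms of degree above `2n` vanish. -/
theorem finiteDimensional_extAlg {n : ℕ} [Fact (Module.finrank ℝ V = 2 * n)] :
    FiniteDimensional ℂ (ExtAlg V) := by
  let g : ExtAlg V →ₗ[ℂ] (∀ k : Fin (2 * n + 1), V [⋀^Fin (k : ℕ)]→L[ℝ] ℂ) :=
    LinearMap.pi fun k => LinearMap.proj (k : ℕ)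
  refine Module.Finite.of_injective g fun η θ h => funext fun k => ?_
  by_cases hk : k < 2 * n + 1
  · exact congrFun h ⟨k, hk⟩
  · have hz : ∀ β : V [⋀^Fin k]→L[ℝ] ℂ, β = 0 := by
      intro β
      ext w
      refine β.toAlternatingMap.map_linearDependent w fun hw => ?_
      have := hw.fintype_card_le_finrank
      rw [Fintype.card_fin, (Fact.out : Module.finrank ℝ V = 2 * n)] at this
      omega
    rw [hz (η k), hz (θ k)]

end FormAnalysis

/-! ### Forms in coordinates and independence of the chart. -/

section Charts

variable {n : ℕ} {M : Type u} [TopologicalSpace M]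
  [ChartedSpace (EuclideanSpace ℝ (Fin (2 * n))) M] [IsManifold (𝓡 (2 * n)) ∞ M]

local notation "𝔼" => EuclideanSpace ℝ (Fin (2 * n))

variable (n) in
/-- The linear isomorphism of the tangent space at `x` with the model space given by the preferred
chart at `x₀`. -/
noncomputable def toCoord (x₀ x : M) : TangentSpace (𝓡 (2 * n)) x →L[ℝ] 𝔼 :=
  (trivializationAt 𝔼 (TangentSpace (𝓡 (2 * n)) : M → Type _) x₀).continuousLinearMapAt ℝ x

variable (n) in
/-- The inverse of `toCoord`. -/
noncomputable def ofCoord (x₀ x : M) : 𝔼 →L[ℝ] TangentSpace (𝓡 (2 * n)) x :=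
  (trivializationAt 𝔼 (TangentSpace (𝓡 (2 * n)) : M → Type _) x₀).symmL ℝ x

theorem toCoord_ofCoord {x₀ x : M} (hx : x ∈ (chartAt 𝔼 x₀).source) (v : 𝔼) :
    toCoord n x₀ x (ofCoord n x₀ x v) = v :=
  (trivializationAt 𝔼 (TangentSpace (𝓡 (2 * n)) : M → Type _)
    x₀).continuousLinearMapAt_symmL hx v

theorem ofCoord_toCoord {x₀ x : M} (hx : x ∈ (chartAt 𝔼 x₀).source)
    (v : TangentSpace (𝓡 (2 * n)) x) : ofCoord n x₀ x (toCoord n x₀ x v) = v :=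
  (trivializationAt 𝔼 (TangentSpace (𝓡 (2 * n)) : M → Type _)
    x₀).symmL_continuousLinearMapAt hx v

/-- This lemma and the next link the definitions of `formInChart` and `dForm`, made with derivatives
of charts, to the trivializations of the tangent bundle. -/
theorem toCoord_eq_mfderiv {x₀ x : M} (hx : x ∈ (chartAt 𝔼 x₀).source) :
    toCoord n x₀ x = mfderiv (𝓡 (2 * n)) 𝓘(ℝ, 𝔼) (extChartAt (𝓡 (2 * n)) x₀) x :=
  have : IsManifold (𝓡 (2 * n)) 1 M := IsManifold.of_le (n := ∞) (by simp)
  TangentBundle.continuousLinearMapAt_trivializationAt hx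

theorem ofCoord_eq_mfderiv {x₀ : M} {y : 𝔼} (hy : y ∈ (extChartAt (𝓡 (2 * n)) x₀).target) :
    ofCoord n x₀ ((extChartAt (𝓡 (2 * n)) x₀).symm y) =
      mfderiv 𝓘(ℝ, 𝔼) (𝓡 (2 * n)) (extChartAt (𝓡 (2 * n)) x₀).symm y := by
  have : IsManifold (𝓡 (2 * n)) 1 M := IsManifold.of_le (n := ∞) (by simp)
  have hx : (extChartAt (𝓡 (2 * n)) x₀).symm y ∈ (chartAt 𝔼 x₀).source := by
    rw [← extChartAt_source (𝓡 (2 * n))]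
    exact (extChartAt (𝓡 (2 * n)) x₀).map_target hy
  have h := TangentBundle.symmL_trivializationAt (I := 𝓡 (2 * n)) hx
  rw [(extChartAt (𝓡 (2 * n)) x₀).right_inv hy, ModelWithCorners.range_eq_univ,
    mfderivWithin_univ] at h
  exact h

/-- The expression of a form in the coordinates given by the preferred chart at `x₀`. -/
noncomputable def coordForm (x₀ : M) (η : FormField n M) (k : ℕ) (x : M) : 𝔼 [⋀^Fin k]→L[ℝ] ℂ :=
  (η x k).compContinuousLinearMap (ofCoord n x₀ x)

theorem formInChart_eq {x₀ : M} {y : 𝔼} (hy : y ∈ (extChartAt (𝓡 (2 * n)) x₀).target)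
    (η : FormField n M) (k : ℕ) :
    formInChart x₀ η k y = coordForm x₀ η k ((extChartAt (𝓡 (2 * n)) x₀).symm y) := by
  rw [formInChart, coordForm, ofCoord_eq_mfderiv hy]

theorem isSmoothForm_iff_contMDiffOn {η : FormField n M} :
    IsSmoothForm η ↔ ∀ x₀ k, ContMDiffOn (𝓡 (2 * n)) 𝓘(ℝ, 𝔼 [⋀^Fin k]→L[ℝ] ℂ) ∞
      (coordForm x₀ η k) (chartAt 𝔼 x₀).source := by
  refine forall_congr' fun x₀ => forall_congr' fun k => ?_
  rw [← contMDiffOn_iff_contDiffOn]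
  constructor
  · intro h
    refine (h.comp (contMDiffOn_extChartAt (I := 𝓡 (2 * n)) (x := x₀)) ?_).congr ?_
    · intro x hx
      rw [← extChartAt_source (𝓡 (2 * n))] at hx
      exact (extChartAt (𝓡 (2 * n)) x₀).map_source hx
    · intro x hx
      rw [← extChartAt_source (𝓡 (2 * n))] at hx
      rw [Function.comp_apply, formInChart_eq ((extChartAt (𝓡 (2 * n)) x₀).map_source hx),
        (extChartAt (𝓡 (2 * n)) x₀).left_inv hx]
  · intro h
    refine (h.comp (contMDiffOn_extChartAt_symm (I := 𝓡 (2 * n)) x₀) ?_).congr ?_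
    · intro y hy
      rw [Set.mem_preimage, ← extChartAt_source (𝓡 (2 * n))]
      exact (extChartAt (𝓡 (2 * n)) x₀).map_target hy
    · intro y hy
      exact formInChart_eq hy η k

theorem ContMDiffAt.form_compContinuousLinearMap {k : ℕ} {f : M → 𝔼 [⋀^Fin k]→L[ℝ] ℂ}
    {A : M → 𝔼 →L[ℝ] 𝔼} {x : M}
    (hf : ContMDiffAt (𝓡 (2 * n)) 𝓘(ℝ, 𝔼 [⋀^Fin k]→L[ℝ] ℂ) ∞ f x)
    (hA : ContMDiffAt (𝓡 (2 * n)) 𝓘(ℝ, 𝔼 →L[ℝ] 𝔼) ∞ A x) :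
    ContMDiffAt (𝓡 (2 * n)) 𝓘(ℝ, 𝔼 [⋀^Fin k]→L[ℝ] ℂ) ∞
      (fun y => (f y).compContinuousLinearMap (A y)) x := by
  have h : ContDiffAt ℝ ∞ (fun p : (𝔼 [⋀^Fin k]→L[ℝ] ℂ) × (𝔼 →L[ℝ] 𝔼) =>
      p.1.compContinuousLinearMap p.2) (f x, A x) :=
    contDiffAt_fst.form_compContinuousLinearMap contDiffAt_snd
  exact h.contMDiffAt.comp x (hf.prodMk_space hA)

theorem toCoord_comp_ofCoord {x₀ x₁ x : M} (h₀ : x ∈ (chartAt 𝔼 x₀).source)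
    (h₁ : x ∈ (chartAt 𝔼 x₁).source) :
    (toCoord n x₁ x).comp (ofCoord n x₀ x) =
      fderiv ℝ (extChartAt (𝓡 (2 * n)) x₁ ∘ (extChartAt (𝓡 (2 * n)) x₀).symm)
        (extChartAt (𝓡 (2 * n)) x₀ x) := by
  have h₀' : x ∈ (extChartAt (𝓡 (2 * n)) x₀).source := by rwa [extChartAt_source]
  have hy := (extChartAt (𝓡 (2 * n)) x₀).map_source h₀'
  have hinv := (extChartAt (𝓡 (2 * n)) x₀).left_inv h₀'
  -- The point is rewritten as the image of its coordinates, so that the formula for the derivative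
  -- of the inverse chart applies.
  generalize extChartAt (𝓡 (2 * n)) x₀ x = y at hy hinv ⊢
  subst hinv
  have : IsManifold (𝓡 (2 * n)) 1 M := IsManifold.of_le (n := ∞) (by simp)
  rw [toCoord_eq_mfderiv h₁, ofCoord_eq_mfderiv hy, ← mfderiv_eq_fderiv]
  refine (mfderiv_comp y (mdifferentiableAt_extChartAt h₁) ?_).symm
  have := mdifferentiableWithinAt_extChartAt_symm (I := 𝓡 (2 * n)) hy
  rwa [ModelWithCorners.range_eq_univ, mdifferentiableWithinAt_univ] at this

theorem contMDiffAt_toCoord_comp_ofCoord {x₀ x₁ x : M} (h₀ : x ∈ (chartAt 𝔼 x₀).source)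
    (h₁ : x ∈ (chartAt 𝔼 x₁).source) :
    ContMDiffAt (𝓡 (2 * n)) 𝓘(ℝ, 𝔼 →L[ℝ] 𝔼) ∞
      (fun x => (toCoord n x₁ x).comp (ofCoord n x₀ x)) x := by
  have h := contMDiffAt_coordChangeL (n := ∞) (IB := 𝓡 (2 * n))
    (e := trivializationAt 𝔼 (TangentSpace (𝓡 (2 * n)) : M → Type _) x₀)
    (e' := trivializationAt 𝔼 (TangentSpace (𝓡 (2 * n)) : M → Type _) x₁) h₀ h₁
  refine h.congr_of_eventuallyEq ?_
  filter_upwards [(chartAt 𝔼 x₀).open_source.mem_nhds h₀, (chartAt 𝔼 x₁).open_source.mem_nhds h₁]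
    with z hz₀ hz₁
  ext1 v
  have hz : z ∈ (trivializationAt 𝔼 (TangentSpace (𝓡 (2 * n)) : M → Type _) x₀).baseSet ∩
    (trivializationAt 𝔼 (TangentSpace (𝓡 (2 * n)) : M → Type _) x₁).baseSet := ⟨hz₀, hz₁⟩
  rw [ContinuousLinearEquiv.coe_coe, Bundle.Trivialization.coordChangeL_apply _ _ hz]
  change (Bundle.Trivialization.linearMapAt ℝ _ z) _ = _
  rw [Bundle.Trivialization.coe_linearMapAt_of_mem _ hz₁]
  exact congrArg (fun w => ((trivializationAt 𝔼 (TangentSpace (𝓡 (2 * n)) : M → Type _) x₁)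
    ⟨z, w⟩).2) (Bundle.Trivialization.symmL_apply _ hz₀ v)

theorem coordForm_eq_comp {x₀ x₁ x : M} (h₁ : x ∈ (chartAt 𝔼 x₁).source) (η : FormField n M)
    (k : ℕ) :
    coordForm x₀ η k x = (coordForm x₁ η k x).compContinuousLinearMap
      ((toCoord n x₁ x).comp (ofCoord n x₀ x)) := by
  ext v
  simp only [coordForm, ContinuousAlternatingMap.compContinuousLinearMap_apply]
  congr 1
  funext i
  exact (ofCoord_toCoord h₁ _).symm

theorem ContMDiffAt.coordForm_of_coordForm {x₀ x₁ x : M} (h₀ : x ∈ (chartAt 𝔼 x₀).source)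
    (h₁ : x ∈ (chartAt 𝔼 x₁).source) {η : FormField n M} {k : ℕ}
    (h : ContMDiffAt (𝓡 (2 * n)) 𝓘(ℝ, 𝔼 [⋀^Fin k]→L[ℝ] ℂ) ∞ (coordForm x₁ η k) x) :
    ContMDiffAt (𝓡 (2 * n)) 𝓘(ℝ, 𝔼 [⋀^Fin k]→L[ℝ] ℂ) ∞ (coordForm x₀ η k) x := by
  refine (h.form_compContinuousLinearMap
    (contMDiffAt_toCoord_comp_ofCoord h₀ h₁)).congr_of_eventuallyEq ?_
  filter_upwards [(chartAt 𝔼 x₁).open_source.mem_nhds h₁] with z hz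
  exact coordForm_eq_comp hz η k

/-- The coordinate expressions in two charts differ by pullback along a smooth matrix, so smoothness
need only be tested at the center of each preferred chart. -/
theorem isSmoothForm_iff {η : FormField n M} :
    IsSmoothForm η ↔ ∀ x k, ContMDiffAt (𝓡 (2 * n)) 𝓘(ℝ, 𝔼 [⋀^Fin k]→L[ℝ] ℂ) ∞
      (coordForm x η k) x := by
  rw [isSmoothForm_iff_contMDiffOn]
  constructor
  · intro h x k
    exact (h x k).contMDiffAt ((chartAt 𝔼 x).open_source.mem_nhds (mem_chart_source 𝔼 x))
  · intro h x₀ k x hx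
    exact (ContMDiffAt.coordForm_of_coordForm hx (mem_chart_source 𝔼 x) (h x k)).contMDiffWithinAt

end Charts

theorem Orientation.map_trans {ι V₁ V₂ V₃ : Type*} [AddCommGroup V₁] [Module ℝ V₁] [AddCommGroup V₂]
    [Module ℝ V₂] [AddCommGroup V₃] [Module ℝ V₃] (e : V₁ ≃ₗ[ℝ] V₂) (f : V₂ ≃ₗ[ℝ] V₃)
    (o : Orientation ℝ V₁ ι) :
    Orientation.map ι (e.trans f) o = Orientation.map ι f (Orientation.map ι e o) := by
  induction o using Module.Ray.ind with
  | h v hv => rfl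

/-! ### The orthonormal frame in coordinates, and its orientation. -/

section FrameMatrix

variable {n : ℕ} {M : Type u} [TopologicalSpace M]
  [ChartedSpace (EuclideanSpace ℝ (Fin (2 * n))) M] [IsManifold (𝓡 (2 * n)) ∞ M]
  [RiemannianBundle (fun x : M => TangentSpace (𝓡 (2 * n)) x)]

local notation "𝔼" => EuclideanSpace ℝ (Fin (2 * n))

variable (n) in
/-- The orthonormal frame, as a continuous linear map. -/
noncomputable def frameL (x₀ x : M) : 𝔼 →L[ℝ] TangentSpace (𝓡 (2 * n)) x :=
  ((frame n x₀ x).toContinuousLinearEquiv : 𝔼 →L[ℝ] TangentSpace (𝓡 (2 * n)) x)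

variable (n) in
/-- The inverse of the orthonormal frame, as a continuous linear map. -/
noncomputable def frameInvL (x₀ x : M) : TangentSpace (𝓡 (2 * n)) x →L[ℝ] 𝔼 :=
  ((frame n x₀ x).symm.toContinuousLinearEquiv : TangentSpace (𝓡 (2 * n)) x →L[ℝ] 𝔼)

theorem frameInvL_frameL (x₀ x : M) (v : 𝔼) : frameInvL n x₀ x (frameL n x₀ x v) = v :=
  (frame n x₀ x).symm_apply_apply v

theorem frameL_frameInvL (x₀ x : M) (v : TangentSpace (𝓡 (2 * n)) x) :
    frameL n x₀ x (frameInvL n x₀ x v) = v :=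
  (frame n x₀ x).apply_symm_apply v

variable (n) in
/-- The matrix of the orthonormal frame in coordinates. -/
noncomputable def frameMatrix (x₀ x : M) : 𝔼 →L[ℝ] 𝔼 := (toCoord n x₀ x).comp (frameL n x₀ x)

variable (n) in
/-- The inverse of the matrix of the orthonormal frame in coordinates. -/
noncomputable def frameMatrixInv (x₀ x : M) : 𝔼 →L[ℝ] 𝔼 :=
  (frameInvL n x₀ x).comp (ofCoord n x₀ x)

theorem frameMatrixInv_frameMatrix {x₀ x : M} (hx : x ∈ (chartAt 𝔼 x₀).source) (v : 𝔼) :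
    frameMatrixInv n x₀ x (frameMatrix n x₀ x v) = v := by
  change frameInvL n x₀ x (ofCoord n x₀ x (toCoord n x₀ x (frameL n x₀ x v))) = v
  rw [ofCoord_toCoord hx, frameInvL_frameL]

theorem frameMatrix_frameMatrixInv {x₀ x : M} (hx : x ∈ (chartAt 𝔼 x₀).source) (v : 𝔼) :
    frameMatrix n x₀ x (frameMatrixInv n x₀ x v) = v := by
  change toCoord n x₀ x (frameL n x₀ x (frameInvL n x₀ x (ofCoord n x₀ x v))) = v
  rw [frameL_frameInvL, toCoord_ofCoord hx]

theorem frameMatrixInv_eq_inverse {x₀ x : M} (hx : x ∈ (chartAt 𝔼 x₀).source) :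
    frameMatrixInv n x₀ x = (frameMatrix n x₀ x).inverse := by
  have h := ContinuousLinearMap.inverse_equiv (ContinuousLinearEquiv.equivOfInverse
    (frameMatrix n x₀ x) (frameMatrixInv n x₀ x) (frameMatrixInv_frameMatrix hx)
    (frameMatrix_frameMatrixInv hx))
  exact h.symm

/-- The expression of a form in the orthonormal frame. -/
noncomputable def frameForm (x₀ x : M) (η : ExtFiber n x) : ExtAlg 𝔼 :=
  gradedComp (frameL n x₀ x) η

theorem frameForm_injective (x₀ x : M) :
    Function.Injective (frameForm x₀ x : ExtFiber n x → ExtAlg 𝔼) := by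
  intro η θ h
  funext k
  ext v
  have := congrArg (fun β => β fun i => frameInvL n x₀ x (v i)) (congrFun h k)
  change η k (fun i => frameL n x₀ x (frameInvL n x₀ x (v i))) =
    θ k (fun i => frameL n x₀ x (frameInvL n x₀ x (v i))) at this
  simpa only [frameL_frameInvL] using this

theorem frameForm_frameInvL (x₀ x : M) (η : ExtAlg 𝔼) :
    frameForm x₀ x (gradedComp (frameInvL n x₀ x) η : ExtFiber n x) = η := by
  funext k
  ext v
  change η k (fun i => frameInvL n x₀ x (frameL n x₀ x (v i))) = _
  simp only [frameInvL_frameL]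

theorem frameForm_eq {x₀ x : M} (hx : x ∈ (chartAt 𝔼 x₀).source) (η : FormField n M) (k : ℕ) :
    frameForm x₀ x (η x) k =
      (coordForm x₀ η k x).compContinuousLinearMap (frameMatrix n x₀ x) := by
  ext v
  change η x k (fun i => frameL n x₀ x (v i)) =
    η x k (fun i => ofCoord n x₀ x (toCoord n x₀ x (frameL n x₀ x (v i))))
  simp only [ofCoord_toCoord hx]

theorem coordForm_eq_frameForm (x₀ x : M) (η : FormField n M) (k : ℕ) :
    coordForm x₀ η k x =
      (frameForm x₀ x (η x) k).compContinuousLinearMap (frameMatrixInv n x₀ x) := by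
  ext v
  change η x k (fun i => ofCoord n x₀ x (v i)) =
    η x k (fun i => frameL n x₀ x (frameInvL n x₀ x (ofCoord n x₀ x (v i))))
  simp only [frameL_frameInvL]

variable [IsContMDiffRiemannianBundle (𝓡 (2 * n)) ∞ (EuclideanSpace ℝ (Fin (2 * n)))
      (fun x : M => TangentSpace (𝓡 (2 * n)) x)]

theorem contMDiffAt_frameMatrix {x₀ x : M} (hx : x ∈ (chartAt 𝔼 x₀).source) :
    ContMDiffAt (𝓡 (2 * n)) 𝓘(ℝ, 𝔼 →L[ℝ] 𝔼) ∞ (frameMatrix n x₀) x := by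
  have h : ∀ i, ContMDiffAt (𝓡 (2 * n)) 𝓘(ℝ, 𝔼) ∞
      (fun y => frameMatrix n x₀ y (EuclideanSpace.basisFun (Fin (2 * n)) ℝ i)) x := by
    intro i
    have := ((trivializationAt 𝔼 (TangentSpace (𝓡 (2 * n)) : M → Type _)
      x₀).contMDiffAt_section_iff hx).1 (contMDiffAt_frame_basis (n := n) (x₀ := x₀) hx i)
    refine this.congr_of_eventuallyEq ?_
    filter_upwards [(chartAt 𝔼 x₀).open_source.mem_nhds hx] with y hy
    change (Bundle.Trivialization.linearMapAt ℝ _ y) _ = _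
    rw [Bundle.Trivialization.coe_linearMapAt_of_mem _ hy]
    rfl
  have hsum : frameMatrix n x₀ = fun y => ∑ i, (ContinuousLinearMap.smulRightL ℝ 𝔼 𝔼
      (EuclideanSpace.proj i : 𝔼 →L[ℝ] ℝ))
      (frameMatrix n x₀ y (EuclideanSpace.basisFun (Fin (2 * n)) ℝ i)) := by
    funext y
    ext1 v
    conv_lhs => rw [← (EuclideanSpace.basisFun (Fin (2 * n)) ℝ).sum_repr v]
    rw [map_sum, sum_apply]
    refine Finset.sum_congr rfl fun i _ => ?_
    rw [map_smul]
    simp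
  rw [hsum]
  refine ContMDiffAt.sum fun i _ => ?_
  exact ((ContinuousLinearMap.smulRightL ℝ 𝔼 𝔼
      (EuclideanSpace.proj i : 𝔼 →L[ℝ] ℝ)).contDiff.contMDiff.contMDiffAt).comp x (h i)

theorem contMDiffAt_frameMatrixInv {x₀ x : M} (hx : x ∈ (chartAt 𝔼 x₀).source) :
    ContMDiffAt (𝓡 (2 * n)) 𝓘(ℝ, 𝔼 →L[ℝ] 𝔼) ∞ (frameMatrixInv n x₀) x := by
  have h := (contDiffAt_map_inverse (𝕜 := ℝ) (n := ∞) (ContinuousLinearEquiv.equivOfInverse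
    (frameMatrix n x₀ x) (frameMatrixInv n x₀ x) (frameMatrixInv_frameMatrix hx)
    (frameMatrix_frameMatrixInv hx)))
  have h' : ContDiffAt ℝ ∞ ContinuousLinearMap.inverse (frameMatrix n x₀ x) := h
  refine (h'.contMDiffAt.comp x (contMDiffAt_frameMatrix hx)).congr_of_eventuallyEq ?_
  filter_upwards [(chartAt 𝔼 x₀).open_source.mem_nhds hx] with y hy
  exact frameMatrixInv_eq_inverse hy

/-- The orientation of `M` is constant in the local trivialization, and the frame has positive
determinant there relative to its value at `x₀`, by continuity. Hence near `x₀` the frame pulls the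
orientation back to a fixed one. -/
theorem exists_frame_orientation (o : ManifoldOrientation n M) (x₀ : M) :
    ∃ o₀ : Orientation ℝ 𝔼 (Fin (2 * n)), ∀ᶠ x in 𝓝 x₀,
      Orientation.map (Fin (2 * n)) (frame n x₀ x).toLinearEquiv o₀ = o.orient x := by
  obtain ⟨o₁, ho₁⟩ := o.locally_constant x₀
  refine ⟨Orientation.map (Fin (2 * n)) (frame n x₀ x₀).symm.toLinearEquiv (o.orient x₀), ?_⟩
  have hx₀ := mem_chart_source 𝔼 x₀
  have hdet : ContinuousAt (fun x => ((frameMatrix n x₀ x).comp (frameMatrixInv n x₀ x₀)).det)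
      x₀ := by
    refine ContinuousLinearMap.continuous_det.continuousAt.comp ?_
    exact (contMDiffAt_frameMatrix hx₀).continuousAt.clm_comp continuousAt_const
  have h1 : ((frameMatrix n x₀ x₀).comp (frameMatrixInv n x₀ x₀)).det = 1 := by
    have : (frameMatrix n x₀ x₀).comp (frameMatrixInv n x₀ x₀) = ContinuousLinearMap.id ℝ 𝔼 :=
      ContinuousLinearMap.ext (frameMatrix_frameMatrixInv hx₀)
    rw [this]
    exact LinearMap.det_id
  have hpos : ∀ᶠ x in 𝓝 x₀, 0 < ((frameMatrix n x₀ x).comp (frameMatrixInv n x₀ x₀)).det :=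
    hdet.eventually (lt_mem_nhds (one_pos.trans_eq h1.symm))
  obtain ⟨_, h₀⟩ := ho₁.self_of_nhds
  filter_upwards [hpos, ho₁] with x hx ⟨hxb, hxo⟩
  let e := fun (x : M) (hx : x ∈ (trivializationAt 𝔼
    (TangentSpace (𝓡 (2 * n)) : M → Type _) x₀).baseSet) => ((trivializationAt 𝔼
    (TangentSpace (𝓡 (2 * n)) : M → Type _) x₀).continuousLinearEquivAt ℝ x hx).toLinearEquiv
  have hmap : ∀ (x : M) hx, (e x hx : TangentSpace (𝓡 (2 * n)) x → 𝔼) = toCoord n x₀ x := by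
    intro x hx
    exact Bundle.Trivialization.coe_continuousLinearEquivAt_eq _ hx
  -- The change of frame from `x₀` to `x`, read in the trivialization. Its determinant is the
  -- positive number `hx`, so it fixes the constant orientation `o₁`.
  let f : 𝔼 ≃ₗ[ℝ] 𝔼 := (e x₀ hx₀).symm.trans ((frame n x₀ x₀).symm.toLinearEquiv.trans
    ((frame n x₀ x).toLinearEquiv.trans (e x hxb)))
  have hf : (f : 𝔼 →ₗ[ℝ] 𝔼) =
      ((frameMatrix n x₀ x).comp (frameMatrixInv n x₀ x₀) : 𝔼 →L[ℝ] 𝔼) := by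
    ext1 v
    change e x hxb (frame n x₀ x ((frame n x₀ x₀).symm ((e x₀ hx₀).symm v))) = _
    rw [hmap]
    change toCoord n x₀ x (frameL n x₀ x (frameInvL n x₀ x₀ ((e x₀ hx₀).symm v))) =
      toCoord n x₀ x (frameL n x₀ x (frameInvL n x₀ x₀ (ofCoord n x₀ x₀ v)))
    congr 3
    rw [LinearEquiv.symm_apply_eq]
    exact ((congrFun (hmap x₀ hx₀) _).trans (toCoord_ofCoord hx₀ v)).symm
  have hcard : Fintype.card (Fin (2 * n)) = Module.finrank ℝ 𝔼 := by simp
  have hfo := (Orientation.map_eq_iff_det_pos o₁ f hcard).2 (by rw [hf]; exact hx)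
  apply (Orientation.map (Fin (2 * n)) (e x hxb)).injective
  rw [hxo]
  refine Eq.trans ?_ hfo
  rw [← h₀, ← Orientation.map_trans, ← Orientation.map_trans, ← Orientation.map_trans]
  have hcomp : (frame n x₀ x₀).symm.toLinearEquiv.trans ((frame n x₀ x).toLinearEquiv.trans
      (e x hxb)) = (e x₀ hx₀).trans f := by
    ext1 v
    change _ = e x hxb (frame n x₀ x ((frame n x₀ x₀).symm ((e x₀ hx₀).symm (e x₀ hx₀ v))))
    rw [LinearEquiv.symm_apply_apply]
    rfl
  exact congrArg (fun g => Orientation.map (Fin (2 * n)) g (o.orient x₀)) hcomp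

end FrameMatrix

/-! ### Operations that preserve smooth forms. -/

section SmoothForms

variable {n : ℕ} {M : Type u} [TopologicalSpace M]
  [ChartedSpace (EuclideanSpace ℝ (Fin (2 * n))) M] [IsManifold (𝓡 (2 * n)) ∞ M]

local notation "𝔼" => EuclideanSpace ℝ (Fin (2 * n))

instance fact_finrank_euclideanSpace (m : ℕ) :
    Fact (Module.finrank ℝ (EuclideanSpace ℝ (Fin m)) = m) :=
  ⟨finrank_euclideanSpace_fin⟩

theorem IsSmoothForm.add {η θ : FormField n M} (hη : IsSmoothForm η) (hθ : IsSmoothForm θ) :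
    IsSmoothForm (η + θ) := by
  rw [isSmoothForm_iff] at *
  intro x k
  exact (hη x k).add (hθ x k)

theorem IsSmoothForm.const_smul {η : FormField n M} (hη : IsSmoothForm η) (c : ℕ → ℂ) :
    IsSmoothForm (fun x k => c k • η x k) := by
  rw [isSmoothForm_iff] at *
  intro x k
  have := ((c k • ContinuousLinearMap.id ℂ (𝔼 [⋀^Fin k]→L[ℝ] ℂ)).restrictScalars
    ℝ).contDiff.contMDiff.contMDiffAt.comp x (hη x k)
  exact this

theorem IsSmoothForm.neg {η : FormField n M} (hη : IsSmoothForm η) : IsSmoothForm (-η) := by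
  have := hη.const_smul fun _ => -1
  convert this using 3 with x k
  ext v
  simp

theorem IsSmoothForm.real_smul {η : FormField n M} (hη : IsSmoothForm η) {f : M → ℝ}
    (hf : ContMDiff (𝓡 (2 * n)) 𝓘(ℝ, ℝ) ∞ f) : IsSmoothForm (fun x => (f x : ℂ) • η x) := by
  rw [isSmoothForm_iff] at *
  intro x k
  refine ((hf x).smul (hη x k)).congr_of_eventuallyEq (Filter.Eventually.of_forall fun y => ?_)
  ext v
  simp [coordForm]

variable [RiemannianBundle (fun x : M => TangentSpace (𝓡 (2 * n)) x)]

theorem starAt_eq (o : ManifoldOrientation n M) (x : M) : starAt o x = gradedStar (o.orient x) :=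
  rfl

/-- The action of a covector of `M` on forms. -/
noncomputable def cliffordAt (o : ManifoldOrientation n M) (x : M)
    (ξ : TangentSpace (𝓡 (2 * n)) x →L[ℝ] ℝ) : ExtFiber n x →ₗ[ℂ] ExtFiber n x :=
  clifford (o.orient x) ξ

variable [IsContMDiffRiemannianBundle (𝓡 (2 * n)) ∞ (EuclideanSpace ℝ (Fin (2 * n)))
      (fun x : M => TangentSpace (𝓡 (2 * n)) x)]

/-- In an oriented orthonormal frame the star is the constant linear map `hodgeStar o₀`; passing to
the frame and back is done by smooth matrices. -/
theorem IsSmoothForm.star {η : FormField n M} (hη : IsSmoothForm η) (o : ManifoldOrientation n M) :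
    IsSmoothForm (fun x => starAt o x (η x)) := by
  rw [isSmoothForm_iff] at *
  intro x₀ l
  obtain ⟨o₀, ho₀⟩ := exists_frame_orientation o x₀
  have hx₀ := mem_chart_source 𝔼 x₀
  have hsrc := (chartAt 𝔼 x₀).open_source.mem_nhds hx₀
  rcases le_or_gt l (2 * n) with hl | hl
  · have hfr : ContMDiffAt (𝓡 (2 * n)) 𝓘(ℝ, 𝔼 [⋀^Fin (2 * n - l)]→L[ℝ] ℂ) ∞
        (fun x => frameForm x₀ x (η x) (2 * n - l)) x₀ := by
      refine ((hη x₀ (2 * n - l)).form_compContinuousLinearMap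
        (contMDiffAt_frameMatrix hx₀)).congr_of_eventuallyEq ?_
      filter_upwards [hsrc] with x hx
      exact frameForm_eq hx η _
    have hst := (LinearMap.toContinuousLinearMap
      ((hodgeStar o₀ (Nat.sub_add_cancel hl)).restrictScalars
        ℝ)).contDiff.contMDiff.contMDiffAt.comp x₀ hfr
    refine (hst.form_compContinuousLinearMap
      (contMDiffAt_frameMatrixInv hx₀)).congr_of_eventuallyEq ?_
    filter_upwards [ho₀] with x hx
    rw [coordForm_eq_frameForm]
    congr 1
    have := congrFun (gradedComp_gradedStar o₀ (o.orient x) (frame n x₀ x) hx (η x)) l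
    refine this.trans ?_
    rw [gradedStar_apply o₀ (Nat.sub_add_cancel hl)]
    rfl
  · have hz : coordForm x₀ (fun x => starAt o x (η x)) l = fun _ => 0 := by
      funext x
      exact ContinuousAlternatingMap.eq_zero_of_finrank_lt hl _
    rw [hz]
    exact contMDiffAt_const

theorem IsSmoothForm.tau {η : FormField n M} (hη : IsSmoothForm η) (o : ManifoldOrientation n M) :
    IsSmoothForm (fun x => tauAt o x (η x)) :=
  (hη.star o).const_smul fun l => Complex.I ^ (n + (2 * n - l) * (2 * n - l - 1))

end SmoothForms

/-! ### The exterior derivative in an arbitrary chart. -/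

section ExteriorDerivative

set_option synthInstance.maxHeartbeats 200000 in
theorem ContDiffAt.extDeriv {E F : Type*} [NormedAddCommGroup E] [NormedSpace ℝ E]
    [NormedAddCommGroup F] [NormedSpace ℝ F] {k : ℕ} {β : E → E [⋀^Fin k]→L[ℝ] F} {x : E}
    (h : ContDiffAt ℝ ∞ β x) : ContDiffAt ℝ ∞ (extDeriv β) x := by
  have h1 : ContDiffAt ℝ ∞ (fderiv ℝ β) x := h.fderiv_right (m := ∞) (by simp)
  have h2 : ContDiff ℝ ∞
      (ContinuousAlternatingMap.alternatizeUncurryFinCLM (n := k) ℝ E F) :=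
    ContinuousLinearMap.contDiff _
  exact h2.contDiffAt.comp x h1

variable {n : ℕ} {M : Type u} [TopologicalSpace M]
  [ChartedSpace (EuclideanSpace ℝ (Fin (2 * n))) M] [IsManifold (𝓡 (2 * n)) ∞ M]

local notation "𝔼" => EuclideanSpace ℝ (Fin (2 * n))

theorem formInChart_differentiableAt {η : FormField n M} (hη : IsSmoothForm η) {x₀ : M} {y : 𝔼}
    (hy : y ∈ (extChartAt (𝓡 (2 * n)) x₀).target) (k : ℕ) :
    DifferentiableAt ℝ (formInChart x₀ η k) y :=
  ((hη x₀ k).contDiffAt ((isOpen_extChartAt_target x₀).mem_nhds hy)).differentiableAt (by simp)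

/-- `dForm` is computed at each point in a chart of its own. Naturality of the exterior derivative
under the transition map gives one formula over the whole domain of the chart at `x₀`, from which
smoothness follows. -/
theorem coordForm_dForm {η : FormField n M} (hη : IsSmoothForm η) {x₀ x : M}
    (hx : x ∈ (chartAt 𝔼 x₀).source) (k : ℕ) :
    coordForm x₀ (dForm η) (k + 1) x =
      extDeriv (formInChart x₀ η k) (extChartAt (𝓡 (2 * n)) x₀ x) := by
  have hxx := mem_chart_source 𝔼 x
  let y := extChartAt (𝓡 (2 * n)) x₀ x
  have hx' : x ∈ (extChartAt (𝓡 (2 * n)) x₀).source := by rwa [extChartAt_source]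
  have hy : y ∈ (extChartAt (𝓡 (2 * n)) x₀).target := (extChartAt (𝓡 (2 * n)) x₀).map_source hx'
  let φ := extChartAt (𝓡 (2 * n)) x ∘ (extChartAt (𝓡 (2 * n)) x₀).symm
  have hφy : φ y = extChartAt (𝓡 (2 * n)) x x :=
    congrArg (extChartAt (𝓡 (2 * n)) x) ((extChartAt (𝓡 (2 * n)) x₀).left_inv hx')
  have hcont : ContinuousAt (extChartAt (𝓡 (2 * n)) x₀).symm y := continuousAt_extChartAt_symm'' hy
  have hsymm : (extChartAt (𝓡 (2 * n)) x₀).symm y = x := (extChartAt (𝓡 (2 * n)) x₀).left_inv hx'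
  -- Near `y` the expression in the chart at `x₀` is the pullback by `φ` of the one in the chart at
  -- `x`.
  have hev : formInChart x₀ η k =ᶠ[𝓝 y] fun z =>
      (formInChart x η k (φ z)).compContinuousLinearMap (fderiv ℝ φ z) := by
    have h1 : ∀ᶠ z in 𝓝 y, (extChartAt (𝓡 (2 * n)) x₀).symm z ∈ (chartAt 𝔼 x).source :=
      hcont.eventually ((chartAt 𝔼 x).open_source.mem_nhds (by rw [hsymm]; exact hxx))
    filter_upwards [h1, (isOpen_extChartAt_target x₀).mem_nhds hy] with z hz hzt
    have hz0 : (extChartAt (𝓡 (2 * n)) x₀).symm z ∈ (chartAt 𝔼 x₀).source := by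
      rw [← extChartAt_source (𝓡 (2 * n))]
      exact (extChartAt (𝓡 (2 * n)) x₀).map_target hzt
    have hzx : (extChartAt (𝓡 (2 * n)) x₀).symm z ∈ (extChartAt (𝓡 (2 * n)) x).source := by
      rwa [extChartAt_source]
    change _ = (formInChart x η k (extChartAt (𝓡 (2 * n)) x
      ((extChartAt (𝓡 (2 * n)) x₀).symm z))).compContinuousLinearMap _
    rw [formInChart_eq hzt, coordForm_eq_comp hz, toCoord_comp_ofCoord hz0 hz,
      (extChartAt (𝓡 (2 * n)) x₀).right_inv hzt,
      formInChart_eq ((extChartAt (𝓡 (2 * n)) x).map_source hzx),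
      (extChartAt (𝓡 (2 * n)) x).left_inv hzx]
  rw [hev.extDeriv_eq]
  have hφs : ContDiffAt ℝ ∞ φ y := by
    have h := contDiffWithinAt_ext_coord_change (I := 𝓡 (2 * n)) (n := ∞) x x₀ (y := y) (by
      rw [PartialEquiv.trans_source]
      refine ⟨hy, ?_⟩
      rw [Set.mem_preimage, extChartAt_source, hsymm]
      exact hxx)
    rwa [ModelWithCorners.range_eq_univ, contDiffWithinAt_univ] at h
  rw [extDeriv_pullback (r := ∞) ?_ hφs (by
    simpa using (WithTop.coe_le_coe.2 (le_top : (2 : ℕ∞) ≤ ⊤))), hφy,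
    ← toCoord_comp_ofCoord hx hxx]
  · ext v
    change (extDeriv (formInChart x η k) _) _ = _
    rw [← toCoord_eq_mfderiv hxx]
    rfl
  · rw [hφy]
    exact formInChart_differentiableAt hη ((extChartAt (𝓡 (2 * n)) x).map_source (by
      rwa [extChartAt_source])) k

theorem IsSmoothForm.dForm {η : FormField n M} (hη : IsSmoothForm η) : IsSmoothForm (dForm η) := by
  rw [isSmoothForm_iff]
  intro x k
  have hx := mem_chart_source 𝔼 x
  cases k with
  | zero =>
    have : coordForm x (_root_.dForm η) 0 = fun _ => 0 := rfl
    rw [this]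
    exact contMDiffAt_const
  | succ k =>
    have hy := (extChartAt (𝓡 (2 * n)) x).map_source (mem_extChartAt_source (I := 𝓡 (2 * n)) x)
    have h1 : ContDiffAt ℝ ∞ (extDeriv (formInChart x η k)) (extChartAt (𝓡 (2 * n)) x x) :=
      ContDiffAt.extDeriv ((hη x k).contDiffAt ((isOpen_extChartAt_target x).mem_nhds hy))
    refine (h1.contMDiffAt.comp x (contMDiffAt_extChartAt (I := 𝓡 (2 * n)))).congr_of_eventuallyEq ?_
    filter_upwards [(chartAt 𝔼 x).open_source.mem_nhds hx] with z hz
    exact coordForm_dForm hη hz k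

end ExteriorDerivative

/-! ### The leading symbol of `d + δ`. -/

section DeRham

variable {n : ℕ} {M : Type u} [TopologicalSpace M]
  [ChartedSpace (EuclideanSpace ℝ (Fin (2 * n))) M] [IsManifold (𝓡 (2 * n)) ∞ M]

local notation "𝔼" => EuclideanSpace ℝ (Fin (2 * n))

theorem formInChart_differentiableAt_self {η : FormField n M} (hη : IsSmoothForm η) (x : M)
    (k : ℕ) : DifferentiableAt ℝ (formInChart x η k) (extChartAt (𝓡 (2 * n)) x x) :=
  formInChart_differentiableAt hη
    ((extChartAt (𝓡 (2 * n)) x).map_source (mem_extChartAt_source x)) k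

theorem extDeriv_complex_smul {k : ℕ} {β : 𝔼 → 𝔼 [⋀^Fin k]→L[ℝ] ℂ} {y : 𝔼}
    (h : DifferentiableAt ℝ β y) (c : ℂ) :
    extDeriv (fun z => c • β z) y = c • extDeriv β y := by
  rw [extDeriv, fderiv_fun_const_smul h]
  exact ContinuousAlternatingMap.alternatizeUncurryFin_smul c _

/-- The scalars may depend on the degree, so this covers the powers of `i` in `τ`. The scalar in the
result is that of the lower degree. -/
theorem dForm_const_smul {η : FormField n M} (hη : IsSmoothForm η) (c : ℕ → ℂ) (x : M) (k : ℕ) :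
    dForm (fun x k => c k • η x k) x (k + 1) = c k • dForm η x (k + 1) := by
  have h := extDeriv_complex_smul (formInChart_differentiableAt_self hη x k) (c k)
  ext v
  exact congrArg (fun β => β fun i => mfderiv (𝓡 (2 * n)) 𝓘(ℝ, 𝔼) (extChartAt (𝓡 (2 * n)) x) x (v i)) h

theorem dForm_eq_zero {η : FormField n M} {k : ℕ} (hη : ∀ x, η x k = 0) (x : M) :
    dForm η x (k + 1) = 0 := by
  have h : formInChart x η k = fun _ => 0 := by
    funext y
    rw [formInChart, hη]
    rfl
  have h' : extDeriv (formInChart x η k) (extChartAt (𝓡 (2 * n)) x x) = 0 := by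
    rw [h]
    rw [extDeriv, fderiv_fun_const]
    ext v
    exact (ContinuousAlternatingMap.alternatizeUncurryFin_apply _ _).trans (by simp)
  change (extDeriv (formInChart x η k) (extChartAt (𝓡 (2 * n)) x x)).compContinuousLinearMap _ = 0
  rw [h']
  rfl

theorem mfderiv_eq_comp_toCoord {f : M → ℝ} (hf : ContMDiff (𝓡 (2 * n)) 𝓘(ℝ, ℝ) ∞ f) (x : M) :
    DifferentiableAt ℝ (f ∘ (extChartAt (𝓡 (2 * n)) x).symm) (extChartAt (𝓡 (2 * n)) x x) ∧
    mfderiv (𝓡 (2 * n)) 𝓘(ℝ, ℝ) f x = (fderiv ℝ (f ∘ (extChartAt (𝓡 (2 * n)) x).symm)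
      (extChartAt (𝓡 (2 * n)) x x)).comp (toCoord n x x) := by
  have hx := mem_extChartAt_source (I := 𝓡 (2 * n)) x
  have hy := (extChartAt (𝓡 (2 * n)) x).map_source hx
  have hd : DifferentiableAt ℝ (f ∘ (extChartAt (𝓡 (2 * n)) x).symm)
      (extChartAt (𝓡 (2 * n)) x x) := by
    have h := hf.comp_contMDiffOn (contMDiffOn_extChartAt_symm (I := 𝓡 (2 * n)) (n := ∞) x)
    rw [contMDiffOn_iff_contDiffOn] at h
    exact (h.contDiffAt ((isOpen_extChartAt_target x).mem_nhds hy)).differentiableAt (by simp)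
  refine ⟨hd, ?_⟩
  have he : f =ᶠ[𝓝 x] (f ∘ (extChartAt (𝓡 (2 * n)) x).symm) ∘ extChartAt (𝓡 (2 * n)) x := by
    filter_upwards [extChartAt_source_mem_nhds (I := 𝓡 (2 * n)) x] with z hz
    exact (congrArg f ((extChartAt (𝓡 (2 * n)) x).left_inv hz)).symm
  rw [he.mfderiv_eq, toCoord_eq_mfderiv (mem_chart_source 𝔼 x), ← mfderiv_eq_fderiv]
  exact mfderiv_comp x hd.mdifferentiableAt
    (mdifferentiableAt_extChartAt (mem_chart_source 𝔼 x))

theorem formInChart_toCoord (s : FormField n M) (x : M) (k : ℕ)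
    (v : Fin k → TangentSpace (𝓡 (2 * n)) x) :
    formInChart x s k (extChartAt (𝓡 (2 * n)) x x) (fun i => toCoord n x x (v i)) = s x k v := by
  have hx := mem_extChartAt_source (I := 𝓡 (2 * n)) x
  rw [formInChart_eq ((extChartAt (𝓡 (2 * n)) x).map_source hx),
    (extChartAt (𝓡 (2 * n)) x).left_inv hx]
  change s x k (fun i => ofCoord n x x (toCoord n x x (v i))) = _
  simp only [ofCoord_toCoord (mem_chart_source 𝔼 x)]

variable [RiemannianBundle (fun x : M => TangentSpace (𝓡 (2 * n)) x)]

/-- In the Leibniz rule the term with `f(x)` drops out and `df ∧ s` remains. -/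
theorem dForm_smul_of_eq_zero {s : FormField n M} (hs : IsSmoothForm s) {f : M → ℝ}
    (hf : ContMDiff (𝓡 (2 * n)) 𝓘(ℝ, ℝ) ∞ f) {x : M} (hx : f x = 0) :
    dForm (fun y => (f y : ℂ) • s y) x =
      gradedWedge (V := TangentSpace (𝓡 (2 * n)) x) (mfderiv (𝓡 (2 * n)) 𝓘(ℝ, ℝ) f x) (s x) := by
  funext k
  cases k with
  | zero => rfl
  | succ k =>
    let y₀ := extChartAt (𝓡 (2 * n)) x x
    let g : 𝔼 → ℝ := f ∘ (extChartAt (𝓡 (2 * n)) x).symm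
    have hxs := mem_chart_source 𝔼 x
    obtain ⟨hg, hfg⟩ := mfderiv_eq_comp_toCoord hf x
    have hg0 : g y₀ = 0 := by
      rw [← hx]
      exact congrArg f (extChartAt_to_inv x)
    have hβ := formInChart_differentiableAt_self hs x k
    have hext : extDeriv (formInChart x (fun y => (f y : ℂ) • s y) k) y₀ =
        wedge (fderiv ℝ g y₀) (formInChart x s k y₀) := by
      have h1 : formInChart x (fun y => (f y : ℂ) • s y) k = g • formInChart x s k := by
        funext y
        ext v
        exact (Complex.real_smul).symm
      rw [h1, extDeriv, fderiv_smul hg hβ]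
      change ContinuousAlternatingMap.alternatizeUncurryFin (g y₀ • _ + _) = _
      rw [hg0, zero_smul, zero_add]
      rfl
    have h2 : ∀ v : Fin (k + 1) → TangentSpace (𝓡 (2 * n)) x,
        dForm (fun y => (f y : ℂ) • s y) x (k + 1) v =
        wedge (fderiv ℝ g y₀) (formInChart x s k y₀) (fun i => toCoord n x x (v i)) := by
      intro v
      rw [← hext, toCoord_eq_mfderiv hxs]
      rfl
    ext v
    refine ((h2 v).trans (wedge_apply _ _ _)).trans
      (Eq.trans ?_ (wedge_apply (V := TangentSpace (𝓡 (2 * n)) x) _ (s x k) v).symm)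
    refine Finset.sum_congr rfl fun i _ => ?_
    have h3 : mfderiv (𝓡 (2 * n)) 𝓘(ℝ, ℝ) f x (v i) = fderiv ℝ g y₀ (toCoord n x x (v i)) :=
      congrArg (fun L : TangentSpace (𝓡 (2 * n)) x →L[ℝ] ℝ => L (v i)) hfg
    have h4 : formInChart x s k y₀ (i.removeNth fun i => toCoord n x x (v i)) =
      s x k (i.removeNth v) := formInChart_toCoord s x k (i.removeNth v)
    exact congrArg₂ (fun (a : ℝ) (b : ℂ) => (-1 : ℤ) ^ (i : ℕ) • a • b) h3.symm h4

variable (o : ManifoldOrientation n M)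

/-- The star commutes with multiplication by `f`, so the Leibniz rule handles `δ` as well as `d`. -/
theorem hodgeDirac_smul_of_eq_zero [IsContMDiffRiemannianBundle (𝓡 (2 * n)) ∞
      (EuclideanSpace ℝ (Fin (2 * n))) (fun x : M => TangentSpace (𝓡 (2 * n)) x)]
    {s : FormField n M} (hs : IsSmoothForm s) {f : M → ℝ}
    (hf : ContMDiff (𝓡 (2 * n)) 𝓘(ℝ, ℝ) ∞ f) {x : M} (hx : f x = 0) :
    hodgeDirac o (fun y => (f y : ℂ) • s y) x =
      cliffordAt o x (mfderiv (𝓡 (2 * n)) 𝓘(ℝ, ℝ) f x) (s x) := by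
  have h1 : (fun y => starAt o y ((f y : ℂ) • s y)) = fun y => (f y : ℂ) • starAt o y (s y) := by
    funext y
    exact map_smul _ _ _
  change dForm _ x + -starAt o x (dForm (fun y => starAt o y ((f y : ℂ) • s y)) x) = _
  rw [h1, dForm_smul_of_eq_zero hs hf hx, dForm_smul_of_eq_zero (hs.star o) hf hx]
  exact (sub_eq_add_neg _ _).symm

end DeRham

/-! ### `D` changes the parity and anticommutes with `τ`. -/

section HodgeDirac

variable {n : ℕ} {M : Type u} [TopologicalSpace M]
  [ChartedSpace (EuclideanSpace ℝ (Fin (2 * n))) M] [IsManifold (𝓡 (2 * n)) ∞ M]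
  [RiemannianBundle (fun x : M => TangentSpace (𝓡 (2 * n)) x)]

local notation "𝔼" => EuclideanSpace ℝ (Fin (2 * n))

theorem starAt_apply_eq_zero (o : ManifoldOrientation n M) {x : M} {η : ExtFiber n x} {l : ℕ}
    (h : ∀ k, k + l = 2 * n → η k = 0) : starAt o x η l = 0 := by
  rcases le_or_gt l (2 * n) with hl | hl
  · have h1 := gradedStar_apply (V := TangentSpace (𝓡 (2 * n)) x) (o.orient x)
      (Nat.sub_add_cancel hl) η
    rw [h _ (Nat.sub_add_cancel hl)] at h1
    exact h1.trans (map_zero _)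
  · exact ContinuousAlternatingMap.eq_zero_of_finrank_lt (V := TangentSpace (𝓡 (2 * n)) x) hl _

/-- `d` shifts the degree by one, and the star preserves parity because `2n` is even. So a component
of `D η` depends only on components of the opposite parity. -/
theorem hodgeDirac_apply_eq_zero (o : ManifoldOrientation n M) {η : FormField n M} {l : ℕ}
    (h : ∀ k, Odd (k + l) → ∀ x, η x k = 0) (x : M) : hodgeDirac o η x l = 0 := by
  have h1 : dForm η x l = 0 := by
    cases l with
    | zero => rfl
    | succ l => exact dForm_eq_zero (h l ⟨l, by ring⟩) x
  have h2 : starAt o x (dForm (fun y => starAt o y (η y)) x) l = 0 := by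
    refine starAt_apply_eq_zero o fun k hk => ?_
    cases k with
    | zero => rfl
    | succ k =>
      refine dForm_eq_zero (fun y => starAt_apply_eq_zero o fun j hj => ?_) x
      exact h j ⟨l, by omega⟩ y
  change dForm η x l + -starAt o x (dForm (fun y => starAt o y (η y)) x) l = 0
  rw [h1, h2, zero_add]
  exact neg_zero

theorem hodgeDirac_mem_extOdd (o : ManifoldOrientation n M) {η : FormField n M}
    (h : ∀ x, η x ∈ extEven n x) (x : M) : hodgeDirac o η x ∈ extOdd n x := by
  intro l hl
  refine hodgeDirac_apply_eq_zero o (fun k hk y => h y k ?_) x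
  exact Nat.not_even_iff_odd.1 fun hke => Nat.not_even_iff_odd.2 hk (hke.add hl)

theorem hodgeDirac_mem_extEven (o : ManifoldOrientation n M) {η : FormField n M}
    (h : ∀ x, η x ∈ extOdd n x) (x : M) : hodgeDirac o η x ∈ extEven n x := by
  intro l hl
  refine hodgeDirac_apply_eq_zero o (fun k hk y => h y k ?_) x
  rw [Nat.odd_add'] at hk
  exact hk.1 hl

variable [IsContMDiffRiemannianBundle (𝓡 (2 * n)) ∞ (EuclideanSpace ℝ (Fin (2 * n)))
      (fun x : M => TangentSpace (𝓡 (2 * n)) x)]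

theorem IsSmoothForm.hodgeDirac {η : FormField n M} (hη : IsSmoothForm η)
    (o : ManifoldOrientation n M) : IsSmoothForm (hodgeDirac o η) :=
  hη.dForm.add ((hη.star o).dForm.star o).neg

/-- The exponents for `k` and `k + 1` differ by `2k`. -/
theorem Complex.I_pow_tau_succ (k : ℕ) :
    Complex.I ^ (n + (k + 1) * (k + 1 - 1)) = (-1 : ℂ) ^ k * Complex.I ^ (n + k * (k - 1)) := by
  have : n + (k + 1) * (k + 1 - 1) = 2 * k + (n + k * (k - 1)) := by
    cases k with
    | zero => simp
    | succ k =>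
      simp only [Nat.add_sub_cancel]
      ring
  rw [this, pow_add, pow_mul, Complex.I_sq]

/-- `τ` exchanges the two summands of `D` up to sign: `dτ = -τδ` and `δτ = -τd`. Each identity
compares the scalars of `τ` in adjacent degrees with the sign of the double star. -/
theorem hodgeDirac_tau (o : ManifoldOrientation n M) {η : FormField n M} (hη : IsSmoothForm η)
    (x : M) : hodgeDirac o (fun y => tauAt o y (η y)) x = -tauAt o x (hodgeDirac o η x) := by
  have hS := hη.star o
  let q : ℕ → ℂ := fun l => Complex.I ^ (n + (2 * n - l) * (2 * n - l - 1))
  have hq : ∀ k l, k + 1 + l = 2 * n → q l = (-1 : ℂ) ^ k * q (l + 1) := by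
    intro k l h
    have h1 : 2 * n - l = k + 1 := by omega
    have h2 : 2 * n - (l + 1) = k := by omega
    simp only [q, h1, h2]
    exact Complex.I_pow_tau_succ k
  funext l
  rcases le_or_gt l (2 * n) with hl | hl
  swap
  · exact (ContinuousAlternatingMap.eq_zero_of_finrank_lt (V := TangentSpace (𝓡 (2 * n)) x) hl _).trans
      (ContinuousAlternatingMap.eq_zero_of_finrank_lt (V := TangentSpace (𝓡 (2 * n)) x) hl _).symm
  -- the two summands of both sides
  have e1 : dForm (fun y => tauAt o y (η y)) x l =
      q l • starAt o x (starAt o x (dForm (fun y => starAt o y (η y)) x)) l := by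
    rw [starAt_eq, gradedStar_gradedStar, smul_smul]
    cases l with
    | zero =>
      change (0 : TangentSpace (𝓡 (2 * n)) x [⋀^Fin 0]→L[ℝ] ℂ) = _ • 0
      ext v
      simp
    | succ l =>
      refine (dForm_const_smul hS q x l).trans ?_
      congr 1
      obtain ⟨k, hk⟩ := Nat.exists_eq_add_of_le hl
      rw [hq k l (by omega), mul_comm]
      congr 1
      rw [neg_one_pow_eq_pow_mod_two, neg_one_pow_eq_pow_mod_two (n := l + 1)]
      congr 1
      omega
  have e2 : starAt o x (dForm (fun y => starAt o y (tauAt o y (η y))) x) l =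
      q l • starAt o x (dForm η x) l := by
    obtain ⟨k, hk⟩ := Nat.exists_eq_add_of_le hl
    have a1 := gradedStar_apply (V := TangentSpace (𝓡 (2 * n)) x) (o.orient x)
      (by omega : k + l = 2 * n) (dForm (fun y => starAt o y (tauAt o y (η y))) x)
    have a2 := gradedStar_apply (V := TangentSpace (𝓡 (2 * n)) x) (o.orient x)
      (by omega : k + l = 2 * n) (dForm η x)
    refine a1.trans (Eq.trans ?_ (congrArg (q l • ·) a2.symm))
    refine Eq.trans (congrArg _ ?_) (map_smul _ (q l) _)
    cases k with
    | zero =>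
      change (0 : TangentSpace (𝓡 (2 * n)) x [⋀^Fin 0]→L[ℝ] ℂ) = _ • 0
      ext v
      simp
    | succ k =>
      -- The star after `τ` is a double star, hence a scalar in each degree, and such scalars pass
      -- through `d`.
      have a3 : (fun y => starAt o y (tauAt o y (η y))) =
          fun y j => (q (2 * n - j) * (-1) ^ j) • η y j := by
        funext y j
        rcases le_or_gt j (2 * n) with hj | hj
        · have b1 := gradedStar_apply (V := TangentSpace (𝓡 (2 * n)) y) (o.orient y)
            (Nat.sub_add_cancel hj) (tauAt o y (η y))
          have b2 := gradedStar_apply (V := TangentSpace (𝓡 (2 * n)) y) (o.orient y)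
            (Nat.sub_add_cancel hj) (starAt o y (η y))
          refine b1.trans ((map_smul (hodgeStar (V := TangentSpace (𝓡 (2 * n)) y) (o.orient y)
            (Nat.sub_add_cancel hj)) (q (2 * n - j)) (starAt o y (η y) (2 * n - j))).trans ?_)
          rw [← b2, starAt_eq, gradedStar_gradedStar, smul_smul]
        · exact (ContinuousAlternatingMap.eq_zero_of_finrank_lt
            (V := TangentSpace (𝓡 (2 * n)) y) hj _).trans
            (ContinuousAlternatingMap.eq_zero_of_finrank_lt
            (V := TangentSpace (𝓡 (2 * n)) y) hj _).symm
      rw [a3]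
      refine (dForm_const_smul hη _ x k).trans ?_
      congr 1
      rw [hq k l (by omega), mul_comm]
      congr 2
      omega
  change dForm _ x l + -starAt o x (dForm (fun y => starAt o y (tauAt o y (η y))) x) l =
    -(q l • starAt o x (dForm η x + -starAt o x (dForm (fun y => starAt o y (η y)) x)) l)
  rw [e1, e2, map_add, map_neg]
  ext v
  change q l * _ + -(q l * _) = -(q l * (_ + - _))
  ring

end HodgeDirac

/-! ### Functions with a given differential and forms with a given value. -/

section Realization

variable {n : ℕ} {M : Type u} [TopologicalSpace M] [T2Space M]
  [ChartedSpace (EuclideanSpace ℝ (Fin (2 * n))) M] [IsManifold (𝓡 (2 * n)) ∞ M]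

local notation "𝔼" => EuclideanSpace ℝ (Fin (2 * n))

/-- A bump function times an affine function of the coordinates. With the next lemma it shows that
the defining property of a leading symbol determines it. -/
theorem exists_contMDiff_mfderiv_eq (x : M) (ξ : TangentSpace (𝓡 (2 * n)) x →L[ℝ] ℝ) :
    ∃ f : M → ℝ, ContMDiff (𝓡 (2 * n)) 𝓘(ℝ, ℝ) ∞ f ∧ f x = 0 ∧
      mfderiv (𝓡 (2 * n)) 𝓘(ℝ, ℝ) f x = ξ := by
  obtain ⟨b⟩ : Nonempty (SmoothBumpFunction (𝓡 (2 * n)) x) := inferInstance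
  let L : 𝔼 →L[ℝ] ℝ := ξ.comp (ofCoord n x x)
  let a : 𝔼 → ℝ := fun y => L (y - extChartAt (𝓡 (2 * n)) x x)
  have ha : ContDiff ℝ ∞ a := L.contDiff.comp (contDiff_id.sub contDiff_const)
  refine ⟨fun y => b y • a (extChartAt (𝓡 (2 * n)) x y), b.contMDiff_smul
    (ha.contMDiff.comp_contMDiffOn contMDiffOn_extChartAt), ?_, ?_⟩
  · simp [a]
  have he : (fun y => b y • a (extChartAt (𝓡 (2 * n)) x y)) =ᶠ[𝓝 x]
      a ∘ extChartAt (𝓡 (2 * n)) x := by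
    filter_upwards [b.eventuallyEq_one] with y hy
    rw [hy]
    exact one_smul ℝ _
  have hd : HasFDerivAt a L (extChartAt (𝓡 (2 * n)) x x) :=
    L.hasFDerivAt.comp _ ((hasFDerivAt_id _).sub_const _)
  rw [he.mfderiv_eq]
  refine (mfderiv_comp x hd.differentiableAt.mdifferentiableAt
    (mdifferentiableAt_extChartAt (mem_chart_source 𝔼 x))).trans ?_
  rw [mfderiv_eq_fderiv, hd.fderiv, ← toCoord_eq_mfderiv (mem_chart_source 𝔼 x)]
  ext v
  exact congrArg ξ (ofCoord_toCoord (mem_chart_source 𝔼 x) v)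

/-- A form with constant coefficients in the chart, cut off by a bump function supported there. -/
theorem exists_isSmoothForm_apply_eq (x : M) (v : ExtFiber n x) :
    ∃ s : FormField n M, IsSmoothForm s ∧ s x = v := by
  obtain ⟨b⟩ : Nonempty (SmoothBumpFunction (𝓡 (2 * n)) x) := inferInstance
  have hx := mem_chart_source 𝔼 x
  let t : FormField n M := fun y => (b y : ℂ) •
    (gradedComp ((ofCoord n x x).comp (toCoord n x y)) v : ExtFiber n y)
  refine ⟨t, isSmoothForm_iff.2 fun x₁ k => ?_, ?_⟩
  · by_cases h₁ : x₁ ∈ (chartAt 𝔼 x).source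
    · refine ContMDiffAt.coordForm_of_coordForm (mem_chart_source 𝔼 x₁) h₁ ?_
      have hc : ContMDiffAt (𝓡 (2 * n)) 𝓘(ℝ, 𝔼 [⋀^Fin k]→L[ℝ] ℂ) ∞
          (fun y => b y • (v k).compContinuousLinearMap (ofCoord n x x)) x₁ :=
        b.contMDiff.contMDiffAt.smul contMDiffAt_const
      refine hc.congr_of_eventuallyEq ?_
      filter_upwards [(chartAt 𝔼 x).open_source.mem_nhds h₁] with y hy
      ext w
      change (b y : ℂ) * v k (fun i => ofCoord n x x (toCoord n x y (ofCoord n x y (w i)))) =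
        b y • v k (fun i => ofCoord n x x (w i))
      simp only [toCoord_ofCoord hy, Complex.real_smul]
    · have h₂ : x₁ ∉ tsupport b := fun h => h₁ (b.tsupport_subset_chartAt_source h)
      refine (contMDiffAt_const (c := 0)).congr_of_eventuallyEq ?_
      filter_upwards [(isClosed_tsupport b).isOpen_compl.mem_nhds h₂] with y hy
      ext w
      change (b y : ℂ) * _ = 0
      rw [image_eq_zero_of_notMem_tsupport hy]
      simp
  · funext k
    ext w
    change (b x : ℂ) * v k (fun i => ofCoord n x x (toCoord n x x (w i))) = _
    simp only [ofCoord_toCoord hx, b.eq_one, Complex.ofReal_one, one_mul]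

end Realization

/-! ### Smooth projections onto the subbundles. -/

section Projectors

variable {n : ℕ} {M : Type u} [TopologicalSpace M]
  [ChartedSpace (EuclideanSpace ℝ (Fin (2 * n))) M] [IsManifold (𝓡 (2 * n)) ∞ M]
  [RiemannianBundle (fun x : M => TangentSpace (𝓡 (2 * n)) x)]

local notation "𝔼" => EuclideanSpace ℝ (Fin (2 * n))

/-- A smooth projection of the forms on `M` onto a family of subspaces which, in oriented
orthonormal frames, is given by a fixed endomorphism. -/
structure FormProjector (o : ManifoldOrientation n M)
    (W : ∀ x : M, Submodule ℂ (ExtFiber n x)) where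
  proj : ∀ x : M, ExtFiber n x →ₗ[ℂ] ExtFiber n x
  model : Orientation ℝ (EuclideanSpace ℝ (Fin (2 * n))) (Fin (2 * n)) →
    ExtAlg (EuclideanSpace ℝ (Fin (2 * n))) →ₗ[ℂ] ExtAlg (EuclideanSpace ℝ (Fin (2 * n)))
  proj_mem : ∀ x η, proj x η ∈ W x
  proj_eq : ∀ x, ∀ η ∈ W x, proj x η = η
  smooth : ∀ {η : FormField n M}, IsSmoothForm η → IsSmoothForm (fun x => proj x (η x))
  frameForm_proj : ∀ {o₀ : Orientation ℝ (EuclideanSpace ℝ (Fin (2 * n))) (Fin (2 * n))} {x₀ x : M},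
    Orientation.map (Fin (2 * n)) (frame n x₀ x).toLinearEquiv o₀ = o.orient x →
    ∀ η : ExtFiber n x, frameForm x₀ x (proj x η) = model o₀ (frameForm x₀ x η)

namespace FormProjector

variable {o : ManifoldOrientation n M} {W W₁ W₂ : ∀ x : M, Submodule ℂ (ExtFiber n x)}

/-- The projection onto an intersection. -/
noncomputable def inf (P₁ : FormProjector o W₁) (P₂ : FormProjector o W₂)
    (h : ∀ x, ∀ η ∈ W₁ x, P₂.proj x η ∈ W₁ x) : FormProjector o (fun x => W₁ x ⊓ W₂ x) where
  proj x := P₂.proj x ∘ₗ P₁.proj x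
  model o₀ := P₂.model o₀ ∘ₗ P₁.model o₀
  proj_mem x η := ⟨h x _ (P₁.proj_mem x η), P₂.proj_mem x _⟩
  proj_eq x η hη := by
    rw [LinearMap.comp_apply, P₁.proj_eq x η hη.1, P₂.proj_eq x η hη.2]
  smooth hη := P₂.smooth (P₁.smooth hη)
  frameForm_proj ho η := by
    rw [LinearMap.comp_apply, P₂.frameForm_proj ho, P₁.frameForm_proj ho]
    rfl

theorem exists_isSmoothSection [T2Space M] (P : FormProjector o W) {x : M} {v : ExtFiber n x}
    (hv : v ∈ W x) : ∃ s, IsSmoothSection W s ∧ s x = v := by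
  obtain ⟨s, hs, hsx⟩ := exists_isSmoothForm_apply_eq x v
  exact ⟨fun y => P.proj y (s y), ⟨P.smooth hs, fun y => P.proj_mem y _⟩,
    (congrArg (P.proj x) hsx).trans (P.proj_eq x v hv)⟩

/-- This is read off from `D` instead of being computed: with `v = s(x)` and `ξ = df_x` one has
`c(ξ) v = D(f s)(x)`, and `f s` is again a section of `W₁`. -/
theorem cliffordAt_mem [T2Space M] [IsContMDiffRiemannianBundle (𝓡 (2 * n)) ∞
      (EuclideanSpace ℝ (Fin (2 * n))) (fun x : M => TangentSpace (𝓡 (2 * n)) x)]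
    (P : FormProjector o W₁)
    (hD : ∀ s, IsSmoothSection W₁ s → IsSmoothSection W₂ (hodgeDirac o s)) (x : M)
    (ξ : TangentSpace (𝓡 (2 * n)) x →L[ℝ] ℝ) {v : ExtFiber n x} (hv : v ∈ W₁ x) :
    cliffordAt o x ξ v ∈ W₂ x := by
  obtain ⟨s, hs, rfl⟩ := P.exists_isSmoothSection hv
  obtain ⟨f, hf, hfx, rfl⟩ := exists_contMDiff_mfderiv_eq x ξ
  rw [← hodgeDirac_smul_of_eq_zero o hs.1 hf hfx]
  exact (hD _ ⟨hs.1.real_smul hf, fun y => (W₁ y).smul_mem _ (hs.2 y)⟩).2 x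

end FormProjector

/-- The multiplication of the forms of degree `k` by a scalar depending on `k`. -/
noncomputable def degreeScaling {V : Type*} [AddCommGroup V] [Module ℝ V] [TopologicalSpace V]
    (c : ℕ → ℂ) : ExtAlg V →ₗ[ℂ] ExtAlg V where
  toFun η k := c k • η k
  map_add' _ _ := by
    funext k
    ext v
    exact mul_add _ _ _
  map_smul' _ _ := by
    funext k
    ext v
    exact mul_left_comm _ _ _

variable (o : ManifoldOrientation n M)

/-- The projection onto a sum of homogeneous components. -/
noncomputable def degreeProjector (S : ℕ → Prop) [DecidablePred S] (W : ∀ x : M, Submodule ℂ (ExtFiber n x))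
    (hW : ∀ x η, η ∈ W x ↔ ∀ k, ¬ S k → η k = 0) : FormProjector o W where
  proj x := degreeScaling (V := TangentSpace (𝓡 (2 * n)) x) fun k => if S k then 1 else 0
  model _ := degreeScaling fun k => if S k then 1 else 0
  proj_mem x η := (hW x _).2 fun k hk => by
    change (if S k then (1 : ℂ) else 0) • η k = 0
    rw [if_neg hk]
    ext v
    exact zero_mul _
  proj_eq x η hη := by
    funext k
    change (if S k then (1 : ℂ) else 0) • η k = η k
    split_ifs with hk
    · ext v
      exact one_mul _
    · rw [(hW x η).1 hη k hk]
      ext v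
      exact mul_zero _
  smooth hη := hη.const_smul _
  frameForm_proj _ _ := rfl

/-- The projection onto the forms of even degree. -/
noncomputable def evenProjector : FormProjector o (extEven n) :=
  degreeProjector o Even _ fun _ _ => by
    simp only [Nat.not_even_iff_odd]
    rfl

/-- The projection onto the forms of odd degree. -/
noncomputable def oddProjector : FormProjector o (extOdd n) :=
  degreeProjector o Odd _ fun _ _ => by
    simp only [Nat.not_odd_iff_even]
    rfl

theorem evenProjector_add_oddProjector (x : M) (η : ExtFiber n x) :
    (evenProjector o).proj x η + (oddProjector o).proj x η = η := by
  funext k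
  ext v
  have h1 : (evenProjector o).proj x η k v = (if Even k then (1 : ℂ) else 0) * η k v := rfl
  have h2 : (oddProjector o).proj x η k v = (if Odd k then (1 : ℂ) else 0) * η k v := rfl
  change (evenProjector o).proj x η k v + (oddProjector o).proj x η k v = η k v
  rw [h1, h2]
  rcases Nat.even_or_odd k with h | h
  · simp [h]
  · simp [h]

variable [IsContMDiffRiemannianBundle (𝓡 (2 * n)) ∞
      (EuclideanSpace ℝ (Fin (2 * n))) (fun x : M => TangentSpace (𝓡 (2 * n)) x)]

/-- The projection onto an eigenspace of the involution `τ`. -/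
noncomputable def tauProjector (b : ℂ) (hb : b * b = 1) :
    FormProjector o (fun x => Module.End.eigenspace (tauAt o x) b) where
  -- Since `τ² = 1` and `b² = 1`, the average of `1` and `b τ` projects onto the `b`-eigenspace.
  proj x := (2⁻¹ : ℂ) • (LinearMap.id + b • tauAt o x)
  model o₀ := (2⁻¹ : ℂ) • (LinearMap.id + b • gradedTau o₀)
  proj_mem x η := by
    rw [Module.End.mem_eigenspace_iff]
    have h : tauAt o x (tauAt o x η) = η :=
      gradedTau_gradedTau (V := TangentSpace (𝓡 (2 * n)) x) (o.orient x) η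
    simp only [LinearMap.smul_apply, LinearMap.add_apply, LinearMap.id_apply, map_smul, map_add, h,
      smul_smul, smul_add]
    rw [add_comm]
    congr 2
    · rw [mul_comm]
    · rw [mul_left_comm, hb, mul_one]
  proj_eq x η hη := by
    rw [Module.End.mem_eigenspace_iff] at hη
    simp only [LinearMap.smul_apply, LinearMap.add_apply, LinearMap.id_apply, hη, smul_smul, hb,
      one_smul, ← two_smul ℂ η]
    norm_num
  smooth hη := (hη.add ((hη.tau o).const_smul fun _ => b)).const_smul fun _ => 2⁻¹
  frameForm_proj {o₀ x₀ x} ho η := by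
    have h : frameForm x₀ x (tauAt o x η) = gradedTau o₀ (frameForm x₀ x η) :=
      gradedComp_gradedTau o₀ (o.orient x) (frame n x₀ x) ho η
    change (2⁻¹ : ℂ) • (frameForm x₀ x η + b • frameForm x₀ x (tauAt o x η)) = _
    rw [h]
    rfl

/-- The projection onto the eigenspace of `τ` for the eigenvalue `1`. -/
noncomputable def plusProjector : FormProjector o (extPlus o) := tauProjector o 1 (by norm_num)

/-- The projection onto the eigenspace of `τ` for the eigenvalue `-1`. -/
noncomputable def minusProjector : FormProjector o (extMinus o) := tauProjector o (-1) (by norm_num)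

theorem plusProjector_add_minusProjector (x : M) (η : ExtFiber n x) :
    (plusProjector o).proj x η + (minusProjector o).proj x η = η := by
  change (2⁻¹ : ℂ) • (η + (1 : ℂ) • tauAt o x η) + (2⁻¹ : ℂ) • (η + (-1 : ℂ) • tauAt o x η) = η
  module

/-- `τ` sends degree `k` to degree `2n - k`, so it preserves any set of degrees that is stable under
this reflection. The even and the odd degrees are such sets. -/
theorem tauProjector_mem {b : ℂ} (hb : b * b = 1) {x : M} {η : ExtFiber n x} {S : ℕ → Prop}
    {W : ∀ x : M, Submodule ℂ (ExtFiber n x)} (hW : ∀ x η, η ∈ W x ↔ ∀ k, ¬ S k → η k = 0)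
    (hS : ∀ k l, k + l = 2 * n → ¬ S l → ¬ S k) (hη : η ∈ W x) :
    (tauProjector o b hb).proj x η ∈ W x := by
  refine (W x).smul_mem _ ((W x).add_mem hη ((W x).smul_mem _ ((hW x _).2 fun l hl => ?_)))
  have h : starAt o x η l = 0 :=
    starAt_apply_eq_zero o fun k hk => (hW x η).1 hη k (hS k l hk hl)
  refine (congrArg (Complex.I ^ (n + (2 * n - l) * (2 * n - l - 1)) • ·) h).trans ?_
  ext v
  exact mul_zero _

theorem tauProjector_mem_extEven {b : ℂ} (hb : b * b = 1) {x : M} {η : ExtFiber n x}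
    (hη : η ∈ extEven n x) : (tauProjector o b hb).proj x η ∈ extEven n x := by
  refine tauProjector_mem o hb (S := Even) (W := extEven n) (fun _ _ => ?_)
    (fun k l h hl hk => ?_) hη
  · simp only [Nat.not_even_iff_odd]
    rfl
  · exact hl ((Nat.even_add.1 (h ▸ even_two_mul n)).1 hk)

theorem tauProjector_mem_extOdd {b : ℂ} (hb : b * b = 1) {x : M} {η : ExtFiber n x}
    (hη : η ∈ extOdd n x) : (tauProjector o b hb).proj x η ∈ extOdd n x := by
  refine tauProjector_mem o hb (S := Odd) (W := extOdd n) (fun _ _ => ?_)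
    (fun k l h hl hk => ?_) hη
  · simp only [Nat.not_odd_iff_even]
    rfl
  · simp only [Nat.not_odd_iff_even] at hl
    exact Nat.not_even_iff_odd.2 hk ((Nat.even_add.1 (h ▸ even_two_mul n)).2 hl)

theorem IsSmoothSection.hodgeDirac_of_even {s : FormField n M}
    (hs : IsSmoothSection (extEven n) s) : IsSmoothSection (extOdd n) (hodgeDirac o s) :=
  ⟨hs.1.hodgeDirac o, hodgeDirac_mem_extOdd o hs.2⟩

theorem IsSmoothSection.hodgeDirac_of_odd {s : FormField n M}
    (hs : IsSmoothSection (extOdd n) s) : IsSmoothSection (extEven n) (hodgeDirac o s) :=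
  ⟨hs.1.hodgeDirac o, hodgeDirac_mem_extEven o hs.2⟩

theorem hodgeDirac_const_smul {s : FormField n M} (hs : IsSmoothForm s) (b : ℂ) (x : M) :
    hodgeDirac o (fun y => b • s y) x = b • hodgeDirac o s x := by
  have hd : ∀ {t : FormField n M}, IsSmoothForm t →
      dForm (fun y => b • t y) x = b • dForm t x := by
    intro t ht
    funext k
    cases k with
    | zero =>
      ext v
      exact (mul_zero _).symm
    | succ k => exact dForm_const_smul ht (fun _ => b) x k
  have h1 : (fun y => starAt o y (b • s y)) = fun y => b • starAt o y (s y) :=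
    funext fun y => map_smul _ _ _
  change dForm _ x + -starAt o x (dForm (fun y => starAt o y (b • s y)) x) =
    b • (dForm s x + -starAt o x (dForm (fun y => starAt o y (s y)) x))
  rw [h1, hd hs, hd (hs.star o), map_smul]
  module

/-- On an eigensection, `b D s = D τ s = -τ D s`. -/
theorem IsSmoothSection.hodgeDirac_of_eigenspace {b b' : ℂ} (hb : b' = -b) {s : FormField n M}
    (hs : IsSmoothSection (fun x => Module.End.eigenspace (tauAt o x) b) s) :
    IsSmoothSection (fun x => Module.End.eigenspace (tauAt o x) b') (hodgeDirac o s) := by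
  refine ⟨hs.1.hodgeDirac o, fun x => ?_⟩
  have h1 : (fun y => tauAt o y (s y)) = fun y k => b • s y k :=
    funext fun y => Module.End.mem_eigenspace_iff.1 (hs.2 y)
  have h2 := hodgeDirac_tau o hs.1 x
  have h3 : hodgeDirac o (fun y => b • s y) x = b • hodgeDirac o s x := 
    hodgeDirac_const_smul o hs.1 b x
  rw [Module.End.mem_eigenspace_iff, hb, neg_smul, ← h3]
  rw [h1] at h2
  exact (neg_eq_iff_eq_neg.2 h2).symm

theorem IsSmoothSection.hodgeDirac_of_plus {s : FormField n M}
    (hs : IsSmoothSection (extPlus o) s) : IsSmoothSection (extMinus o) (hodgeDirac o s) :=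
  IsSmoothSection.hodgeDirac_of_eigenspace o (b := 1) rfl hs

theorem IsSmoothSection.hodgeDirac_of_minus {s : FormField n M}
    (hs : IsSmoothSection (extMinus o) s) : IsSmoothSection (extPlus o) (hodgeDirac o s) :=
  IsSmoothSection.hodgeDirac_of_eigenspace o (b := -1) (neg_neg 1).symm hs

theorem IsSmoothSection.hodgeDirac_inf {W₁ W₂ W₁' W₂' : ∀ x : M, Submodule ℂ (ExtFiber n x)}
    (h : ∀ s, IsSmoothSection W₁ s → IsSmoothSection W₁' (hodgeDirac o s))
    (h' : ∀ s, IsSmoothSection W₂ s → IsSmoothSection W₂' (hodgeDirac o s)) (s : FormField n M)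
    (hs : IsSmoothSection (fun x => W₁ x ⊓ W₂ x) s) :
    IsSmoothSection (fun x => W₁' x ⊓ W₂' x) (hodgeDirac o s) :=
  ⟨hs.1.hodgeDirac o, fun x => ⟨(h s ⟨hs.1, fun y => (hs.2 y).1⟩).2 x,
    (h' s ⟨hs.1, fun y => (hs.2 y).2⟩).2 x⟩⟩

end Projectors

/-! ### Convergence in the total spaces, expressed in orthonormal frames. -/

section TotalSpaces

open Filter

variable {n : ℕ} {M : Type u} [TopologicalSpace M]
  [ChartedSpace (EuclideanSpace ℝ (Fin (2 * n))) M] [IsManifold (𝓡 (2 * n)) ∞ M]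

local notation "𝔼" => EuclideanSpace ℝ (Fin (2 * n))

theorem trivializationAt_form_apply {k : ℕ} (x₀ x : M)
    (η : TangentSpace (𝓡 (2 * n)) x [⋀^Fin k]→L[ℝ] ℂ) :
    (trivializationAt (𝔼 [⋀^Fin k]→L[ℝ] ℂ)
      (fun x : M => TangentSpace (𝓡 (2 * n)) x [⋀^Fin k]→L[ℝ] Bundle.Trivial M ℂ x) x₀
      ⟨x, η⟩).2 = η.compContinuousLinearMap (ofCoord n x₀ x) := by
  rw [FiberBundle.trivializationAt_continuousAlternatingMap_apply]
  ext v
  exact congrArg (fun L : ℂ →L[ℝ] ℂ => L _)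
    (Bundle.Trivial.continuousLinearMapAt_trivialization ℝ M ℂ x)

theorem trivializationAt_cotangent_apply (x₀ x : M) (ξ : TangentSpace (𝓡 (2 * n)) x →L[ℝ] ℝ) :
    (trivializationAt (𝔼 →L[ℝ] ℝ)
      (fun x : M => TangentSpace (𝓡 (2 * n)) x →L[ℝ] Bundle.Trivial M ℝ x) x₀
      ⟨x, ξ⟩).2 = ξ.comp (ofCoord n x₀ x) := by
  rw [hom_trivializationAt_apply]
  ext1 v
  exact congrArg (fun L : ℝ →L[ℝ] ℝ => L _)
    (Bundle.Trivial.continuousLinearMapAt_trivialization ℝ M ℝ x)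

/-- The expression of a covector in coordinates. -/
noncomputable def coordCovector (x₀ x : M) (ξ : TangentSpace (𝓡 (2 * n)) x →L[ℝ] ℝ) : 𝔼 →L[ℝ] ℝ :=
  ξ.comp (ofCoord n x₀ x)

variable [RiemannianBundle (fun x : M => TangentSpace (𝓡 (2 * n)) x)]

/-- The expression of a covector in the orthonormal frame. -/
noncomputable def frameCovector (x₀ x : M) (ξ : TangentSpace (𝓡 (2 * n)) x →L[ℝ] ℝ) : 𝔼 →L[ℝ] ℝ :=
  ξ.comp (frameL n x₀ x)

theorem norm_frameCovector (x₀ x : M) (ξ : TangentSpace (𝓡 (2 * n)) x →L[ℝ] ℝ) :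
    ‖frameCovector x₀ x ξ‖ = ‖ξ‖ :=
  ContinuousLinearMap.opNorm_comp_linearIsometryEquiv ξ (frame n x₀ x)

variable [IsContMDiffRiemannianBundle (𝓡 (2 * n)) ∞ (EuclideanSpace ℝ (Fin (2 * n)))
      (fun x : M => TangentSpace (𝓡 (2 * n)) x)]

/-- The bundle topology is given by coordinate expressions, and these differ from the frame
expressions by invertible matrices that depend continuously on the base point. In frames, limits are
taken in the fixed space `ExtAlg 𝔼`. -/
theorem tendsto_subFamily_iff {W : ∀ x : M, Submodule ℂ (ExtFiber n x)} {Z : Type*} {l : Filter Z}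
    {f : Z → (subFamily W).Total} {p₀ : (subFamily W).Total} {x₀ : M}
    (hp : p₀.proj ∈ (chartAt 𝔼 x₀).source) :
    Tendsto f l (𝓝 p₀) ↔ Tendsto (fun z => (f z).proj) l (𝓝 p₀.proj) ∧
      Tendsto (fun z => frameForm x₀ (f z).proj (f z).snd.1) l
        (𝓝 (frameForm x₀ p₀.proj p₀.snd.1)) := by
  have h1 : Tendsto f l (𝓝 p₀) ↔ ∀ k : ℕ, Tendsto (fun z => (f z).proj) l (𝓝 p₀.proj) ∧
      Tendsto (fun z => ((f z).snd.1 k).compContinuousLinearMap (ofCoord n x₀ (f z).proj)) l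
        (𝓝 ((p₀.snd.1 k).compContinuousLinearMap (ofCoord n x₀ p₀.proj))) := by
    have h0 := nhds_induced (fun p : (subFamily W).Total => ((fun k => ⟨p.proj, p.snd.1 k⟩) : ∀ k : ℕ,
      Bundle.TotalSpace (EuclideanSpace ℝ (Fin (2 * n)) [⋀^Fin k]→L[ℝ] ℂ)
        (fun x : M => TangentSpace (𝓡 (2 * n)) x [⋀^Fin k]→L[ℝ] Bundle.Trivial M ℂ x))) p₀
    refine (iff_of_eq (congrArg (Tendsto f l) h0)).trans ?_
    rw [tendsto_comap_iff, tendsto_pi_nhds]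
    refine forall_congr' fun k => ?_
    refine ((trivializationAt (𝔼 [⋀^Fin k]→L[ℝ] ℂ) (fun x : M => TangentSpace (𝓡 (2 * n)) x
      [⋀^Fin k]→L[ℝ] Bundle.Trivial M ℂ x) x₀).tendsto_nhds_iff ?_).trans ?_
    · rw [FiberBundle.trivializationAt_continuousAlternatingMap_source]
      exact ⟨hp, trivial⟩
    · simp only [trivializationAt_form_apply, Function.comp_def]
  rw [h1]
  constructor
  · intro h
    refine ⟨(h 0).1, tendsto_pi_nhds.2 fun k => ?_⟩
    have h2 := (h k).2.form_compContinuousLinearMap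
      ((contMDiffAt_frameMatrix hp).continuousAt.tendsto.comp (h k).1)
    have h3 : ∀ q : (subFamily W).Total, q.proj ∈ (chartAt 𝔼 x₀).source →
        ((q.snd.1 k).compContinuousLinearMap
          (ofCoord n x₀ q.proj)).compContinuousLinearMap (frameMatrix n x₀ q.proj) =
        frameForm x₀ q.proj q.snd.1 k := by
      intro q hq
      ext v
      change q.snd.1 k (fun i => ofCoord n x₀ q.proj
        (toCoord n x₀ q.proj (frameL n x₀ q.proj (v i)))) = _
      simp only [ofCoord_toCoord hq]
      rfl
    rw [h3 p₀ hp] at h2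
    refine h2.congr' ?_
    filter_upwards [(h 0).1 ((chartAt 𝔼 x₀).open_source.mem_nhds hp)] with z hz
    exact h3 (f z) hz
  · rintro ⟨h, h'⟩ k
    refine ⟨h, ?_⟩
    have h2 := (tendsto_pi_nhds.1 h' k).form_compContinuousLinearMap
      ((contMDiffAt_frameMatrixInv hp).continuousAt.tendsto.comp h)
    have h3 : ∀ q : (subFamily W).Total,
        (frameForm x₀ q.proj q.snd.1 k).compContinuousLinearMap (frameMatrixInv n x₀ q.proj) =
        (q.snd.1 k).compContinuousLinearMap (ofCoord n x₀ q.proj) := by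
      intro q
      ext v
      change q.snd.1 k (fun i => frameL n x₀ q.proj
        (frameInvL n x₀ q.proj (ofCoord n x₀ q.proj (v i)))) = _
      simp only [frameL_frameInvL]
      rfl
    rw [h3] at h2
    exact h2.congr fun z => h3 (f z)

/-- The same change from coordinates to frames, for covectors. Frames have the advantage of
preserving norms. -/
theorem tendsto_cotangent_iff {Z : Type*} {l : Filter Z} {f : Z → Cotangent n M}
    {p₀ : Cotangent n M} {x₀ : M} (hp : p₀.proj ∈ (chartAt 𝔼 x₀).source) :
    Tendsto f l (𝓝 p₀) ↔ Tendsto (fun z => (f z).proj) l (𝓝 p₀.proj) ∧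
      Tendsto (fun z => frameCovector x₀ (f z).proj (f z).snd) l
        (𝓝 (frameCovector x₀ p₀.proj p₀.snd)) := by
  have h1 : Tendsto f l (𝓝 p₀) ↔ Tendsto (fun z => (f z).proj) l (𝓝 p₀.proj) ∧
      Tendsto (fun z => coordCovector x₀ (f z).proj (f z).snd) l
        (𝓝 (coordCovector x₀ p₀.proj p₀.snd)) := by
    refine ((trivializationAt (𝔼 →L[ℝ] ℝ) (fun x : M => TangentSpace (𝓡 (2 * n)) x
      →L[ℝ] Bundle.Trivial M ℝ x) x₀).tendsto_nhds_iff ?_).trans ?_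
    · rw [hom_trivializationAt_source]
      exact ⟨hp, trivial⟩
    · exact Iff.of_eq (congrArg₂ And rfl (congrArg₂ (fun a b => Tendsto a l (𝓝 b))
        (funext fun z => trivializationAt_cotangent_apply x₀ (f z).proj (f z).snd)
        (trivializationAt_cotangent_apply x₀ p₀.proj p₀.snd)))
  rw [h1]
  refine and_congr_right fun h => ⟨fun h' => ?_, fun h' => ?_⟩
  · have h2 := ((ContinuousLinearMap.compL ℝ 𝔼 𝔼 ℝ).isBoundedBilinearMap.continuous.tendsto _).comp
      (h'.prodMk_nhds ((contMDiffAt_frameMatrix hp).continuousAt.tendsto.comp h))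
    have h3 : ∀ q : Cotangent n M, q.proj ∈ (chartAt 𝔼 x₀).source →
        (coordCovector x₀ q.proj q.snd).comp
          (frameMatrix n x₀ q.proj) = frameCovector x₀ q.proj q.snd := by
      intro q hq
      ext1 v
      exact congrArg q.snd (ofCoord_toCoord hq _)
    refine (h2.mono_right (congrArg 𝓝 (h3 p₀ hp)).le).congr' ?_
    filter_upwards [h ((chartAt 𝔼 x₀).open_source.mem_nhds hp)] with z hz
    exact h3 (f z) hz
  · have h2 := ((ContinuousLinearMap.compL ℝ 𝔼 𝔼 ℝ).isBoundedBilinearMap.continuous.tendsto _).comp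
      (h'.prodMk_nhds ((contMDiffAt_frameMatrixInv hp).continuousAt.tendsto.comp h))
    have h3 : ∀ q : Cotangent n M,
        (frameCovector x₀ q.proj q.snd).comp (frameMatrixInv n x₀ q.proj) =
        coordCovector x₀ q.proj q.snd := by
      intro q
      ext1 v
      exact congrArg q.snd (frameL_frameInvL x₀ q.proj _)
    exact (h2.mono_right (congrArg 𝓝 (h3 p₀)).le).congr fun z => h3 (f z)

end TotalSpaces

/-! ### Continuity of the symbol, local triviality, and topology of the disc bundle. -/

section FormContinuity

open Filter

variable {n : ℕ} {M : Type u} [TopologicalSpace M]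
  [ChartedSpace (EuclideanSpace ℝ (Fin (2 * n))) M] [IsManifold (𝓡 (2 * n)) ∞ M]

local notation "𝔼" => EuclideanSpace ℝ (Fin (2 * n))

variable {Z : Type*} [TopologicalSpace Z]

/-- The continuity of a family of forms at points of `M` which depend on a parameter. -/
def ContinuousForms (b : Z → M) (s : ∀ z, ExtFiber n (b z)) : Prop :=
  Continuous fun z => (subFamily (fun _ : M => (⊤ : Submodule ℂ (ExtFiber n _)))).pt (b z)
    ⟨s z, trivial⟩

/-- The topology on a family of subspaces is induced from `Λ^*`, so continuity does not depend on
the subspaces and may be tested in the full bundle. -/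
theorem continuous_subFamily_pt_iff {W : ∀ x : M, Submodule ℂ (ExtFiber n x)} {b : Z → M}
    {s : ∀ z, W (b z)} :
    Continuous (fun z => (subFamily W).pt (b z) (s z)) ↔ ContinuousForms b fun z => (s z).1 := by
  have h : ∀ (W : ∀ x : M, Submodule ℂ (ExtFiber n x)) (s : ∀ z, W (b z)),
      Continuous (fun z => (subFamily W).pt (b z) (s z)) ↔
      Continuous (fun z => ((fun k => ⟨b z, (s z).1 k⟩) : ∀ k : ℕ,
        Bundle.TotalSpace (EuclideanSpace ℝ (Fin (2 * n)) [⋀^Fin k]→L[ℝ] ℂ)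
        (fun x : M => TangentSpace (𝓡 (2 * n)) x [⋀^Fin k]→L[ℝ] Bundle.Trivial M ℂ x))) :=
    fun W s => continuous_induced_rng
  exact (h W s).trans (h (fun _ => ⊤) fun z => ⟨(s z).1, trivial⟩).symm

theorem continuousForms_snd (W : ∀ x : M, Submodule ℂ (ExtFiber n x)) :
    ContinuousForms (fun p : (subFamily W).Total => p.proj) (fun p => p.snd.1) :=
  continuous_subFamily_pt_iff.1 continuous_id

theorem ContinuousForms.comp {Z' : Type*} [TopologicalSpace Z'] {b : Z → M}
    {s : ∀ z, ExtFiber n (b z)} (h : ContinuousForms b s) {g : Z' → Z} (hg : Continuous g) :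
    ContinuousForms (fun z => b (g z)) (fun z => s (g z)) :=
  Continuous.comp h hg

variable [RiemannianBundle (fun x : M => TangentSpace (𝓡 (2 * n)) x)]
  [IsContMDiffRiemannianBundle (𝓡 (2 * n)) ∞ (EuclideanSpace ℝ (Fin (2 * n)))
      (fun x : M => TangentSpace (𝓡 (2 * n)) x)]

theorem continuous_proj_subFamily (W : ∀ x : M, Submodule ℂ (ExtFiber n x)) :
    Continuous fun p : (subFamily W).Total => p.proj :=
  continuous_iff_continuousAt.2 fun p =>
    ((tendsto_subFamily_iff (mem_chart_source 𝔼 p.proj)).1 tendsto_id).1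

theorem ContinuousForms.continuous_base {b : Z → M} {s : ∀ z, ExtFiber n (b z)}
    (h : ContinuousForms b s) : Continuous b :=
  (continuous_proj_subFamily _).comp h

theorem ContinuousForms.continuousAt {b : Z → M} {s : ∀ z, ExtFiber n (b z)}
    (h : ContinuousForms b s) {z₀ : Z} {x₀ : M} (hz : b z₀ ∈ (chartAt 𝔼 x₀).source) :
    ContinuousAt (fun z => frameForm x₀ (b z) (s z)) z₀ :=
  ((tendsto_subFamily_iff (p₀ := (subFamily (fun _ : M =>
    (⊤ : Submodule ℂ (ExtFiber n _)))).pt (b z₀) ⟨s z₀, trivial⟩) hz).1 (h.tendsto z₀)).2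

theorem continuousForms_of_continuousAt {b : Z → M} {s : ∀ z, ExtFiber n (b z)}
    (hb : Continuous b) (h : ∀ z₀, ∃ x₀ : M, b z₀ ∈ (chartAt 𝔼 x₀).source ∧
      ContinuousAt (fun z => frameForm x₀ (b z) (s z)) z₀) : ContinuousForms b s := by
  refine continuous_iff_continuousAt.2 fun z₀ => ?_
  obtain ⟨x₀, hx₀, h⟩ := h z₀
  exact (tendsto_subFamily_iff (p₀ := (subFamily (fun _ : M =>
    (⊤ : Submodule ℂ (ExtFiber n _)))).pt (b z₀) ⟨s z₀, trivial⟩) hx₀).2 ⟨hb.tendsto z₀, h⟩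

theorem ContinuousForms.add {b : Z → M} {s t : ∀ z, ExtFiber n (b z)} (hs : ContinuousForms b s)
    (ht : ContinuousForms b t) : ContinuousForms b (fun z => s z + t z) := by
  refine continuousForms_of_continuousAt hs.continuous_base fun z₀ =>
    ⟨b z₀, mem_chart_source 𝔼 _, ?_⟩
  have h := (hs.continuousAt (z₀ := z₀) (mem_chart_source 𝔼 _)).add
    (ht.continuousAt (z₀ := z₀) (mem_chart_source 𝔼 _))
  refine h.congr (Eventually.of_forall fun z => ?_)
  exact (map_add (gradedComp (frameL n (b z₀) (b z))) (s z) (t z)).symm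

theorem ContinuousForms.smul {b : Z → M} {s : ∀ z, ExtFiber n (b z)} (hs : ContinuousForms b s)
    {c : Z → ℂ} (hc : Continuous c) : ContinuousForms b (fun z => c z • s z) := by
  refine continuousForms_of_continuousAt hs.continuous_base fun z₀ =>
    ⟨b z₀, mem_chart_source 𝔼 _, ?_⟩
  have h := hc.continuousAt.smul (hs.continuousAt (z₀ := z₀) (mem_chart_source 𝔼 _))
  refine h.congr (Eventually.of_forall fun z => ?_)
  exact (map_smul (gradedComp (frameL n (b z₀) (b z))) (c z) (s z)).symm

theorem continuous_extAlg_linearMap (A : ExtAlg 𝔼 →ₗ[ℂ] ExtAlg 𝔼) : Continuous A :=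
  have : FiniteDimensional ℂ (ExtAlg 𝔼) := finiteDimensional_extAlg (n := n)
  A.continuous_of_finiteDimensional

/-- Near a point the projection is a fixed endomorphism of a finite dimensional space in the frame,
hence continuous. -/
theorem ContinuousForms.proj {b : Z → M} {s : ∀ z, ExtFiber n (b z)} (hs : ContinuousForms b s)
    {o : ManifoldOrientation n M} {W : ∀ x : M, Submodule ℂ (ExtFiber n x)}
    (P : FormProjector o W) : ContinuousForms b (fun z => P.proj (b z) (s z)) := by
  refine continuousForms_of_continuousAt hs.continuous_base fun z₀ =>
    ⟨b z₀, mem_chart_source 𝔼 _, ?_⟩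
  obtain ⟨o₀, ho₀⟩ := exists_frame_orientation o (b z₀)
  refine ((continuous_extAlg_linearMap (P.model o₀)).continuousAt.comp
    (hs.continuousAt (mem_chart_source 𝔼 _))).congr ?_
  filter_upwards [hs.continuous_base.continuousAt.eventually ho₀] with z hz
  exact (P.frameForm_proj hz (s z)).symm

theorem continuous_clifford (o₀ : Orientation ℝ 𝔼 (Fin (2 * n))) :
    Continuous fun p : (𝔼 →L[ℝ] ℝ) × ExtAlg 𝔼 => clifford o₀ p.1 p.2 := by
  have hw : Continuous fun p : (𝔼 →L[ℝ] ℝ) × ExtAlg 𝔼 => gradedWedge p.1 p.2 := by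
    refine continuous_pi fun k => ?_
    cases k with
    | zero => exact continuous_const
    | succ k =>
      have h1 : Continuous fun p : (𝔼 →L[ℝ] ℝ) × ExtAlg 𝔼 => p.1.smulRight (p.2 k) :=
        (ContinuousLinearMap.smulRightL ℝ 𝔼 (𝔼 [⋀^Fin k]→L[ℝ] ℂ)).isBoundedBilinearMap.continuous.comp
          (continuous_fst.prodMk ((continuous_apply k).comp continuous_snd))
      exact (ContinuousAlternatingMap.alternatizeUncurryFinCLM (n := k) ℝ 𝔼 ℂ).continuous.comp h1
  have hS := continuous_extAlg_linearMap (gradedStar o₀)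
  exact hw.sub (hS.comp (hw.comp (continuous_fst.prodMk (hS.comp continuous_snd))))

theorem continuousAt_frameCovector {g : Z → Cotangent n M} (hg : Continuous g) {z₀ : Z} {x₀ : M}
    (hz : (g z₀).proj ∈ (chartAt 𝔼 x₀).source) :
    ContinuousAt (fun z => frameCovector x₀ (g z).proj (g z).snd) z₀ :=
  ((tendsto_cotangent_iff hz).1 (hg.tendsto z₀)).2

theorem ContinuousForms.clifford (o : ManifoldOrientation n M) {g : Z → Cotangent n M}
    (hg : Continuous g) {s : ∀ z, ExtFiber n (g z).proj}
    (hs : ContinuousForms (fun z => (g z).proj) s) :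
    ContinuousForms (fun z => (g z).proj) (fun z => cliffordAt o (g z).proj (g z).snd (s z)) := by
  refine continuousForms_of_continuousAt hs.continuous_base fun z₀ =>
    ⟨(g z₀).proj, mem_chart_source 𝔼 _, ?_⟩
  obtain ⟨o₀, ho₀⟩ := exists_frame_orientation o (g z₀).proj
  refine ((continuous_clifford o₀).continuousAt.comp (ContinuousAt.prodMk
    (continuousAt_frameCovector hg (mem_chart_source 𝔼 _))
    (hs.continuousAt (mem_chart_source 𝔼 _)))).congr ?_
  filter_upwards [hs.continuous_base.continuousAt.eventually ho₀] with z hz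
  exact (gradedComp_clifford o₀ (o.orient _) (frame n _ _) hz (g z).snd (s z)).symm

theorem continuous_norm_cotangent : Continuous fun p : Cotangent n M => ‖p.snd‖ := by
  refine continuous_iff_continuousAt.2 fun p => ?_
  refine (continuousAt_frameCovector continuous_id (mem_chart_source 𝔼 p.proj)).norm.congr
    (Eventually.of_forall fun q => norm_frameCovector p.proj q.proj q.snd)

theorem continuous_proj_cotangent : Continuous fun p : Cotangent n M => p.proj :=
  continuous_iff_continuousAt.2 fun p =>
    ((tendsto_cotangent_iff (mem_chart_source 𝔼 p.proj)).1 tendsto_id).1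

/-- In an oriented frame the subspaces `W x` all become the fixed space of one endomorphism, so the
frame trivializes the family. -/
theorem isLocallyTrivial_subFamily {o : ManifoldOrientation n M}
    {W : ∀ x : M, Submodule ℂ (ExtFiber n x)} (P : FormProjector o W) :
    (subFamily W).IsLocallyTrivial := by
  refine VectFamily.isLocallyTrivial_of_exists (continuous_proj_subFamily W) fun x₀ => ?_
  obtain ⟨o₀, ho₀⟩ := exists_frame_orientation o x₀
  obtain ⟨U, hU, hUo, hxU⟩ := eventually_nhds_iff.1
    (ho₀.and ((chartAt 𝔼 x₀).open_source.mem_nhds (mem_chart_source 𝔼 x₀)))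
  -- A vector lies in `W x` exactly if the projection fixes it, so the common model fiber is the
  -- fixed space of the model of the projection.
  let W₀ : Submodule ℂ (ExtAlg 𝔼) := LinearMap.ker (P.model o₀ - LinearMap.id)
  have hW₀ : ∀ w, w ∈ W₀ ↔ P.model o₀ w = w := fun w => by
    rw [LinearMap.mem_ker, LinearMap.sub_apply, sub_eq_zero, LinearMap.id_apply]
  have hfd : FiniteDimensional ℂ (ExtAlg 𝔼) := finiteDimensional_extAlg (n := n)
  let φ : ∀ x : (⟨U, hUo⟩ : TopologicalSpace.Opens M), W₀ ≃ₗ[ℂ] (subFamily W).fiber x := fun x =>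
    { toFun := fun w => (⟨gradedComp (frameInvL n x₀ x.1) w.1, by
        have h : P.proj x.1 (gradedComp (frameInvL n x₀ x.1) w.1) =
            gradedComp (frameInvL n x₀ x.1) w.1 := by
          apply frameForm_injective x₀ x.1
          rw [P.frameForm_proj (hU x.1 x.2).1, frameForm_frameInvL, (hW₀ _).1 w.2]
        rw [← h]
        exact P.proj_mem x.1 _⟩ : W x.1)
      map_add' := fun _ _ => rfl
      map_smul' := fun _ _ => rfl
      invFun := fun v => ⟨frameForm x₀ x.1 v.1, by
        rw [hW₀, ← P.frameForm_proj (hU x.1 x.2).1, P.proj_eq x.1 v.1 v.2]⟩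
      left_inv := fun w => Subtype.ext (frameForm_frameInvL x₀ x.1 w.1)
      right_inv := fun v => Subtype.ext (frameForm_injective x₀ x.1
        (frameForm_frameInvL x₀ x.1 _)) }
  refine ⟨⟨U, hUo⟩, W₀, inferInstance, inferInstance, inferInstance, inferInstance, inferInstance,
    inferInstance, inferInstance, φ, hxU, ?_, ?_⟩
  · refine continuous_subFamily_pt_iff.2 (continuousForms_of_continuousAt
      (continuous_subtype_val.comp continuous_fst) fun z₀ => ⟨x₀, (hU _ z₀.1.2).2, ?_⟩)
    have h : Continuous fun p : (⟨U, hUo⟩ : TopologicalSpace.Opens M) × W₀ => (p.2 : ExtAlg 𝔼) :=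
      continuous_subtype_val.comp continuous_snd
    refine h.continuousAt.congr (Eventually.of_forall fun p => ?_)
    exact (frameForm_frameInvL x₀ p.1.1 p.2.1).symm
  · refine continuous_induced_rng.2 (continuous_iff_continuousAt.2 fun z₀ => ?_)
    exact ((continuousForms_snd W).comp continuous_subtype_val).continuousAt (hU _ z₀.2).2

/-- The limits of an ultrafilter have the same base point because `M` is Hausdorff, and then the
same covector, as seen in the frame at that point. -/
theorem t2Space_cotangent [T2Space M] : T2Space (Cotangent n M) := by
  refine t2_iff_ultrafilter.2 fun {p q} F hp hq => ?_
  obtain ⟨x, ξ⟩ := p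
  obtain ⟨y, ζ⟩ := q
  have h1 := fun z => tendsto_cotangent_iff (Z := Cotangent n M) (l := F) (f := id)
    (p₀ := z) (x₀ := x)
  obtain rfl : x = y := tendsto_nhds_unique
    ((continuous_proj_cotangent.tendsto _).mono_left hp)
    ((continuous_proj_cotangent.tendsto _).mono_left hq)
  have h2 : frameCovector x x ξ = frameCovector x x ζ := tendsto_nhds_unique
    ((h1 ⟨x, ξ⟩ (mem_chart_source 𝔼 x)).1 hp).2 ((h1 ⟨x, ζ⟩ (mem_chart_source 𝔼 x)).1 hq).2
  have h3 : ξ = ζ := by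
    ext v
    have := congrArg (fun L => L (frameInvL n x x v)) h2
    change ξ (frameL n x x (frameInvL n x x v)) = ζ (frameL n x x (frameInvL n x x v)) at this
    simpa only [frameL_frameInvL] using this
  rw [h3]

instance t2Space_codiscBundle [T2Space M] : T2Space (CodiscBundle n M) :=
  have : T2Space (Cotangent n M) := t2Space_cotangent
  inferInstanceAs (T2Space {p : Cotangent n M // ‖p.snd‖ ≤ 1})

/-- For an ultrafilter the base points converge by compactness of `M`. The covectors, read in the
frame at the limit, stay in a compact ball because the frame is isometric. -/
instance compactSpace_codiscBundle [CompactSpace M] : CompactSpace (CodiscBundle n M) := by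
  refine ⟨isCompact_iff_ultrafilter_le_nhds.2 fun F _ => ?_⟩
  have hM : (F.map (fun p : CodiscBundle n M => p.1.proj) : Filter M) ≤
      𝓝 (F.map (fun p : CodiscBundle n M => p.1.proj)).lim :=
    (F.map (fun p : CodiscBundle n M => p.1.proj)).le_nhds_lim
  generalize (F.map (fun p : CodiscBundle n M => p.1.proj)).lim = x₀ at hM
  obtain ⟨ξ₀, hξ₀, hF⟩ := isCompact_iff_ultrafilter_le_nhds.1
    (isCompact_closedBall (0 : 𝔼 →L[ℝ] ℝ) 1)
    (F.map (fun p : CodiscBundle n M => frameCovector x₀ p.1.proj p.1.snd)) (by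
      refine le_principal_iff.2 (Filter.mem_map.2 (Filter.univ_mem' fun p => ?_))
      rw [Set.mem_preimage, mem_closedBall_zero_iff, norm_frameCovector]
      exact p.2)
  let ξ : TangentSpace (𝓡 (2 * n)) x₀ →L[ℝ] ℝ := ξ₀.comp (frameInvL n x₀ x₀)
  have hξ : frameCovector x₀ x₀ ξ = ξ₀ := by
    ext1 v
    exact congrArg ξ₀ (frameInvL_frameL x₀ x₀ v)
  refine ⟨⟨⟨x₀, ξ⟩, ?_⟩, trivial, ?_⟩
  · change ‖ξ‖ ≤ 1
    rw [← norm_frameCovector x₀ x₀ ξ, hξ]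
    exact mem_closedBall_zero_iff.1 hξ₀
  · have h : Tendsto (fun p : CodiscBundle n M => p.1) F (𝓝 ⟨x₀, ξ⟩) :=
      (tendsto_cotangent_iff (x₀ := x₀) (mem_chart_source 𝔼 x₀)).2
        ⟨hM, hF.trans (congrArg 𝓝 hξ.symm).le⟩
    exact (IsInducing.subtypeVal.tendsto_nhds_iff (f := fun p : CodiscBundle n M => p)).2 h

theorem isClosed_cosphere : IsClosed (cosphere n M) :=
  isClosed_eq (continuous_norm_cotangent.comp continuous_subtype_val) continuous_const

end FormContinuity

/-! ### The symbol as an isomorphism over the sphere bundle, and its class. -/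

section LinearAlgebra

theorem LinearMap.bijective_of_comp_eq_smul {V W : Type*} [AddCommMonoid V] [Module ℂ V]
    [AddCommMonoid W] [Module ℂ W] (f : V →ₗ[ℂ] W) (g : W →ₗ[ℂ] V) {c : ℂ} (hc : c ≠ 0)
    (hgf : ∀ v, g (f v) = c • v) (hfg : ∀ w, f (g w) = c • w) : Function.Bijective f := by
  refine ⟨Function.LeftInverse.injective (g := fun w => c⁻¹ • g w) fun v => ?_,
    fun w => ⟨c⁻¹ • g w, ?_⟩⟩
  · change c⁻¹ • g (f v) = v
    rw [hgf, smul_smul, inv_mul_cancel₀ hc, one_smul]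
  · rw [map_smul, hfg, smul_smul, inv_mul_cancel₀ hc, one_smul]

variable {V W : Type*} [AddCommGroup V] [Module ℂ V] [AddCommGroup W] [Module ℂ W]

/-- The equivalence given by two maps whose compositions are `-1`. -/
def LinearEquiv.ofCompEqNeg (f : V →ₗ[ℂ] W) (g : W →ₗ[ℂ] V) (hgf : ∀ v, g (f v) = -v)
    (hfg : ∀ w, f (g w) = -w) : V ≃ₗ[ℂ] W where
  toFun := f
  map_add' := f.map_add
  map_smul' := f.map_smul
  invFun w := (-1 : ℂ) • g w
  left_inv v := by
    change (-1 : ℂ) • g (f v) = v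
    rw [hgf, neg_one_smul, neg_neg]
  right_inv w := by
    refine (f.map_smul (-1 : ℂ) (g w)).trans ?_
    rw [hfg, neg_one_smul, neg_neg]

end LinearAlgebra

section SymbolIso

variable {n : ℕ} {M : Type u} [TopologicalSpace M]
  [ChartedSpace (EuclideanSpace ℝ (Fin (2 * n))) M] [IsManifold (𝓡 (2 * n)) ∞ M]
  [RiemannianBundle (fun x : M => TangentSpace (𝓡 (2 * n)) x)]

local notation "𝔼" => EuclideanSpace ℝ (Fin (2 * n))

theorem cliffordAt_cliffordAt (o : ManifoldOrientation n M) (p : Cotangent n M)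
    (v : ExtFiber n p.proj) : cliffordAt o p.proj p.snd (cliffordAt o p.proj p.snd v) =
      -((‖p.snd‖ ^ 2 : ℝ) : ℂ) • v :=
  clifford_clifford (V := TangentSpace (𝓡 (2 * n)) p.proj) (o.orient p.proj) p.snd v

section Continuity

variable {W W' : ∀ x : M, Submodule ℂ (ExtFiber n x)}
  {Z : Type*} [TopologicalSpace Z]

theorem continuous_liftToDisc_pt {g : Z → CodiscBundle n M} (hg : Continuous g)
    {s : ∀ z, W (g z).1.proj} (hs : ContinuousForms (fun z => (g z).1.proj) (fun z => (s z).1)) :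
    Continuous (fun z => (liftToDisc W).pt (g z) (s z)) :=
  VectFamily.continuous_pullback_mk hg (continuous_subFamily_pt_iff.2 hs)

theorem continuous_liftToDisc_proj : Continuous fun p : (liftToDisc W).Total => p.proj :=
  VectFamily.continuous_pullback_proj _ _

theorem ContinuousForms.of_liftToDisc {g : Z → CodiscBundle n M}
    {s : ∀ z, W (g z).1.proj} (h : Continuous (fun z => (liftToDisc W).pt (g z) (s z))) :
    ContinuousForms (fun z => (g z).1.proj) (fun z => (s z).1) :=
  continuous_subFamily_pt_iff.1 ((VectFamily.continuous_pullback_pt _ _).comp h)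

theorem continuousForms_liftToDisc_snd (W : ∀ x : M, Submodule ℂ (ExtFiber n x)) :
    ContinuousForms (fun p : (liftToDisc W).Total => p.proj.1.proj) (fun p => p.snd.1) :=
  ContinuousForms.of_liftToDisc (W := W) continuous_id

theorem continuous_restrict_cosphere_pt
    {s : ∀ p : ((liftToDisc W).restrict (cosphere n M)).Total, W' p.proj.1.1.proj}
    (hs : ContinuousForms (fun p : ((liftToDisc W).restrict (cosphere n M)).Total =>
      p.proj.1.1.proj) (fun p => (s p).1)) :
    Continuous fun p : ((liftToDisc W).restrict (cosphere n M)).Total =>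
      ((liftToDisc W').restrict (cosphere n M)).pt p.proj (s p) := by
  have h : Continuous fun p : ((liftToDisc W).restrict (cosphere n M)).Total => p.proj :=
    VectFamily.continuous_pullback_proj _ _
  exact VectFamily.continuous_pullback_mk h
    (continuous_liftToDisc_pt (continuous_subtype_val.comp h) hs)

theorem continuousForms_restrict_cosphere_snd (W : ∀ x : M, Submodule ℂ (ExtFiber n x)) :
    ContinuousForms (fun p : ((liftToDisc W).restrict (cosphere n M)).Total => p.proj.1.1.proj)
      (fun p => p.snd.1) := by
  have h : Continuous fun p : ((liftToDisc W).restrict (cosphere n M)).Total =>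
      (liftToDisc W).pt p.proj.1 p.snd := VectFamily.continuous_pullback_pt _ _
  exact ContinuousForms.of_liftToDisc h

theorem continuous_restrict_cosphere_base (W : ∀ x : M, Submodule ℂ (ExtFiber n x)) :
    Continuous fun p : ((liftToDisc W).restrict (cosphere n M)).Total => p.proj.1.1 := by
  have h : Continuous fun p : ((liftToDisc W).restrict (cosphere n M)).Total => p.proj :=
    VectFamily.continuous_pullback_proj _ _
  have h' : Continuous (Subtype.val : cosphere n M → CodiscBundle n M) := continuous_subtype_val
  have h'' : Continuous (Subtype.val : CodiscBundle n M → Cotangent n M) := continuous_subtype_val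
  exact h''.comp (h'.comp h)

end Continuity

variable [IsContMDiffRiemannianBundle (𝓡 (2 * n)) ∞ (EuclideanSpace ℝ (Fin (2 * n)))
      (fun x : M => TangentSpace (𝓡 (2 * n)) x)]

theorem isLocallyTrivial_liftToDisc {o : ManifoldOrientation n M}
    {W : ∀ x : M, Submodule ℂ (ExtFiber n x)} (P : FormProjector o W) :
    (liftToDisc W).IsLocallyTrivial :=
  VectFamily.isLocallyTrivial_pullback (isLocallyTrivial_subFamily P)
    (continuous_proj_cotangent.comp continuous_subtype_val)

/-- A pair of subbundles of `Λ^*` which are interchanged by the operator `D`. -/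
structure CliffordPair (o : ManifoldOrientation n M)
    (W₁ W₂ : ∀ x : M, Submodule ℂ (ExtFiber n x)) where
  left : FormProjector o W₁
  right : FormProjector o W₂
  mapsTo : ∀ s, IsSmoothSection W₁ s → IsSmoothSection W₂ (hodgeDirac o s)
  mapsTo_symm : ∀ s, IsSmoothSection W₂ s → IsSmoothSection W₁ (hodgeDirac o s)

namespace CliffordPair

variable {o : ManifoldOrientation n M} {W₁ W₂ : ∀ x : M, Submodule ℂ (ExtFiber n x)}

/-- The pair with the roles of the two subbundles interchanged. -/
def symm (S : CliffordPair o W₁ W₂) : CliffordPair o W₂ W₁ :=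
  ⟨S.right, S.left, S.mapsTo_symm, S.mapsTo⟩

variable [T2Space M]

/-- The leading symbol of `D`. -/
noncomputable def symbol (S : CliffordPair o W₁ W₂) (p : Cotangent n M) :
    W₁ p.proj →ₗ[ℂ] W₂ p.proj :=
  (cliffordAt o p.proj p.snd).restrict fun _ hv => S.left.cliffordAt_mem S.mapsTo _ _ hv

theorem symm_symbol_symbol (S : CliffordPair o W₁ W₂) (p : Cotangent n M) (v : W₁ p.proj) :
    S.symm.symbol p (S.symbol p v) = -((‖p.snd‖ ^ 2 : ℝ) : ℂ) • v :=
  Subtype.ext (cliffordAt_cliffordAt o p v.1)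

theorem symbol_symm_symbol (S : CliffordPair o W₁ W₂) (p : Cotangent n M) (v : W₂ p.proj) :
    S.symbol p (S.symm.symbol p v) = -((‖p.snd‖ ^ 2 : ℝ) : ℂ) • v :=
  Subtype.ext (cliffordAt_cliffordAt o p v.1)

/-- Every covector is a differential and every vector of `W₁` extends to a smooth section, so the
defining identity fixes the symbol everywhere. -/
theorem isPrincipalSymbol_iff (S : CliffordPair o W₁ W₂)
    (σ : ∀ p : Cotangent n M, W₁ p.proj →ₗ[ℂ] W₂ p.proj) :
    IsPrincipalSymbol W₁ W₂ (hodgeDirac o) σ ↔ ∀ p, σ p = S.symbol p := by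
  constructor
  · rintro h ⟨x, ξ⟩
    ext1 ⟨v, hv⟩
    obtain ⟨s, hs, rfl⟩ := S.left.exists_isSmoothSection hv
    obtain ⟨f, hf, hfx, rfl⟩ := exists_contMDiff_mfderiv_eq x ξ
    exact Subtype.ext ((h x f s hs hf hfx).trans (hodgeDirac_smul_of_eq_zero o hs.1 hf hfx))
  · intro h x f s hs hf hfx
    refine Eq.trans ?_ (hodgeDirac_smul_of_eq_zero o hs.1 hf hfx).symm
    exact congrArg (fun L : W₁ x →ₗ[ℂ] W₂ x => (L ⟨s x, hs.2 x⟩ : ExtFiber n x)) (h ⟨x, _⟩)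

/-- The symbols in the two directions compose to the scalar `-|ξ|²`, which is nonzero off the zero
section. -/
theorem symbol_bijective (S : CliffordPair o W₁ W₂) {p : Cotangent n M} (hp : p.snd ≠ 0) :
    Function.Bijective (S.symbol p) := by
  have hp' : ‖p.snd‖ ≠ 0 :=
    (norm_ne_zero_iff (a := (p.snd : TangentSpace (𝓡 (2 * n)) p.proj →L[ℝ] ℝ))).2 hp
  have hc : -((‖p.snd‖ ^ 2 : ℝ) : ℂ) ≠ 0 :=
    neg_ne_zero.2 (Complex.ofReal_ne_zero.2 (pow_ne_zero 2 hp'))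
  exact LinearMap.bijective_of_comp_eq_smul (S.symbol p) (S.symm.symbol p) hc
    (S.symm_symbol_symbol p) (S.symbol_symm_symbol p)

theorem symm_symbol_symbol_of_norm_eq_one (S : CliffordPair o W₁ W₂) {p : Cotangent n M}
    (hp : ‖p.snd‖ = 1) (v : W₁ p.proj) : S.symm.symbol p (S.symbol p v) = -v := by
  refine (S.symm_symbol_symbol p v).trans ?_
  rw [hp, one_pow, Complex.ofReal_one]
  exact neg_one_smul ℂ v

theorem symbol_symm_symbol_of_norm_eq_one (S : CliffordPair o W₁ W₂) {p : Cotangent n M}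
    (hp : ‖p.snd‖ = 1) (v : W₂ p.proj) : S.symbol p (S.symm.symbol p v) = -v := by
  refine (S.symbol_symm_symbol p v).trans ?_
  rw [hp, one_pow, Complex.ofReal_one]
  exact neg_one_smul ℂ v

theorem continuousForms_symbol (S : CliffordPair o W₁ W₂) {Z : Type*} [TopologicalSpace Z]
    {g : Z → Cotangent n M} (hg : Continuous g) {s : ∀ z, W₁ (g z).proj}
    (hs : ContinuousForms (fun z => (g z).proj) (fun z => (s z).1)) :
    ContinuousForms (fun z => (g z).proj) (fun z => (S.symbol (g z) (s z)).1) :=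
  hs.clifford o hg

/-- The leading symbol of `D` over the unit sphere bundle. -/
noncomputable def symbolIso (S : CliffordPair o W₁ W₂) :
    VectFamily.Iso ((liftToDisc W₁).restrict (cosphere n M))
      ((liftToDisc W₂).restrict (cosphere n M)) where
  equiv p := LinearEquiv.ofCompEqNeg (V := W₁ p.1.1.proj) (W := W₂ p.1.1.proj) (S.symbol p.1.1)
    (S.symm.symbol p.1.1) (S.symm_symbol_symbol_of_norm_eq_one p.2)
    (S.symbol_symm_symbol_of_norm_eq_one p.2)
  continuous_hom := continuous_restrict_cosphere_pt (W := W₁) (W' := W₂)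
    (s := fun p => S.symbol p.proj.1.1 p.snd)
    (S.continuousForms_symbol (continuous_restrict_cosphere_base W₁)
      (continuousForms_restrict_cosphere_snd W₁))
  continuous_inv := continuous_restrict_cosphere_pt (W := W₂) (W' := W₁)
    (s := fun p => (-1 : ℂ) • S.symm.symbol p.proj.1.1 p.snd)
    ((S.symm.continuousForms_symbol (continuous_restrict_cosphere_base W₂)
      (continuousForms_restrict_cosphere_snd W₂)).smul continuous_const)

theorem exists_class [CompactSpace M] (S : CliffordPair o W₁ W₂) :
    ∃ c, IsDifferenceClass (liftToDisc W₁) (liftToDisc W₂) S.symbolIso c :=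
  exists_isDifferenceClass isClosed_cosphere (isLocallyTrivial_liftToDisc S.left)
    (isLocallyTrivial_liftToDisc S.right) _

/-- The symbol is forced, hence so is the isomorphism over the sphere bundle; its difference class
is unique. -/
theorem isSymbolClass_iff [CompactSpace M] (S : CliffordPair o W₁ W₂) {c₀ : KCotangent n M}
    (h₀ : IsDifferenceClass (liftToDisc W₁) (liftToDisc W₂) S.symbolIso c₀) (c : KCotangent n M) :
    IsSymbolClass W₁ W₂ (hodgeDirac o) c ↔ c = c₀ := by
  constructor
  · rintro ⟨-, σ, hσ, -, Φ, hΦ, hc⟩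
    refine IsDifferenceClass.unique isClosed_cosphere (hc.trans (VectFamily.Iso.refl _)
      (VectFamily.Iso.refl _) fun p v => ?_) h₀
    exact (((hΦ p v).trans (congrArg (fun L : W₁ p.1.1.proj →ₗ[ℂ] W₂ p.1.1.proj => L v)
      ((S.isPrincipalSymbol_iff σ).1 hσ p.1.1)))).symm
  · rintro rfl
    exact ⟨S.mapsTo, S.symbol, (S.isPrincipalSymbol_iff _).2 fun _ => rfl,
      fun p hp => S.symbol_bijective hp, S.symbolIso, fun _ _ => rfl, h₀⟩

end CliffordPair

end SymbolIso

/-! ### Splittings of the subbundles and of the symbol. -/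

section SplitEquiv

/-- The decomposition of a subspace given by two projections. -/
def Submodule.splitEquiv {N : Type*} [AddCommMonoid N] [Module ℂ N] {W W₁ W₂ : Submodule ℂ N}
    (hle₁ : W₁ ≤ W) (hle₂ : W₂ ≤ W) (P₁ P₂ : N →ₗ[ℂ] N) (h₁ : ∀ v, P₁ v ∈ W₁)
    (h₂ : ∀ v, P₂ v ∈ W₂) (h₁₂ : ∀ v ∈ W, P₁ v + P₂ v = v) (e₁ : ∀ v ∈ W₁, P₁ v = v)
    (e₂ : ∀ v ∈ W₂, P₂ v = v) (z₁ : ∀ v ∈ W₂, P₁ v = 0) (z₂ : ∀ v ∈ W₁, P₂ v = 0) :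
    W ≃ₗ[ℂ] W₁ × W₂ where
  toFun v := (⟨P₁ v.1, h₁ _⟩, ⟨P₂ v.1, h₂ _⟩)
  map_add' v w := Prod.ext (Subtype.ext (P₁.map_add _ _)) (Subtype.ext (P₂.map_add _ _))
  map_smul' c v := Prod.ext (Subtype.ext (P₁.map_smul _ _)) (Subtype.ext (P₂.map_smul _ _))
  invFun p := ⟨p.1.1 + p.2.1, W.add_mem (hle₁ p.1.2) (hle₂ p.2.2)⟩
  left_inv v := Subtype.ext (h₁₂ v.1 v.2)
  right_inv p := by
    refine Prod.ext (Subtype.ext ?_) (Subtype.ext ?_)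
    · exact (P₁.map_add _ _).trans (by rw [e₁ _ p.1.2, z₁ _ p.2.2, add_zero])
    · exact (P₂.map_add _ _).trans (by rw [e₂ _ p.2.2, z₂ _ p.1.2, zero_add])

/-- The rotation `(a, b) ↦ (f a + s b, g b + s a)`, for maps with `g f = f g = -r` and
`r + s ^ 2 = 1`. -/
def LinearEquiv.rotation {V W : Type*} [AddCommMonoid V] [Module ℂ V] [AddCommMonoid W]
    [Module ℂ W] (f : V →ₗ[ℂ] W) (g : W →ₗ[ℂ] V) {r s : ℂ} (hrs : r + s * s = 1)
    (hgf : ∀ v, g (f v) = -r • v) (hfg : ∀ w, f (g w) = -r • w) : (V × W) ≃ₗ[ℂ] (W × V) where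
  toFun p := (f p.1 + s • p.2, g p.2 + s • p.1)
  map_add' p q := by
    simp only [Prod.fst_add, Prod.snd_add, map_add, smul_add, Prod.mk_add_mk]
    refine Prod.ext ?_ ?_ <;> exact add_add_add_comm _ _ _ _
  map_smul' c p := by
    refine Prod.ext ?_ ?_
    · change f (c • p.1) + s • c • p.2 = c • (f p.1 + s • p.2)
      rw [f.map_smul, smul_comm s, smul_add]
    · change g (c • p.2) + s • c • p.1 = c • (g p.2 + s • p.1)
      rw [g.map_smul, smul_comm s, smul_add]
  -- The adjugate pattern: the off-diagonal `s` is kept and the maps change sign. In the composition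
  -- the mixed terms cancel and the rest is `r + s²`.
  invFun q := ((-1 : ℂ) • g q.1 + s • q.2, (-1 : ℂ) • f q.2 + s • q.1)
  left_inv p := by
    refine Prod.ext ?_ ?_
    · change (-1 : ℂ) • g (f p.1 + s • p.2) + s • (g p.2 + s • p.1) = p.1
      rw [g.map_add, g.map_smul, hgf]
      match_scalars
      · linear_combination hrs
      · ring
    · change (-1 : ℂ) • f (g p.2 + s • p.1) + s • (f p.1 + s • p.2) = p.2
      rw [f.map_add, f.map_smul, hfg]
      match_scalars
      · linear_combination hrs
      · ring
  right_inv q := by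
    refine Prod.ext ?_ ?_
    · change f ((-1 : ℂ) • g q.1 + s • q.2) + s • ((-1 : ℂ) • f q.2 + s • q.1) = q.1
      rw [f.map_add, f.map_smul, f.map_smul, hfg]
      match_scalars
      · linear_combination hrs
      · ring
    · change g ((-1 : ℂ) • f q.2 + s • q.1) + s • ((-1 : ℂ) • g q.1 + s • q.2) = q.2
      rw [g.map_add, g.map_smul, g.map_smul, hgf]
      match_scalars
      · linear_combination hrs
      · ring

end SplitEquiv

section SplitIso

variable {n : ℕ} {M : Type u} [TopologicalSpace M]
  [ChartedSpace (EuclideanSpace ℝ (Fin (2 * n))) M] [IsManifold (𝓡 (2 * n)) ∞ M]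
  [RiemannianBundle (fun x : M => TangentSpace (𝓡 (2 * n)) x)]
  [IsContMDiffRiemannianBundle (𝓡 (2 * n)) ∞ (EuclideanSpace ℝ (Fin (2 * n)))
      (fun x : M => TangentSpace (𝓡 (2 * n)) x)]

local notation "𝔼" => EuclideanSpace ℝ (Fin (2 * n))

variable {o : ManifoldOrientation n M} {W W₁ W₂ W' W₁' W₂' : ∀ x : M, Submodule ℂ (ExtFiber n x)}

/-- Two projections decompose a family of subspaces. -/
structure FormProjector.Splits (P₁ : FormProjector o W₁) (P₂ : FormProjector o W₂)
    (W : ∀ x : M, Submodule ℂ (ExtFiber n x)) : Prop where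
  left_le : ∀ x, W₁ x ≤ W x
  right_le : ∀ x, W₂ x ≤ W x
  add_eq : ∀ x, ∀ v ∈ W x, P₁.proj x v + P₂.proj x v = v

theorem FormProjector.Splits.right_eq_zero {P₁ : FormProjector o W₁} {P₂ : FormProjector o W₂}
    (h : P₁.Splits P₂ W) (x : M) (v : ExtFiber n x) (hv : v ∈ W₁ x) : P₂.proj x v = 0 := by
  have := h.add_eq x v (h.left_le x hv)
  rw [P₁.proj_eq x v hv] at this
  exact left_eq_add.1 this.symm

theorem FormProjector.Splits.left_eq_zero {P₁ : FormProjector o W₁} {P₂ : FormProjector o W₂}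
    (h : P₁.Splits P₂ W) (x : M) (v : ExtFiber n x) (hv : v ∈ W₂ x) : P₁.proj x v = 0 := by
  have := h.add_eq x v (h.right_le x hv)
  rw [P₂.proj_eq x v hv] at this
  exact right_eq_add.1 this.symm

/-- The decomposition of the pullback to the disc bundle given by two projections. -/
noncomputable def FormProjector.Splits.iso {P₁ : FormProjector o W₁} {P₂ : FormProjector o W₂}
    (h : P₁.Splits P₂ W) :
    VectFamily.Iso (liftToDisc W) ((liftToDisc W₁).directSum (liftToDisc W₂)) where
  equiv p := Submodule.splitEquiv (h.left_le p.1.proj) (h.right_le p.1.proj) (P₁.proj p.1.proj)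
    (P₂.proj p.1.proj) (P₁.proj_mem _) (P₂.proj_mem _) (h.add_eq _) (P₁.proj_eq _) (P₂.proj_eq _)
    (h.left_eq_zero _) (h.right_eq_zero _)
  continuous_hom := by
    have hs := continuousForms_liftToDisc_snd W
    exact VectFamily.continuous_directSum_mk
      (continuous_liftToDisc_pt (W := W₁) continuous_liftToDisc_proj (hs.proj P₁))
      (continuous_liftToDisc_pt (W := W₂) continuous_liftToDisc_proj (hs.proj P₂))
  continuous_inv := by
    have h1 := VectFamily.continuous_directSum_fst (liftToDisc W₁) (liftToDisc W₂)
    have h2 := VectFamily.continuous_directSum_snd (liftToDisc W₁) (liftToDisc W₂)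
    have hs := ContinuousForms.of_liftToDisc (W := W₁) h1
    have ht := ContinuousForms.of_liftToDisc (W := W₂) h2
    exact continuous_liftToDisc_pt (W := W) (continuous_liftToDisc_proj.comp h1) (hs.add ht)

namespace CliffordPair

variable [T2Space M]

/-- Clifford multiplication maps each summand into the corresponding one, and each projection kills
the other summand, so there are no cross terms. -/
theorem proj_cliffordAt {S₁ : CliffordPair o W₁ W₁'} {S₂ : CliffordPair o W₂ W₂'}
    (h : S₁.left.Splits S₂.left W) (h' : S₁.right.Splits S₂.right W') (x : M)
    (ξ : TangentSpace (𝓡 (2 * n)) x →L[ℝ] ℝ) {v : ExtFiber n x} (hv : v ∈ W x) :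
    S₁.right.proj x (cliffordAt o x ξ v) = cliffordAt o x ξ (S₁.left.proj x v) ∧
    S₂.right.proj x (cliffordAt o x ξ v) = cliffordAt o x ξ (S₂.left.proj x v) := by
  have h1 := S₁.left.cliffordAt_mem S₁.mapsTo x ξ (S₁.left.proj_mem x v)
  have h2 := S₂.left.cliffordAt_mem S₂.mapsTo x ξ (S₂.left.proj_mem x v)
  have hsum : cliffordAt o x ξ v =
      cliffordAt o x ξ (S₁.left.proj x v) + cliffordAt o x ξ (S₂.left.proj x v) := by
    rw [← map_add, h.add_eq x v hv]
  rw [hsum, map_add, map_add, S₁.right.proj_eq x _ h1, S₂.right.proj_eq x _ h2,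
    h'.left_eq_zero x _ h2, h'.right_eq_zero x _ h1, add_zero, zero_add]
  exact ⟨rfl, rfl⟩

end CliffordPair
end SplitIso

section SplitClass

variable {n : ℕ} {M : Type u} [TopologicalSpace M]
  [ChartedSpace (EuclideanSpace ℝ (Fin (2 * n))) M] [IsManifold (𝓡 (2 * n)) ∞ M]
  [RiemannianBundle (fun x : M => TangentSpace (𝓡 (2 * n)) x)]
  [IsContMDiffRiemannianBundle (𝓡 (2 * n)) ∞ (EuclideanSpace ℝ (Fin (2 * n)))
      (fun x : M => TangentSpace (𝓡 (2 * n)) x)]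
  [T2Space M]
  {o : ManifoldOrientation n M} {W W₁ W₂ W' W₁' W₂' : ∀ x : M, Submodule ℂ (ExtFiber n x)}

theorem FormProjector.Splits.iso_apply {P₁ : FormProjector o W₁} {P₂ : FormProjector o W₂}
    (h : P₁.Splits P₂ W) (p : CodiscBundle n M) (v : W p.1.proj) :
    h.iso.equiv p v = ((⟨P₁.proj _ v.1, P₁.proj_mem _ _⟩, ⟨P₂.proj _ v.1, P₂.proj_mem _ _⟩) :
      W₁ p.1.proj × W₂ p.1.proj) := rfl

namespace CliffordPair

theorem proj_symbol {S₁ : CliffordPair o W₁ W₁'} {S₂ : CliffordPair o W₂ W₂'}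
    (h : S₁.left.Splits S₂.left W) (h' : S₁.right.Splits S₂.right W') (S : CliffordPair o W W')
    (p : Cotangent n M) (v : W p.proj) :
    ((⟨S₁.right.proj _ (S.symbol p v).1, S₁.right.proj_mem _ _⟩,
      ⟨S₂.right.proj _ (S.symbol p v).1, S₂.right.proj_mem _ _⟩) : W₁' p.proj × W₂' p.proj) =
    (S₁.symbol p ⟨S₁.left.proj _ v.1, S₁.left.proj_mem _ _⟩,
      S₂.symbol p ⟨S₂.left.proj _ v.1, S₂.left.proj_mem _ _⟩) := by
  have hh := proj_cliffordAt h h' p.proj p.snd v.2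
  have h1 : (⟨S₁.right.proj _ (S.symbol p v).1, S₁.right.proj_mem _ _⟩ : W₁' p.proj) =
    S₁.symbol p ⟨S₁.left.proj _ v.1, S₁.left.proj_mem _ _⟩ := Subtype.ext hh.1
  have h2 : (⟨S₂.right.proj _ (S.symbol p v).1, S₂.right.proj_mem _ _⟩ : W₂' p.proj) =
    S₂.symbol p ⟨S₂.left.proj _ v.1, S₂.left.proj_mem _ _⟩ := Subtype.ext hh.2
  exact congrArg₂ Prod.mk h1 h2

theorem iso_symbolIso {S₁ : CliffordPair o W₁ W₁'} {S₂ : CliffordPair o W₂ W₂'}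
    (h : S₁.left.Splits S₂.left W) (h' : S₁.right.Splits S₂.right W') (S : CliffordPair o W W')
    (p : cosphere n M) (v : W p.1.1.proj) :
    h'.iso.equiv p.1 (S.symbolIso.equiv p v) =
    ((S₁.symbolIso.restrictSum S₂.symbolIso).equiv p (h.iso.equiv p.1 v)) :=
  (h'.iso_apply p.1 (S.symbol p.1.1 v)).trans (proj_symbol h h' S p.1.1 v)

/-- The symbol is block diagonal for the two splittings, and difference classes are additive. -/
theorem isDifferenceClass_of_splits (S : CliffordPair o W W')
    {S₁ : CliffordPair o W₁ W₁'} {S₂ : CliffordPair o W₂ W₂'}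
    (h : S₁.left.Splits S₂.left W) (h' : S₁.right.Splits S₂.right W') {c₁ c₂ : KCotangent n M}
    (hc₁ : IsDifferenceClass (liftToDisc W₁) (liftToDisc W₁') S₁.symbolIso c₁)
    (hc₂ : IsDifferenceClass (liftToDisc W₂) (liftToDisc W₂') S₂.symbolIso c₂) :
    IsDifferenceClass (liftToDisc W) (liftToDisc W') S.symbolIso (c₁ + c₂) :=
  (hc₁.directSum hc₂).trans h.iso h'.iso (iso_symbolIso h h' S)

end CliffordPair
end SplitClass

theorem ofReal_sq_add_sqrt_mul_sqrt {r : ℝ} (h0 : 0 ≤ r) (h1 : r ≤ 1) :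
    ((r ^ 2 : ℝ) : ℂ) + ((√(1 - r ^ 2) : ℝ) : ℂ) * ((√(1 - r ^ 2) : ℝ) : ℂ) = 1 := by
  rw [← Complex.ofReal_mul, Real.mul_self_sqrt (by nlinarith), ← Complex.ofReal_add]
  simp

/-! ### The symbols in the two directions have opposite classes. -/

section Rotation

variable {n : ℕ} {M : Type u} [TopologicalSpace M]
  [ChartedSpace (EuclideanSpace ℝ (Fin (2 * n))) M] [IsManifold (𝓡 (2 * n)) ∞ M]
  [RiemannianBundle (fun x : M => TangentSpace (𝓡 (2 * n)) x)]
  [IsContMDiffRiemannianBundle (𝓡 (2 * n)) ∞ (EuclideanSpace ℝ (Fin (2 * n)))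
      (fun x : M => TangentSpace (𝓡 (2 * n)) x)]
  [T2Space M]
  {o : ManifoldOrientation n M} {W₁ W₂ : ∀ x : M, Submodule ℂ (ExtFiber n x)}

namespace CliffordPair

theorem ofReal_norm_sq_add (p : CodiscBundle n M) :
    ((‖p.1.snd‖ ^ 2 : ℝ) : ℂ) + ((√(1 - ‖p.1.snd‖ ^ 2) : ℝ) : ℂ) * ((√(1 - ‖p.1.snd‖ ^ 2) : ℝ) : ℂ) =
      1 :=
  ofReal_sq_add_sqrt_mul_sqrt
    (norm_nonneg (p.1.snd : TangentSpace (𝓡 (2 * n)) p.1.proj →L[ℝ] ℝ)) p.2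

theorem continuous_sqrt_norm : Continuous fun p : CodiscBundle n M =>
    ((√(1 - ‖p.1.snd‖ ^ 2) : ℝ) : ℂ) := by
  have h : Continuous fun p : CodiscBundle n M => ‖p.1.snd‖ :=
    continuous_norm_cotangent.comp continuous_subtype_val
  exact Complex.continuous_ofReal.comp (Real.continuous_sqrt.comp (continuous_const.sub (h.pow 2)))

theorem continuousForms_symbol_add (S : CliffordPair o W₁ W₂) {Z : Type*} [TopologicalSpace Z]
    {g : Z → CodiscBundle n M} (hg : Continuous g) {s : ∀ z, W₁ (g z).1.proj}
    {t : ∀ z, W₂ (g z).1.proj}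
    (hs : ContinuousForms (fun z => (g z).1.proj) (fun z => (s z).1))
    (ht : ContinuousForms (fun z => (g z).1.proj) (fun z => (t z).1)) :
    Continuous (fun z => (liftToDisc W₂).pt (g z)
      (S.symbol (g z).1 (s z) + ((√(1 - ‖(g z).1.snd‖ ^ 2) : ℝ) : ℂ) • t z)) :=
  continuous_liftToDisc_pt hg ((S.continuousForms_symbol (continuous_subtype_val.comp hg) hs).add
    (ht.smul (continuous_sqrt_norm.comp hg)))

theorem continuousForms_neg_symbol_add (S : CliffordPair o W₁ W₂) {Z : Type*} [TopologicalSpace Z]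
    {g : Z → CodiscBundle n M} (hg : Continuous g) {s : ∀ z, W₁ (g z).1.proj}
    {t : ∀ z, W₂ (g z).1.proj}
    (hs : ContinuousForms (fun z => (g z).1.proj) (fun z => (s z).1))
    (ht : ContinuousForms (fun z => (g z).1.proj) (fun z => (t z).1)) :
    Continuous (fun z => (liftToDisc W₂).pt (g z)
      ((-1 : ℂ) • S.symbol (g z).1 (s z) + ((√(1 - ‖(g z).1.snd‖ ^ 2) : ℝ) : ℂ) • t z)) :=
  continuous_liftToDisc_pt hg
    (((S.continuousForms_symbol (continuous_subtype_val.comp hg) hs).smul continuous_const).add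
      (ht.smul (continuous_sqrt_norm.comp hg)))

/-- An isomorphism over the disc bundle which extends the direct sum of the symbols of `D` in the
two directions. -/
noncomputable def rotationIso (S : CliffordPair o W₁ W₂) :
    VectFamily.Iso ((liftToDisc W₁).directSum (liftToDisc W₂))
      ((liftToDisc W₂).directSum (liftToDisc W₁)) where
  equiv p := LinearEquiv.rotation (S.symbol p.1) (S.symm.symbol p.1) (ofReal_norm_sq_add p)
    (S.symm_symbol_symbol p.1) (S.symbol_symm_symbol p.1)
  continuous_hom := by
    have h1 := VectFamily.continuous_directSum_fst (liftToDisc W₁) (liftToDisc W₂)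
    have h2 := VectFamily.continuous_directSum_snd (liftToDisc W₁) (liftToDisc W₂)
    have hb := continuous_liftToDisc_proj.comp h1
    have ha := ContinuousForms.of_liftToDisc (W := W₁) h1
    have ha' := ContinuousForms.of_liftToDisc (W := W₂) h2
    exact VectFamily.continuous_directSum_mk (S.continuousForms_symbol_add hb ha ha')
      (S.symm.continuousForms_symbol_add hb ha' ha)
  continuous_inv := by
    have h1 := VectFamily.continuous_directSum_fst (liftToDisc W₂) (liftToDisc W₁)
    have h2 := VectFamily.continuous_directSum_snd (liftToDisc W₂) (liftToDisc W₁)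
    have hb := continuous_liftToDisc_proj.comp h1
    have ha := ContinuousForms.of_liftToDisc (W := W₂) h1
    have ha' := ContinuousForms.of_liftToDisc (W := W₁) h2
    exact VectFamily.continuous_directSum_mk (S.symm.continuousForms_neg_symbol_add hb ha ha')
      (S.continuousForms_neg_symbol_add hb ha' ha)

theorem rotation_symbol (S : CliffordPair o W₁ W₂) (p : Cotangent n M) {s : ℂ} (hs : s = 0)
    (v : W₁ p.proj × W₂ p.proj) :
    ((S.symbol p v.1 + s • v.2, S.symm.symbol p v.2 + s • v.1) : W₂ p.proj × W₁ p.proj) =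
      (S.symbol p v.1, S.symm.symbol p v.2) := by
  subst hs
  have h1 : S.symbol p v.1 + (0 : ℂ) • v.2 = S.symbol p v.1 :=
    (congrArg (S.symbol p v.1 + ·) (zero_smul ℂ v.2)).trans (add_zero _)
  have h2 : S.symm.symbol p v.2 + (0 : ℂ) • v.1 = S.symm.symbol p v.2 :=
    (congrArg (S.symm.symbol p v.2 + ·) (zero_smul ℂ v.1)).trans (add_zero _)
  exact congrArg₂ Prod.mk h1 h2

/-- On the unit sphere the off-diagonal coefficient `√(1 - |ξ|²)` vanishes. -/
theorem rotationIso_apply (S : CliffordPair o W₁ W₂) (p : cosphere n M)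
    (v : W₁ p.1.1.proj × W₂ p.1.1.proj) :
    S.rotationIso.equiv p.1 v = (S.symbolIso.restrictSum S.symm.symbolIso).equiv p v := by
  have hs : ((√(1 - ‖p.1.1.snd‖ ^ 2) : ℝ) : ℂ) = 0 := by
    have : ‖p.1.1.snd‖ = 1 := p.2
    rw [this]
    simp
  exact S.rotation_symbol p.1.1 hs v

/-- The direct sum of the two symbols extends to an isomorphism over the whole disc bundle, so its
class is zero. -/
theorem add_eq_zero [CompactSpace M] (S : CliffordPair o W₁ W₂) {c c' : KCotangent n M}
    (hc : IsDifferenceClass (liftToDisc W₁) (liftToDisc W₂) S.symbolIso c)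
    (hc' : IsDifferenceClass (liftToDisc W₂) (liftToDisc W₁) S.symm.symbolIso c') : c + c' = 0 :=
  (hc.directSum hc').eq_zero isClosed_cosphere S.rotationIso S.rotationIso_apply

end CliffordPair
end Rotation

/-! ### The four common subbundles and the main theorem. -/

section Conclusion

variable {n : ℕ} {M : Type u} [TopologicalSpace M]
  [ChartedSpace (EuclideanSpace ℝ (Fin (2 * n))) M] [IsManifold (𝓡 (2 * n)) ∞ M]
  [RiemannianBundle (fun x : M => TangentSpace (𝓡 (2 * n)) x)]
  [IsContMDiffRiemannianBundle (𝓡 (2 * n)) ∞ (EuclideanSpace ℝ (Fin (2 * n)))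
      (fun x : M => TangentSpace (𝓡 (2 * n)) x)]

theorem FormProjector.splits_inf_left {o : ManifoldOrientation n M}
    {W W₁ W₂ : ∀ x : M, Submodule ℂ (ExtFiber n x)} (P : FormProjector o W)
    (P₁ : FormProjector o W₁) (P₂ : FormProjector o W₂)
    (h₁ : ∀ x, ∀ η ∈ W x, P₁.proj x η ∈ W x) (h₂ : ∀ x, ∀ η ∈ W x, P₂.proj x η ∈ W x)
    (h : ∀ x η, P₁.proj x η + P₂.proj x η = η) : (P.inf P₁ h₁).Splits (P.inf P₂ h₂) W where
  left_le _ := inf_le_left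
  right_le _ := inf_le_left
  add_eq x v hv := (h x (P.proj x v)).trans (P.proj_eq x v hv)

theorem FormProjector.splits_inf_right {o : ManifoldOrientation n M}
    {W W₁ W₂ : ∀ x : M, Submodule ℂ (ExtFiber n x)} (P : FormProjector o W)
    (P₁ : FormProjector o W₁) (P₂ : FormProjector o W₂)
    (h₁ : ∀ x, ∀ η ∈ W₁ x, P.proj x η ∈ W₁ x) (h₂ : ∀ x, ∀ η ∈ W₂ x, P.proj x η ∈ W₂ x)
    (h : ∀ x η, P₁.proj x η + P₂.proj x η = η) : (P₁.inf P h₁).Splits (P₂.inf P h₂) W where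
  left_le _ := inf_le_right
  right_le _ := inf_le_right
  add_eq x v hv := by
    change P.proj x (P₁.proj x v) + P.proj x (P₂.proj x v) = v
    rw [← map_add, h, P.proj_eq x v hv]

variable (o : ManifoldOrientation n M)

/-- The pair of subbundles on which the de Rham operator acts. -/
noncomputable def eulerPair : CliffordPair o (extEven n) (extOdd n) where
  left := evenProjector o
  right := oddProjector o
  mapsTo _ := IsSmoothSection.hodgeDirac_of_even o
  mapsTo_symm _ := IsSmoothSection.hodgeDirac_of_odd o

/-- The pair of subbundles on which the signature operator acts. -/
noncomputable def signaturePair : CliffordPair o (extPlus o) (extMinus o) where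
  left := plusProjector o
  right := minusProjector o
  mapsTo _ := IsSmoothSection.hodgeDirac_of_plus o
  mapsTo_symm _ := IsSmoothSection.hodgeDirac_of_minus o

/-- The pair of subbundles on which the common part of the de Rham operator and of the signature
operator acts. -/
noncomputable def evenPlusPair : CliffordPair o (fun x => extEven n x ⊓ extPlus o x)
    (fun x => extOdd n x ⊓ extMinus o x) where
  left := (evenProjector o).inf (plusProjector o) fun _ _ => tauProjector_mem_extEven o _
  right := (oddProjector o).inf (minusProjector o) fun _ _ => tauProjector_mem_extOdd o _
  mapsTo := IsSmoothSection.hodgeDirac_inf o (fun _ => IsSmoothSection.hodgeDirac_of_even o)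
    fun _ => IsSmoothSection.hodgeDirac_of_plus o
  mapsTo_symm := IsSmoothSection.hodgeDirac_inf o (fun _ => IsSmoothSection.hodgeDirac_of_odd o)
    fun _ => IsSmoothSection.hodgeDirac_of_minus o

/-- The even forms in `Λ^-` and the odd forms in `Λ^+`. -/
noncomputable def evenMinusPair : CliffordPair o (fun x => extEven n x ⊓ extMinus o x)
    (fun x => extOdd n x ⊓ extPlus o x) where
  left := (evenProjector o).inf (minusProjector o) fun _ _ => tauProjector_mem_extEven o _
  right := (oddProjector o).inf (plusProjector o) fun _ _ => tauProjector_mem_extOdd o _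
  mapsTo := IsSmoothSection.hodgeDirac_inf o (fun _ => IsSmoothSection.hodgeDirac_of_even o)
    fun _ => IsSmoothSection.hodgeDirac_of_minus o
  mapsTo_symm := IsSmoothSection.hodgeDirac_inf o (fun _ => IsSmoothSection.hodgeDirac_of_odd o)
    fun _ => IsSmoothSection.hodgeDirac_of_plus o

theorem splits_extEven :
    (evenPlusPair o).left.Splits (evenMinusPair o).left (extEven n) :=
  FormProjector.splits_inf_left _ _ _
    (fun _ _ => tauProjector_mem_extEven o _) (fun _ _ => tauProjector_mem_extEven o _)
    (plusProjector_add_minusProjector o)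

theorem splits_extOdd :
    (evenPlusPair o).right.Splits (evenMinusPair o).right (extOdd n) :=
  FormProjector.splits_inf_left _ _ _
    (fun _ _ => tauProjector_mem_extOdd o _) (fun _ _ => tauProjector_mem_extOdd o _)
    fun x η => (add_comm _ _).trans (plusProjector_add_minusProjector o x η)

/-- For the signature operator the second summand of the source consists of odd forms, so
`evenMinusPair` enters with its direction reversed; for the de Rham operator it enters unreversed.
This is the only difference between the two classes. -/
theorem splits_extPlus :
    (evenPlusPair o).left.Splits (evenMinusPair o).symm.left (extPlus o) :=
  FormProjector.splits_inf_right _ _ _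
    (fun _ _ => tauProjector_mem_extEven o _) (fun _ _ => tauProjector_mem_extOdd o _)
    (evenProjector_add_oddProjector o)

theorem splits_extMinus :
    (evenPlusPair o).right.Splits (evenMinusPair o).symm.right (extMinus o) :=
  FormProjector.splits_inf_right _ _ _
    (fun _ _ => tauProjector_mem_extOdd o _) (fun _ _ => tauProjector_mem_extEven o _)
    fun x η => (add_comm _ _).trans (evenProjector_add_oddProjector o x η)

end Conclusion

theorem mainTheorem1 {n : ℕ} {M : Type*} [TopologicalSpace M] [T2Space M] [CompactSpace M]
    [ChartedSpace (EuclideanSpace ℝ (Fin (2 * n))) M] [IsManifold (𝓡 (2 * n)) ∞ M]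
    [RiemannianBundle (fun x : M => TangentSpace (𝓡 (2 * n)) x)]
    [IsContMDiffRiemannianBundle (𝓡 (2 * n)) ∞ (EuclideanSpace ℝ (Fin (2 * n)))
      (fun x : M => TangentSpace (𝓡 (2 * n)) x)]
    (o : ManifoldOrientation n M) :
    ∃ euler sign mixed : KCotangent n M,
      (∀ c, IsSymbolClass (extEven n) (extOdd n) (hodgeDirac o) c ↔ c = euler) ∧
      (∀ c, IsSymbolClass (extPlus o) (extMinus o) (hodgeDirac o) c ↔ c = sign) ∧
      (∀ c, IsSymbolClass (fun x => extEven n x ⊓ extPlus o x) (fun x => extOdd n x ⊓ extMinus o x)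
        (hodgeDirac o) c ↔ c = mixed) ∧
      (∃ z : KCotangent n M, euler - sign = z + z) ∧
      euler + sign = mixed + mixed := by
  obtain ⟨a, ha⟩ := (evenPlusPair o).exists_class
  obtain ⟨b, hb⟩ := (evenMinusPair o).exists_class
  obtain ⟨b', hb'⟩ := (evenMinusPair o).symm.exists_class
  have hbb : b + b' = 0 := (evenMinusPair o).add_eq_zero hb hb'
  obtain rfl : b' = -b := eq_neg_of_add_eq_zero_right hbb
  -- The de Rham class is `a + b` and the signature class is `a - b`; hence their sum is `2a` and
  -- their difference is twice the witness `b`.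
  refine ⟨a + b, a + -b, a,
    (eulerPair o).isSymbolClass_iff ((eulerPair o).isDifferenceClass_of_splits
      (splits_extEven o) (splits_extOdd o) ha hb),
    (signaturePair o).isSymbolClass_iff ((signaturePair o).isDifferenceClass_of_splits
      (splits_extPlus o) (splits_extMinus o) ha hb'),
    (evenPlusPair o).isSymbolClass_iff ha, ⟨b, ?_⟩, ?_⟩
  · abel
  · abel
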